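/- Let $h_1,h_2,h_3\in\mathbb C$ with $h_1+h_2+h_3=0$ be generic, i.e. $h_1,h_2$ are linearly independent over $\mathbb Q$, and put $\sigma_2=h_1h_2+h_1h_3+h_2h_3$, $\sigma_3=h_1h_2h_3$. Let $\mathcal Y$ be the affine Yangian of $\mathfrak{gl}(1)$ with $\psi_0=1$: the associative $\mathbb C$-algebra with generators $e_j,f_j,\psi_j$ ($j\ge 0$) and relations $[\psi_j,\psi_k]=0$, $[e_j,f_k]=\psi_{j+k}$, $\psi_0=1$, $$[x_{j+3},y_k]-3[x_{j+2},y_{k+1}]+3[x_{j+1},y_{k+2}]-[x_j,y_{k+3}]+\sigma_2[x_{j+1},y_k]-\sigma_2[x_j,y_{k+1}]-\epsilon\sigma_3\{x_j,y_k\}=0$$ with $\epsilon=1$ for $(x,y)=(e,e),(\psi,e)$ and $\epsilon=-1$ for $(x,y)=(f,f),(\psi,f)$; $[\psi_0,e_j]=[\psi_1,e_j]=0$, $[\psi_2,e_j]=2e_j$, $[\psi_0,f_j]=[\psi_1,f_j]=0$, $[\psi_2,f_j]=-2f_j$; and $\mathrm{Sym}_{(j_1,j_2,j_3)}[x_{j_1},[x_{j_2},x_{j_3+1}]]=0$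 for $x=e,f$. A plane partition (3D Young diagram) is a finite set $\pi\subset\mathbb N^3$ of boxes closed under decreasing coordinates; $\pi^+$ and $\pi^-$ denote the sets of boxes that can be added to, resp. removed from, $\pi$. For a box $\square=(x,y,z)$ put $h_\square=h_1y+h_2x+h_3z$; let $\varphi(u)=\prod_{i=1}^3\frac{u+h_i}{u-h_i}$ and $\psi_\pi(u)=\frac{u+\sigma_3}{u}\prod_{\square\in\pi}\varphi(u-h_\square)$. A plane partition representation is a representation of $\mathcal Y$ on the space with basis $|\pi\rangle$ given by $$\Bigl(1+\sigma_3\sum_{j\ge0}\frac{\psi_j}{u^{j+1}}\Bigr)|\pi\rangle=\psi_\pi(u)|\pi\rangle,\quad e_j|\pi\rangle=\sum_{\square\in\pi^+}h_\square^jE(\pi\to\pi+\square)|\pi+\square\rangle,\quad f_j|\pi\rangle=-\sum_{\square\in\pi^-}h_\square^jE(\pi-\square\to\pi)|\pi-\square\rangle,$$ where each $E(\pi\to\pi+\square)$ is a square root of $\frac1{\sigma_3}\operatorname{res}_{u=h_\square}\psi_\pi(u)$. Let $|0\rangle$ be the basis vector of the empty diagram and $\langle0|A|0\rangle$ the coefficient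 of $|0\rangle$ in $A|0\rangle$. For $n\ge1$ let $a_{n,1}=-\frac1{(n-1)!}\mathrm{ad}_{f_1}^{n-1}f_0$ and $a_{-n,1}=\frac1{(n-1)!}\mathrm{ad}_{e_1}^{n-1}e_0$. On the representation space let, for $n\ge2$, $$a_{-n,2}=\tfrac1{(n-2)!}\mathrm{ad}_{e_1}^{n-2}\bigl([e_2,e_0]-\sigma_3[e_1,e_0]\bigr)-\sum_{i+j=-n}:a_{i,1}a_{j,1}:,$$ $$a_{n,2}=-\tfrac1{(n-2)!}\mathrm{ad}_{f_1}^{n-2}\bigl([f_2,f_0]-\sigma_3[f_1,f_0]\bigr)-\sum_{i+j=n}:a_{i,1}a_{j,1}:,$$ and $a_{0,2}=\psi_2-\sum_{i+j=0}:a_{i,1}a_{j,1}:=\psi_2-2\sum_{j\ge1}a_{-j,1}a_{j,1}$, where $i,j$ run over the non-zero integers and $:\ :$ puts the smaller index on the left (on each $|\pi\rangle$ only finitely many terms are non-zero). Write $P_{2,2}=a_{-2,2}$. Let $\mathcal Y^+\subset\mathcal Y$ be the subalgebra generated by the $e_j$, let $\tilde a$ be the anti-automorphism of $\mathcal Y$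 with $\tilde a(e_j)=-f_j$, $\tilde a(f_j)=-e_j$, $\tilde a(\psi_j)=\psi_j$, and let $\langle x|0\rangle,y|0\rangle\rangle=\langle0|\tilde a(y)x|0\rangle$ for $x,y\in\mathcal Y^+$. Then a plane partition representation exists, and in every plane partition representation: 1. for all $n\ge2$, $\ \langle0|a_{n,2}a_{-n,2}|0\rangle=-2\binom{n+1}{n-2}(1+\sigma_2+\sigma_3^2)$; 2. as operators on the representation space, $[a_{2,2},a_{-2,2}]=8a_{0,2}-2(1+\sigma_2+\sigma_3^2)$; 3. for all $n\ge0$, the vector $P_{2,2}^n|0\rangle$ lies in $\mathcal Y^+|0\rangle$, and $\ \langle P_{2,2}^n|0\rangle,P_{2,2}^n|0\rangle\rangle=n!\prod_{j=1}^n\bigl(-2(1+\sigma_2+\sigma_3^2)+16(j-1)\bigr)$, independently of how $P_{2,2}^n|0\rangle$ is written as an element of $\mathcal Y^+|0\rangle$. -/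

import Mathlib

noncomputable section

namespace PlanePartitionYangian

/-! ### Parameters

The parameters are `h 0 = h₁`, `h 1 = h₂`, `h 2 = h₃`. -/

/-- `σ₂ = h₁h₂ + h₁h₃ + h₂h₃`. -/
def sigma2 (h : Fin 3 → ℂ) : ℂ := h 0 * h 1 + h 0 * h 2 + h 1 * h 2

/-- `σ₃ = h₁h₂h₃`. -/
def sigma3 (h : Fin 3 → ℂ) : ℂ := h 0 * h 1 * h 2

/-! ### The affine Yangian of `gl(1)` with `ψ₀ = 1` -/

/-- The generators `e_j, f_j, ψ_j`. -/
inductive Gen : Type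
  | e (j : ℕ) : Gen
  | f (j : ℕ) : Gen
  | psi (j : ℕ) : Gen

/-- The free associative algebra on the generators. -/
abbrev Free : Type := FreeAlgebra ℂ Gen

/-- The generator `e_j` of the free algebra. -/
def Free.e (j : ℕ) : Free := FreeAlgebra.ι ℂ (Gen.e j)

/-- The generator `f_j` of the free algebra. -/
def Free.f (j : ℕ) : Free := FreeAlgebra.ι ℂ (Gen.f j)

/-- The generator `ψ_j` of the free algebra. -/
def Free.psi (j : ℕ) : Free := FreeAlgebra.ι ℂ (Gen.psi j)

/-- The expression
`[x_{j+3}, y_k] - 3[x_{j+2}, y_{k+1}] + 3[x_{j+1}, y_{k+2}] - [x_j, y_{k+3}]`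
`+ s₂[x_{j+1}, y_k] - s₂[x_j, y_{k+1}] - s₃{x_j, y_k}`. -/
def cubic {A : Type} [Ring A] [Algebra ℂ A] (s₂ s₃ : ℂ) (x y : ℕ → A) (j k : ℕ) : A :=
  ⁅x (j + 3), y k⁆ - (3 : ℂ) • ⁅x (j + 2), y (k + 1)⁆ + (3 : ℂ) • ⁅x (j + 1), y (k + 2)⁆
    - ⁅x j, y (k + 3)⁆ + s₂ • ⁅x (j + 1), y k⁆ - s₂ • ⁅x j, y (k + 1)⁆
    - s₃ • (x j * y k + y k * x j)

/-- The Serre expression `Sym_{(j₁,j₂,j₃)} [x_{j₁}, [x_{j₂}, x_{j₃+1}]]`, a sum of six terms. -/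
def serre {A : Type} [Ring A] (x : ℕ → A) (j : Fin 3 → ℕ) : A :=
  ∑ s : Equiv.Perm (Fin 3), ⁅x (j (s 0)), ⁅x (j (s 1)), x (j (s 2) + 1)⁆⁆

/-- The defining relations of the affine Yangian of `gl(1)`, with `ψ₀ = 1`. -/
inductive Rel (h : Fin 3 → ℂ) : Free → Free → Prop
  | psi_psi (j k : ℕ) : Rel h ⁅Free.psi j, Free.psi k⁆ 0
  | e_e (j k : ℕ) : Rel h (cubic (sigma2 h) (sigma3 h) Free.e Free.e j k) 0
  | f_f (j k : ℕ) : Rel h (cubic (sigma2 h) (-sigma3 h) Free.f Free.f j k) 0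
  | e_f (j k : ℕ) : Rel h ⁅Free.e j, Free.f k⁆ (Free.psi (j + k))
  | psi_e (j k : ℕ) : Rel h (cubic (sigma2 h) (sigma3 h) Free.psi Free.e j k) 0
  | psi_f (j k : ℕ) : Rel h (cubic (sigma2 h) (-sigma3 h) Free.psi Free.f j k) 0
  | psi0_e (j : ℕ) : Rel h ⁅Free.psi 0, Free.e j⁆ 0
  | psi1_e (j : ℕ) : Rel h ⁅Free.psi 1, Free.e j⁆ 0
  | psi2_e (j : ℕ) : Rel h ⁅Free.psi 2, Free.e j⁆ ((2 : ℂ) • Free.e j)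
  | psi0_f (j : ℕ) : Rel h ⁅Free.psi 0, Free.f j⁆ 0
  | psi1_f (j : ℕ) : Rel h ⁅Free.psi 1, Free.f j⁆ 0
  | psi2_f (j : ℕ) : Rel h ⁅Free.psi 2, Free.f j⁆ (-((2 : ℂ) • Free.f j))
  | serre_e (j : Fin 3 → ℕ) : Rel h (serre Free.e j) 0
  | serre_f (j : Fin 3 → ℕ) : Rel h (serre Free.f j) 0
  | psi0 : Rel h (Free.psi 0) 1

/-- The affine Yangian `𝒴` of `gl(1)` with `ψ₀ = 1`. -/
abbrev Yangian (h : Fin 3 → ℂ) : Type := RingQuot (Rel h)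

/-- The quotient map from the free algebra. -/
def Yangian.mk (h : Fin 3 → ℂ) : Free →ₐ[ℂ] Yangian h := RingQuot.mkAlgHom ℂ (Rel h)

/-- The generator `e_j` of `𝒴`. -/
def Yangian.e (h : Fin 3 → ℂ) (j : ℕ) : Yangian h := Yangian.mk h (Free.e j)

/-- The generator `f_j` of `𝒴`. -/
def Yangian.f (h : Fin 3 → ℂ) (j : ℕ) : Yangian h := Yangian.mk h (Free.f j)

/-- The generator `ψ_j` of `𝒴`. -/
def Yangian.psi (h : Fin 3 → ℂ) (j : ℕ) : Yangian h := Yangian.mk h (Free.psi j)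

/-- The subalgebra `𝒴⁺` generated by the `e_j`. -/
def Yangian.plus (h : Fin 3 → ℂ) : Subalgebra ℂ (Yangian h) :=
  Algebra.adjoin ℂ (Set.range (Yangian.e h))

theorem Yangian.mk_rel (h : Fin 3 → ℂ) {x y : Free} (r : Rel h x y) :
    Yangian.mk h x = Yangian.mk h y := RingQuot.mkAlgHom_rel ℂ r

theorem map_bracket {A B : Type} [Ring A] [Algebra ℂ A] [Ring B] [Algebra ℂ B]
    (g : A →ₐ[ℂ] B) (x y : A) : g ⁅x, y⁆ = ⁅g x, g y⁆ := by
  simp [Ring.lie_def]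

theorem map_cubic {A B : Type} [Ring A] [Algebra ℂ A] [Ring B] [Algebra ℂ B]
    (g : A →ₐ[ℂ] B) (s₂ s₃ : ℂ) (x y : ℕ → A) (j k : ℕ) :
    g (cubic s₂ s₃ x y j k) = cubic s₂ s₃ (fun i => g (x i)) (fun i => g (y i)) j k := by
  simp only [cubic, map_add, map_sub, map_smul, map_mul, map_bracket]

theorem map_serre {A B : Type} [Ring A] [Algebra ℂ A] [Ring B] [Algebra ℂ B]
    (g : A →ₐ[ℂ] B) (x : ℕ → A) (j : Fin 3 → ℕ) :
    g (serre x j) = serre (fun i => g (x i)) j := by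
  simp only [serre, map_sum, map_bracket]

theorem bracket_op {A : Type} [Ring A] (x y : A) :
    ⁅MulOpposite.op x, MulOpposite.op y⁆ = -MulOpposite.op ⁅x, y⁆ := by
  simp [Ring.lie_def]

theorem bracket_neg_right {A : Type} [Ring A] (x y : A) : ⁅x, -y⁆ = -⁅x, y⁆ := by
  simp only [Ring.lie_def]
  noncomm_ring

theorem bracket_neg_left {A : Type} [Ring A] (x y : A) : ⁅-x, y⁆ = -⁅x, y⁆ := by
  simp only [Ring.lie_def]
  noncomm_ring

theorem neg_bracket {A : Type} [Ring A] (x y : A) : -⁅x, y⁆ = ⁅y, x⁆ := by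
  simp only [Ring.lie_def]
  noncomm_ring

theorem cubic_op {A : Type} [Ring A] [Algebra ℂ A] (s₂ s₃ : ℂ) (x y : ℕ → A) (j k : ℕ) :
    cubic s₂ s₃ (fun i => MulOpposite.op (x i)) (fun i => MulOpposite.op (y i)) j k
      = -MulOpposite.op (cubic s₂ (-s₃) x y j k) := by
  simp only [cubic, bracket_op, ← MulOpposite.op_mul, ← MulOpposite.op_add, ← MulOpposite.op_neg,
    ← MulOpposite.op_smul, ← MulOpposite.op_sub]
  congr 1
  rw [add_comm (y k * x j)]
  module

theorem cubic_neg {A : Type} [Ring A] [Algebra ℂ A] (s₂ s₃ : ℂ) (x y : ℕ → A) (j k : ℕ) :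
    cubic s₂ s₃ (fun i => -x i) (fun i => -y i) j k = cubic s₂ s₃ x y j k := by
  simp [cubic, Ring.lie_def]

theorem cubic_neg_right {A : Type} [Ring A] [Algebra ℂ A] (s₂ s₃ : ℂ) (x y : ℕ → A) (j k : ℕ) :
    cubic s₂ s₃ x (fun i => -y i) j k = -cubic s₂ s₃ x y j k := by
  simp only [cubic, Ring.lie_def, mul_neg, neg_mul]
  module

theorem serre_neg_op {A : Type} [Ring A] (x : ℕ → A) (j : Fin 3 → ℕ) :
    serre (fun i => MulOpposite.op (-x i)) j = -MulOpposite.op (serre x j) := by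
  have hs : MulOpposite.op (serre x j) = ∑ s : Equiv.Perm (Fin 3),
      MulOpposite.op ⁅x (j (s 0)), ⁅x (j (s 1)), x (j (s 2) + 1)⁆⁆ :=
    map_sum (MulOpposite.opAddEquiv : A ≃+ Aᵐᵒᵖ) _ _
  rw [hs, ← Finset.sum_neg_distrib]
  refine Finset.sum_congr rfl fun s _ => ?_
  simp only [bracket_op, bracket_neg_left, bracket_neg_right, neg_neg, ← MulOpposite.op_neg]

/-- The values of the anti-automorphism `ã` on the generators. -/
def antiGen (h : Fin 3 → ℂ) : Gen → (Yangian h)ᵐᵒᵖ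
  | Gen.e j => MulOpposite.op (-Yangian.f h j)
  | Gen.f j => MulOpposite.op (-Yangian.e h j)
  | Gen.psi j => MulOpposite.op (Yangian.psi h j)

theorem anti_rel (h : Fin 3 → ℂ) {x y : Free} (r : Rel h x y) :
    FreeAlgebra.lift ℂ (antiGen h) x = FreeAlgebra.lift ℂ (antiGen h) y := by
  have le (j : ℕ) : FreeAlgebra.lift ℂ (antiGen h) (Free.e j)
      = MulOpposite.op (-Yangian.f h j) := FreeAlgebra.lift_ι_apply _ _
  have lf (j : ℕ) : FreeAlgebra.lift ℂ (antiGen h) (Free.f j)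
      = MulOpposite.op (-Yangian.e h j) := FreeAlgebra.lift_ι_apply _ _
  have lp (j : ℕ) : FreeAlgebra.lift ℂ (antiGen h) (Free.psi j)
      = MulOpposite.op (Yangian.psi h j) := FreeAlgebra.lift_ι_apply _ _
  have br (u v : Free) : ⁅Yangian.mk h u, Yangian.mk h v⁆ = Yangian.mk h ⁅u, v⁆ :=
    (map_bracket _ _ _).symm
  cases r with
  | psi_psi j k =>
    rw [map_bracket, lp, lp, bracket_op, Yangian.psi, Yangian.psi, br,
      Yangian.mk_rel h (Rel.psi_psi j k)]
    simp
  | e_e j k =>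
    have key := Yangian.mk_rel h (Rel.f_f j k)
    rw [map_cubic, map_zero] at key
    rw [map_cubic]
    simp only [le]
    rw [cubic_op, cubic_neg]
    exact (congrArg (fun t => -MulOpposite.op t) key).trans (by simp)
  | f_f j k =>
    have key := Yangian.mk_rel h (Rel.e_e j k)
    rw [map_cubic, map_zero] at key
    rw [map_cubic]
    simp only [lf]
    rw [cubic_op, cubic_neg, neg_neg]
    exact (congrArg (fun t => -MulOpposite.op t) key).trans (by simp)
  | e_f j k =>
    have key := Yangian.mk_rel h (Rel.e_f k j)
    rw [map_bracket, le, lf, lp, bracket_op, bracket_neg_left, bracket_neg_right, neg_neg,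
      ← MulOpposite.op_neg, neg_bracket, Yangian.e, Yangian.f, br, key, add_comm k j, Yangian.psi]
  | psi_e j k =>
    have key := Yangian.mk_rel h (Rel.psi_f j k)
    rw [map_cubic, map_zero] at key
    rw [map_cubic]
    simp only [le, lp]
    rw [cubic_op, cubic_neg_right]
    exact (congrArg (fun t => -MulOpposite.op (-t)) key).trans (by simp)
  | psi_f j k =>
    have key := Yangian.mk_rel h (Rel.psi_e j k)
    rw [map_cubic, map_zero] at key
    rw [map_cubic]
    simp only [lf, lp]
    rw [cubic_op, cubic_neg_right, neg_neg]
    exact (congrArg (fun t => -MulOpposite.op (-t)) key).trans (by simp)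
  | psi0_e j =>
    rw [map_bracket, lp, le, bracket_op, bracket_neg_right, Yangian.psi, Yangian.f, br,
      Yangian.mk_rel h (Rel.psi0_f j)]
    simp
  | psi1_e j =>
    rw [map_bracket, lp, le, bracket_op, bracket_neg_right, Yangian.psi, Yangian.f, br,
      Yangian.mk_rel h (Rel.psi1_f j)]
    simp
  | psi2_e j =>
    rw [map_bracket, map_smul, lp, le, bracket_op, bracket_neg_right, Yangian.psi, Yangian.f, br,
      Yangian.mk_rel h (Rel.psi2_f j)]
    simp
  | psi0_f j =>
    rw [map_bracket, lp, lf, bracket_op, bracket_neg_right, Yangian.psi, Yangian.e, br,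
      Yangian.mk_rel h (Rel.psi0_e j)]
    simp
  | psi1_f j =>
    rw [map_bracket, lp, lf, bracket_op, bracket_neg_right, Yangian.psi, Yangian.e, br,
      Yangian.mk_rel h (Rel.psi1_e j)]
    simp
  | psi2_f j =>
    rw [map_bracket, map_neg, map_smul, lp, lf, bracket_op, bracket_neg_right, Yangian.psi, Yangian.e, br,
      Yangian.mk_rel h (Rel.psi2_e j)]
    simp
  | serre_e j =>
    have key := Yangian.mk_rel h (Rel.serre_f j)
    rw [map_serre, map_zero] at key
    rw [map_serre]
    simp only [le]
    rw [serre_neg_op]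
    exact (congrArg (fun t => -MulOpposite.op t) key).trans (by simp)
  | serre_f j =>
    have key := Yangian.mk_rel h (Rel.serre_e j)
    rw [map_serre, map_zero] at key
    rw [map_serre]
    simp only [lf]
    rw [serre_neg_op]
    exact (congrArg (fun t => -MulOpposite.op t) key).trans (by simp)
  | psi0 =>
    rw [lp, Yangian.psi, Yangian.mk_rel h Rel.psi0]
    simp

/-- The anti-automorphism `ã` of `𝒴` with `ã(e_j) = -f_j`, `ã(f_j) = -e_j`, `ã(ψ_j) = ψ_j`,
as a homomorphism to the opposite algebra. -/
def anti (h : Fin 3 → ℂ) : Yangian h →ₐ[ℂ] (Yangian h)ᵐᵒᵖ :=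
  RingQuot.liftAlgHom ℂ ⟨FreeAlgebra.lift ℂ (antiGen h), fun _ _ r => anti_rel h r⟩

/-! ### Plane partitions (3D Young diagrams) -/

/-- A box, given by its coordinates `(x, y, z)`. -/
abbrev Box : Type := ℕ × ℕ × ℕ

/-- A plane partition, seen as a 3D Young diagram: a finite set of boxes closed under decreasing
coordinates. -/
@[ext]
structure PlanePartition : Type where
  boxes : Finset Box
  isLowerSet : IsLowerSet (boxes : Set Box)

namespace PlanePartition

/-- The empty diagram. -/
def empty : PlanePartition := ⟨∅, by simp [IsLowerSet]⟩

/-- `□ ∈ π⁺`: the box is not in `π` and adding it gives a diagram. -/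
def Addable (π : PlanePartition) (b : Box) : Prop :=
  b ∉ π.boxes ∧ IsLowerSet ((insert b π.boxes : Finset Box) : Set Box)

/-- `□ ∈ π⁻`: the box is in `π` and removing it gives a diagram. -/
def Removable (π : PlanePartition) (b : Box) : Prop :=
  b ∈ π.boxes ∧ IsLowerSet ((π.boxes.erase b : Finset Box) : Set Box)

/-- The diagram `π + □`. -/
def add (π : PlanePartition) (b : {b : Box // π.Addable b}) : PlanePartition :=
  ⟨insert b.1 π.boxes, b.2.2⟩

/-- The diagram `π - □`. -/
def remove (π : PlanePartition) (b : {b : Box // π.Removable b}) : PlanePartition :=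
  ⟨π.boxes.erase b.1, b.2.2⟩

theorem finite_addable (π : PlanePartition) : Finite {b : Box // π.Addable b} := by
  have hfin : {b : Box | π.Addable b}.Finite := by
    refine ((((Set.finite_singleton ((0, 0, 0) : Box)).union
      (π.boxes.finite_toSet.image fun c : Box => (c.1 + 1, c.2.1, c.2.2))).union
      (π.boxes.finite_toSet.image fun c : Box => (c.1, c.2.1 + 1, c.2.2))).union
      (π.boxes.finite_toSet.image fun c : Box => (c.1, c.2.1, c.2.2 + 1))).subset ?_
    rintro ⟨x, y, z⟩ ⟨_, hl⟩
    have key (c : Box) (hc : c ≤ (x, y, z)) (hne : c ≠ (x, y, z)) : c ∈ π.boxes := by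
      have hm := hl hc (Finset.mem_coe.2 (Finset.mem_insert_self _ _))
      exact (Finset.mem_insert.1 (Finset.mem_coe.1 hm)).resolve_left hne
    rcases x with _ | x
    · rcases y with _ | y
      · rcases z with _ | z
        · simp
        · exact Or.inr ⟨(0, 0, z), key _ (by simp [Prod.le_def]) (by simp), rfl⟩
      · exact Or.inl (Or.inr ⟨(0, y, z), key _ (by simp [Prod.le_def]) (by simp), rfl⟩)
    · exact Or.inl (Or.inl (Or.inr ⟨(x, y, z), key _ (by simp [Prod.le_def]) (by simp), rfl⟩))
  exact hfin

theorem finite_removable (π : PlanePartition) : Finite {b : Box // π.Removable b} :=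
  (π.boxes.finite_toSet.subset fun _ hb => hb.1 : {b : Box | π.Removable b}.Finite)

instance (π : PlanePartition) : Fintype {b : Box // π.Addable b} :=
  @Fintype.ofFinite _ π.finite_addable

instance (π : PlanePartition) : Fintype {b : Box // π.Removable b} :=
  @Fintype.ofFinite _ π.finite_removable

end PlanePartition

/-- `h_□ = h₁ y_□ + h₂ x_□ + h₃ z_□`. -/
def boxWeight (h : Fin 3 → ℂ) (b : Box) : ℂ := h 0 * b.2.1 + h 1 * b.1 + h 2 * b.2.2

/-- `φ(u) = (u+h₁)(u+h₂)(u+h₃) / ((u-h₁)(u-h₂)(u-h₃))`. -/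
def varphi (h : Fin 3 → ℂ) (u : ℂ) : ℂ :=
  ((u + h 0) * (u + h 1) * (u + h 2)) / ((u - h 0) * (u - h 1) * (u - h 2))

/-- `ψ_π(u) = ((u + σ₃)/u) ∏_{□ ∈ π} φ(u - h_□)`, with `ψ₀ = 1`. -/
def psiFun (h : Fin 3 → ℂ) (π : PlanePartition) (u : ℂ) : ℂ :=
  (u + sigma3 h) / u * ∏ b ∈ π.boxes, varphi h (u - boxWeight h b)

/-- The space with basis the plane partitions. -/
abbrev Fock : Type := PlanePartition →₀ ℂ

/-- The basis vector `|π⟩`. -/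
def ket (π : PlanePartition) : Fock := Finsupp.single π 1

/-- The vacuum `|0⟩`. -/
def vac : Fock := ket PlanePartition.empty

/-- The matrix element `⟨0|A|0⟩`. -/
def vev (A : Module.End ℂ Fock) : ℂ := A vac PlanePartition.empty

/-- `ρ` is the representation of `𝒴` on plane partitions:
* `ψ(u)|π⟩ = ψ_π(u)|π⟩`, that is, `ψ_j|π⟩ = c π j |π⟩` where
  `ψ_π(u) = 1 + σ₃ ∑_j (c π j) / u^{j+1}` near `u = ∞`;
* `e_j|π⟩ = ∑_{□ ∈ π⁺} h_□^j E(π → π+□) |π+□⟩`;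
* `f_j|π⟩ = ∑_{□ ∈ π⁻} h_□^j F(π → π-□) |π-□⟩` with `F(π → π-□) = -E(π-□ → π)`;
* `E(π → π+□)` is a square root of `(1/σ₃) res_{u = h_□} ψ_π(u)`, the residue at a pole that is
  at most simple.
The branches of the square roots are the ones for which this is a representation. -/
def IsPlanePartitionRep (h : Fin 3 → ℂ) (ρ : Yangian h →ₐ[ℂ] Module.End ℂ Fock) : Prop :=
  ∃ (E : PlanePartition → Box → ℂ) (c : PlanePartition → ℕ → ℂ),
    (∀ π : PlanePartition, ∀ᶠ u in Bornology.cobounded ℂ,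
      HasSum (fun j : ℕ => sigma3 h * (c π j / u ^ (j + 1))) (psiFun h π u - 1)) ∧
    (∀ (π : PlanePartition) (b : {b : Box // π.Addable b}),
      Filter.Tendsto (fun u => (u - boxWeight h b) * psiFun h π u)
        (nhdsWithin (boxWeight h b) {boxWeight h b}ᶜ) (nhds (sigma3 h * E π b ^ 2))) ∧
    (∀ (j : ℕ) (π : PlanePartition), ρ (Yangian.psi h j) (ket π) = c π j • ket π) ∧
    (∀ (j : ℕ) (π : PlanePartition), ρ (Yangian.e h j) (ket π) =
      ∑ b : {b : Box // π.Addable b}, (boxWeight h b ^ j * E π b) • ket (π.add b)) ∧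
    (∀ (j : ℕ) (π : PlanePartition), ρ (Yangian.f h j) (ket π) =
      ∑ b : {b : Box // π.Removable b},
        (boxWeight h b ^ j * -E (π.remove b) b) • ket (π.remove b))

/-! ### The modes -/

/-- `ad_x^n y`. -/
def adPow {A : Type} [Ring A] (x : A) (n : ℕ) (y : A) : A := (fun z => ⁅x, z⁆)^[n] y

/-- The modes `a_{n,1}`, `n ≠ 0`:
`a_{n,1} = -1/(n-1)! ad_{f₁}^{n-1} f₀` and `a_{-n,1} = 1/(n-1)! ad_{e₁}^{n-1} e₀` for `n > 0`.
There is no mode `a_{0,1}`; the value `0` makes it drop out of the sums below. -/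
def modeOne (h : Fin 3 → ℂ) : ℤ → Yangian h
  | Int.ofNat 0 => 0
  | Int.ofNat (n + 1) =>
      -((1 / (n.factorial : ℂ)) • adPow (Yangian.f h 1) n (Yangian.f h 0))
  | Int.negSucc n => (1 / (n.factorial : ℂ)) • adPow (Yangian.e h 1) n (Yangian.e h 0)

/-- The normally ordered product `:a_{i,1} a_{j,1}:`, the smaller index on the left. -/
def normalProd (h : Fin 3 → ℂ) (i j : ℤ) : Yangian h :=
  if i ≤ j then modeOne h i * modeOne h j else modeOne h j * modeOne h i

/-- The operator `∑_{i+j=m} :a_{i,1} a_{j,1}:`; on each basis vector `|π⟩` only finitely many terms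
are non-zero. -/
def bosonSum {h : Fin 3 → ℂ} (ρ : Yangian h →ₐ[ℂ] Module.End ℂ Fock) (m : ℤ) :
    Module.End ℂ Fock :=
  Finsupp.linearCombination ℂ fun π : PlanePartition =>
    ∑ᶠ i : ℤ, ρ (normalProd h i (m - i)) (ket π)

/-- The operator `a_{-n,2}` (also written `P_{n,2}`), for `n ≥ 2`:
`1/(n-2)! ad_{e₁}^{n-2}([e₂,e₀] - σ₃[e₁,e₀]) - ∑_{i+j=-n} :a_{i,1} a_{j,1}:`. -/
def creation {h : Fin 3 → ℂ} (ρ : Yangian h →ₐ[ℂ] Module.End ℂ Fock) (n : ℕ) :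
    Module.End ℂ Fock :=
  ρ ((1 / ((n - 2).factorial : ℂ)) • adPow (Yangian.e h 1) (n - 2)
      (⁅Yangian.e h 2, Yangian.e h 0⁆ - sigma3 h • ⁅Yangian.e h 1, Yangian.e h 0⁆))
    - bosonSum ρ (-(n : ℤ))

/-- The operator `a_{n,2}`, for `n ≥ 2`:
`-1/(n-2)! ad_{f₁}^{n-2}([f₂,f₀] - σ₃[f₁,f₀]) - ∑_{i+j=n} :a_{i,1} a_{j,1}:`. -/
def annihilation {h : Fin 3 → ℂ} (ρ : Yangian h →ₐ[ℂ] Module.End ℂ Fock) (n : ℕ) :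
    Module.End ℂ Fock :=
  -ρ ((1 / ((n - 2).factorial : ℂ)) • adPow (Yangian.f h 1) (n - 2)
      (⁅Yangian.f h 2, Yangian.f h 0⁆ - sigma3 h • ⁅Yangian.f h 1, Yangian.f h 0⁆))
    - bosonSum ρ (n : ℤ)

/-- The operator `a_{0,2} = ψ₂ - ∑_{i+j=0} :a_{i,1} a_{j,1}: = ψ₂ - 2 ∑_{j≥1} a_{-j,1} a_{j,1}`. -/
def zeroMode {h : Fin 3 → ℂ} (ρ : Yangian h →ₐ[ℂ] Module.End ℂ Fock) : Module.End ℂ Fock :=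
  ρ (Yangian.psi h 2) - bosonSum ρ 0

/-! ### The quadratic form -/

/-- `⟨v, w⟩ = r` for the form on `𝒴⁺|0⟩` given by `⟨x|0⟩, y|0⟩⟩ = ⟨0| ã(y) x |0⟩`, `x, y ∈ 𝒴⁺`:
both vectors lie in `𝒴⁺|0⟩`, and every way of writing them so gives the value `r`. -/
def FormEq {h : Fin 3 → ℂ} (ρ : Yangian h →ₐ[ℂ] Module.End ℂ Fock) (v w : Fock) (r : ℂ) : Prop :=
  (∃ x ∈ Yangian.plus h, ρ x vac = v) ∧ (∃ y ∈ Yangian.plus h, ρ y vac = w) ∧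
    ∀ x ∈ Yangian.plus h, ∀ y ∈ Yangian.plus h, ρ x vac = v → ρ y vac = w →
      vev (ρ ((anti h y).unop * x)) = r

end PlanePartitionYangian

end

/-! Write J_n for `a_{n,1}`, V_{-2} = [e₂,e₀] - σ₃[e₁,e₀], V_2 for its transpose, and T_m = ∑ :J_i
J_{m-i}:. The three identities say that subtracting T decouples a free boson from the spin-two
modes. They follow from [J_m, J_n] = m δ_{m+n,0}, [V_{±2}, J_n] = -2n J_{n±2} and [V_2, V_{-2}] =
8ψ₂ - 2(σ₂ + σ₃²) (`CurrentRelations`, `lie_modeV_modeV`). Indeed T_m has the same brackets with the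
J_n as V_m, so V_{±2} - T_{±2} commutes with every J_n. Hence the bracket of the two differences is
[V_2, V_{-2}] - [T_2, V_{-2}], and [T_2, V_{-2}] = 8T_0 + 2. The 2, from the one product that has to
be reordered, is the origin of the summand 1 in 1 + σ₂ + σ₃². The vectors P₂₂ⁿ|0⟩ are then killed by
J_n for n ≥ 0 and are eigenvectors of a_{0,2} with eigenvalue 4n, so their norms follow by the usual
highest-weight recursion. The norms of a_{-n,2}|0⟩ come from the sl₂ spanned by e₁, f₁, ψ₂ together
with Wick contractions.

On Fock space e_j and -f_j are transposes for the form in which the diagrams are orthonormal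
(`isAdj_eOp`). Thus ã becomes transposition, and each relation for the e's gives one for the f's.
Generic weights separate the addable boxes of a diagram. So ψ_π has at most simple poles, at addable
and removable boxes, and [e_j, f_k] is diagonal with the moments of the residues as eigenvalues.

Brackets of J's of opposite sign, those of V_{-2} with J_n for n ≥ 0, and [V_2, V_{-2}] need only
the relations collected in `LowRelations`. The hard part is the creation modes: the J_{-k} commute,
and [V_{-2}, J_{-k}] is again a single mode. For this φ(v) is factored as β(v)/β(v + h₁), which
splits ψ(z) into two diagonal dressings `dA` and `dB`. Operators ε_n are defined by a recursion with
e₁. In hindsight ∑ ε_n tⁿ is the vertex operator exp(-h₁ ∑ (t/(h₂h₃))^k J_{-k}/k). Their relation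
with f(z) (`LoweringRel`) and with e(z) (`RaisingRel`) are proved by a joint induction. The engine
is `op_eq_zero_of_commute`: a defect with raised values that commutes with all f(z) is zero, by
induction on the number of boxes. The ε_n then commute with e₀, generate the same algebra as the
J_{-k}, and span an algebra stable under ad V_{-2}. In that algebra an element of nonzero degree
killed by all annihilation modes vanishes, by Euler's identity (`euler_identity`). This determines
[V_{-2}, J_{-k}].

For existence, square roots are chosen with an antisymmetric convention for pairs of boxes, so that
amplitudes along the two sides of every square of diagrams agree (`exchange_amplitude`). The (ψ,e)
relations express ψ_{π+□} = ψ_π φ. The cubic (e,e) relations follow by the vanishing principle. The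
Serre relations reduce to [J_{-1}, J_{-2}] = 0. -/

noncomputable section

namespace PlanePartitionYangian

section

open Filter Topology

/-! ### Combinatorics of adding and removing boxes -/

namespace PlanePartition

variable {π : PlanePartition} {a b c : Box}

theorem mem_of_le (hb : b ∈ π.boxes) (h : c ≤ b) : c ∈ π.boxes :=
  Finset.mem_coe.1 (π.isLowerSet h (Finset.mem_coe.2 hb))

theorem addable_iff : π.Addable b ↔ b ∉ π.boxes ∧ ∀ c, c ≤ b → c ≠ b → c ∈ π.boxes := by
  refine and_congr_right fun hb => ⟨fun hl c hc hne => ?_, fun H x y hyx hx => ?_⟩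
  · have := hl hc (Finset.mem_coe.2 (Finset.mem_insert_self b π.boxes))
    exact (Finset.mem_insert.1 (Finset.mem_coe.1 this)).resolve_left hne
  · rw [Finset.mem_coe, Finset.mem_insert] at hx ⊢
    rcases hx with rfl | hx
    · by_cases h : y = x
      · exact Or.inl h
      · exact Or.inr (H y hyx h)
    · exact Or.inr (mem_of_le hx hyx)

theorem removable_iff : π.Removable b ↔ b ∈ π.boxes ∧ ∀ c ∈ π.boxes, b ≤ c → c = b := by
  refine and_congr_right fun hb => ⟨fun hl c hc hbc => ?_, fun H x y hyx hx => ?_⟩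
  · by_contra hne
    have := hl hbc (Finset.mem_coe.2 (Finset.mem_erase.2 ⟨hne, hc⟩))
    exact Finset.notMem_erase b π.boxes (Finset.mem_coe.1 this)
  · rw [Finset.mem_coe, Finset.mem_erase] at hx ⊢
    refine ⟨?_, mem_of_le hx.2 hyx⟩
    rintro rfl
    exact hx.1 (H x hx.2 hyx)

open Classical in
/-- `π + b`, and `π` itself if `b` is not addable. -/
def ins (π : PlanePartition) (b : Box) : PlanePartition :=
  if hb : π.Addable b then π.add ⟨b, hb⟩ else π

open Classical in
/-- `π - b`, and `π` itself if `b` is not removable. -/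
def del (π : PlanePartition) (b : Box) : PlanePartition :=
  if hb : π.Removable b then π.remove ⟨b, hb⟩ else π

theorem ins_eq (hb : π.Addable b) : π.ins b = π.add ⟨b, hb⟩ := dif_pos hb

theorem del_eq (hb : π.Removable b) : π.del b = π.remove ⟨b, hb⟩ := dif_pos hb

theorem ins_boxes (hb : π.Addable b) : (π.ins b).boxes = insert b π.boxes := by
  rw [ins_eq hb]; rfl

theorem del_boxes (hb : π.Removable b) : (π.del b).boxes = π.boxes.erase b := by
  rw [del_eq hb]; rfl

theorem mem_ins (hb : π.Addable b) : c ∈ (π.ins b).boxes ↔ c = b ∨ c ∈ π.boxes := by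
  rw [ins_boxes hb, Finset.mem_insert]

theorem mem_del (hb : π.Removable b) : c ∈ (π.del b).boxes ↔ c ≠ b ∧ c ∈ π.boxes := by
  rw [del_boxes hb, Finset.mem_erase]

theorem removable_ins (hb : π.Addable b) : (π.ins b).Removable b := by
  refine ⟨(mem_ins hb).2 (Or.inl rfl), ?_⟩
  rw [ins_boxes hb, Finset.erase_insert hb.1]
  exact π.isLowerSet

theorem del_ins (hb : π.Addable b) : (π.ins b).del b = π := by
  ext1
  rw [del_boxes (removable_ins hb), ins_boxes hb, Finset.erase_insert hb.1]

theorem addable_del (hb : π.Removable b) : (π.del b).Addable b := by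
  refine ⟨fun h => ((mem_del hb).1 h).1 rfl, ?_⟩
  rw [del_boxes hb, Finset.insert_erase hb.1]
  exact π.isLowerSet

theorem ins_del (hb : π.Removable b) : (π.del b).ins b = π := by
  ext1
  rw [ins_boxes (addable_del hb), del_boxes hb, Finset.insert_erase hb.1]

theorem addable_ins (ha : π.Addable a) (hb : π.Addable b) (hab : a ≠ b) :
    (π.ins a).Addable b := by
  rw [addable_iff] at hb ⊢
  refine ⟨fun h => ?_, fun c hc hne => (mem_ins ha).2 (Or.inr (hb.2 c hc hne))⟩
  rcases (mem_ins ha).1 h with h | h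
  · exact hab h.symm
  · exact hb.1 h

theorem ins_comm (ha : π.Addable a) (hb : π.Addable b) :
    (π.ins a).ins b = (π.ins b).ins a := by
  by_cases hab : a = b
  · rw [hab]
  · ext1
    rw [ins_boxes (addable_ins ha hb hab), ins_boxes ha,
      ins_boxes (addable_ins hb ha (Ne.symm hab)), ins_boxes hb, Finset.insert_comm]

/-- Adding `a` and then removing another box `b` amounts to adding `a` or `b` to a common
diagram. -/
theorem exists_of_addable_removable (ha : π.Addable a) (hb : (π.ins a).Removable b)
    (hab : a ≠ b) : π.Removable b ∧ (π.del b).Addable a ∧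
      (π.ins a).del b = (π.del b).ins a := by
  have hbπ : b ∈ π.boxes := ((mem_ins ha).1 hb.1).resolve_left (Ne.symm hab)
  have hr : π.Removable b := by
    rw [removable_iff] at hb ⊢
    exact ⟨hbπ, fun c hc hbc => hb.2 c ((mem_ins ha).2 (Or.inr hc)) hbc⟩
  have hd : (π.del b).Addable a := by
    rw [removable_iff] at hb
    have ha' := addable_iff.1 ha
    rw [addable_iff]
    refine ⟨fun h => ha.1 ((mem_del hr).1 h).2, fun c hc hne => (mem_del hr).2 ⟨?_, ha'.2 c hc hne⟩⟩
    rintro rfl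
    exact hab (hb.2 a ((mem_ins ha).2 (Or.inl rfl)) hc)
  refine ⟨hr, hd, ?_⟩
  ext1
  rw [del_boxes hb, ins_boxes ha, ins_boxes hd, del_boxes hr, Finset.erase_insert_of_ne hab]

/-- Converse of `exists_of_addable_removable`. Together they biject the paths "add, then remove"
with "remove, then add", which makes the off-diagonal part of [e, f] cancel. -/
theorem removable_ins_of (hb : π.Removable b) (ha : (π.del b).Addable a) (hab : a ≠ b) :
    π.Addable a ∧ (π.ins a).Removable b := by
  have h1 : ((π.del b).ins b).Addable a := addable_ins (addable_del hb) ha (Ne.symm hab)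
  rw [ins_del hb] at h1
  refine ⟨h1, ?_⟩
  have h2 := removable_ins (addable_ins ha (addable_del hb) hab)
  rwa [ins_comm ha (addable_del hb), ins_del hb] at h2

theorem eq_of_addable_of_le (ha : π.Addable a) (hb : π.Addable b) (h : a ≤ b) : a = b := by
  by_contra hne
  exact ha.1 ((addable_iff.1 hb).2 a h hne)

/-- The boxes with all coordinates less than `M`. -/
def cube (M : ℕ) : Finset Box := Finset.range M ×ˢ Finset.range M ×ˢ Finset.range M

theorem mem_cube {M : ℕ} : b ∈ cube M ↔ b.1 < M ∧ b.2.1 < M ∧ b.2.2 < M := by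
  simp [cube]

theorem exists_cube (π : PlanePartition) : ∃ M, π.boxes ⊆ cube M := by
  -- Any bound works; the summand of `b` alone already exceeds each of its coordinates.
  refine ⟨∑ b ∈ π.boxes, (b.1 + b.2.1 + b.2.2 + 1), fun b hb => ?_⟩
  have := Finset.single_le_sum (f := fun b : Box => b.1 + b.2.1 + b.2.2 + 1)
    (fun _ _ => Nat.zero_le _) hb
  rw [mem_cube]; omega

theorem Addable.mem_cube {M : ℕ} (hM : π.boxes ⊆ cube M) (hb : π.Addable b) :
    b ∈ cube (M + 1) := by
  obtain ⟨x, y, z⟩ := b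
  rw [addable_iff] at hb
  rw [PlanePartition.mem_cube]
  refine ⟨?_, ?_, ?_⟩ <;> simp only <;> by_contra hlt
  · have := PlanePartition.mem_cube.1 (hM (hb.2 (x - 1, y, z) (by simp [Prod.le_def])
      (by simp; omega)))
    simp only at this; omega
  · have := PlanePartition.mem_cube.1 (hM (hb.2 (x, y - 1, z) (by simp [Prod.le_def])
      (by simp; omega)))
    simp only at this; omega
  · have := PlanePartition.mem_cube.1 (hM (hb.2 (x, y, z - 1) (by simp [Prod.le_def])
      (by simp; omega)))
    simp only at this; omega

theorem card_del (hb : π.Removable b) : (π.del b).boxes.card + 1 = π.boxes.card := by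
  rw [del_boxes hb, Finset.card_erase_add_one hb.1]

theorem card_ins (hb : π.Addable b) : (π.ins b).boxes.card = π.boxes.card + 1 := by
  rw [ins_boxes hb, Finset.card_insert_of_notMem hb.1]

theorem exists_removable (h : π.boxes.Nonempty) : ∃ b, π.Removable b := by
  obtain ⟨b, hb, hmax⟩ := π.boxes.exists_maximal h
  exact ⟨b, removable_iff.2 ⟨hb, fun c hc hbc => le_antisymm (hmax hc hbc) hbc⟩⟩

theorem induction_ins {P : PlanePartition → Prop} (h0 : P empty)
    (h1 : ∀ π b, π.Addable b → P π → P (π.ins b)) (π : PlanePartition) : P π := by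
  induction hn : π.boxes.card generalizing π with
  | zero =>
    have : π = empty := by ext1; exact Finset.card_eq_zero.1 hn
    rwa [this]
  | succ n ih =>
    obtain ⟨b, hb⟩ := exists_removable (Finset.card_pos.1 (by omega) : π.boxes.Nonempty)
    rw [← ins_del hb]
    exact h1 _ _ (addable_del hb) (ih _ (by have := card_del hb; omega))

end PlanePartition

/-! ### Generic parameters and weights -/

/-- The parameters are generic. -/
structure Generic (h : Fin 3 → ℂ) : Prop where
  sum : h 0 + h 1 + h 2 = 0
  indep : ∀ m n : ℤ, (m : ℂ) * h 0 + n * h 1 = 0 → m = 0 ∧ n = 0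

theorem generic_of_linearIndependent {h : Fin 3 → ℂ} (hsum : h 0 + h 1 + h 2 = 0)
    (hgen : LinearIndependent ℚ ![h 0, h 1]) : Generic h := by
  refine ⟨hsum, fun m n hmn => ?_⟩
  rw [LinearIndependent.pair_iff] at hgen
  have := hgen m n (by rw [← hmn]; simp [Rat.smul_def])
  exact_mod_cast this

namespace Generic

variable {h : Fin 3 → ℂ}

theorem h2_eq (H : Generic h) : h 2 = -h 0 - h 1 := by linear_combination H.sum

theorem h0_ne (H : Generic h) : h 0 ≠ 0 := fun e => by
  have := H.indep 1 0 (by simp [e]); omega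

theorem h1_ne (H : Generic h) : h 1 ≠ 0 := fun e => by
  have := H.indep 0 1 (by simp [e]); omega

theorem h2_ne (H : Generic h) : h 2 ≠ 0 := fun e => by
  have := H.indep 1 1 (by have := H.sum; simp [e] at this; simpa using this); omega

theorem sigma3_ne (H : Generic h) : sigma3 h ≠ 0 :=
  mul_ne_zero (mul_ne_zero H.h0_ne H.h1_ne) H.h2_ne

theorem boxWeight_eq (H : Generic h) (b : Box) :
    boxWeight h b = ((b.2.1 : ℤ) - b.2.2 : ℤ) * h 0 + ((b.1 : ℤ) - b.2.2 : ℤ) * h 1 := by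
  rw [boxWeight, H.h2_eq]; push_cast; ring

/-- Eliminating h₃ = -h₁ - h₂ puts the weight in ℤh₁ + ℤh₂ with coordinates (y - z, x - z). A weight
therefore knows a box exactly up to translation along (1,1,1). -/
theorem weight_sub (H : Generic h) {a b : Box} {m n : ℤ}
    (e : boxWeight h b - boxWeight h a = m * h 0 + n * h 1) :
    (b.2.1 : ℤ) - b.2.2 - (a.2.1 - a.2.2) = m ∧ (b.1 : ℤ) - b.2.2 - (a.1 - a.2.2) = n := by
  rw [H.boxWeight_eq, H.boxWeight_eq] at e
  have := H.indep ((b.2.1 : ℤ) - b.2.2 - (a.2.1 - a.2.2) - m)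
    ((b.1 : ℤ) - b.2.2 - (a.1 - a.2.2) - n) (by push_cast at e ⊢; linear_combination e)
  omega

theorem comparable_of_eq (H : Generic h) {a b : Box} (e : boxWeight h b = boxWeight h a) :
    a ≤ b ∨ b ≤ a := by
  have := H.weight_sub (a := a) (b := b) (m := 0) (n := 0) (by rw [e]; simp)
  simp only [Prod.le_def]; omega

/-- The boxes differ by a unit step modulo (1,1,1); whichever multiple of (1,1,1) is added, all
coordinates of the difference have weakly the same sign. -/
theorem comparable_of_h (H : Generic h) {a b : Box} (i : Fin 3)
    (e : boxWeight h b - boxWeight h a = h i) :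
    a ≤ b ∨ b ≤ a := by
  fin_cases i
  · have := H.weight_sub (m := 1) (n := 0) (e.trans (by simp))
    simp only [Prod.le_def]; omega
  · have := H.weight_sub (m := 0) (n := 1) (e.trans (by simp))
    simp only [Prod.le_def]; omega
  · have := H.weight_sub (m := -1) (n := -1) (e.trans (by
      simp only [Fin.reduceFinMk, H.h2_eq]; push_cast; ring))
    simp only [Prod.le_def]; omega

end Generic

namespace PlanePartition

variable {h : Fin 3 → ℂ} {π : PlanePartition} {a b : Box}

theorem weight_ne_of_addable (H : Generic h) (ha : π.Addable a) (hb : π.Addable b) (hab : a ≠ b) :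
    boxWeight h b ≠ boxWeight h a := fun e => by
  rcases H.comparable_of_eq e with h | h
  · exact hab (eq_of_addable_of_le ha hb h)
  · exact hab (eq_of_addable_of_le hb ha h).symm

/-- Addable boxes form an antichain. Consequently φ has neither a zero nor a pole at the difference
of two of their weights, which makes the exchange factors below finite and invertible. -/
theorem weight_sub_ne_of_addable (H : Generic h) (ha : π.Addable a) (hb : π.Addable b)
    (hab : a ≠ b) (i : Fin 3) : boxWeight h b - boxWeight h a ≠ h i := fun e => by
  rcases H.comparable_of_h i e with h | h
  · exact hab (eq_of_addable_of_le ha hb h)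
  · exact hab (eq_of_addable_of_le hb ha h).symm

end PlanePartition

end

section

open Filter Topology

/-! ### The order of `ψ_π` along the diagonals -/

namespace PlanePartition

/-- The diagram extended by all the boxes of `ℤ³` with a negative coordinate. -/
def Ext (π : PlanePartition) (x y z : ℤ) : Prop :=
  x < 0 ∨ y < 0 ∨ z < 0 ∨ (x.toNat, y.toNat, z.toNat) ∈ π.boxes

open Classical in
/-- The indicator function of the extended diagram. -/
def ind (π : PlanePartition) (x y z : ℤ) : ℤ := if π.Ext x y z then 1 else 0

variable {π : PlanePartition} {b : Box}

theorem Ext.mono {x y z x' y' z' : ℤ} (H : π.Ext x y z) (hx : x' ≤ x) (hy : y' ≤ y)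
    (hz : z' ≤ z) : π.Ext x' y' z' := by
  unfold Ext at *
  by_cases h1 : x' < 0; · exact Or.inl h1
  by_cases h2 : y' < 0; · exact Or.inr (Or.inl h2)
  by_cases h3 : z' < 0; · exact Or.inr (Or.inr (Or.inl h3))
  refine Or.inr (Or.inr (Or.inr ?_))
  rcases H with h | h | h | h
  · omega
  · omega
  · omega
  · refine mem_of_le h ?_
    simp only [Prod.le_def]; omega

theorem ind_mono {x y z x' y' z' : ℤ} (hx : x' ≤ x) (hy : y' ≤ y) (hz : z' ≤ z) :
    π.ind x y z ≤ π.ind x' y' z' := by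
  unfold ind
  by_cases h : π.Ext x y z
  · rw [if_pos h, if_pos (h.mono hx hy hz)]
  · rw [if_neg h]; split_ifs <;> simp

theorem ind_nonneg (x y z : ℤ) : 0 ≤ π.ind x y z := by unfold ind; split_ifs <;> simp

theorem ind_le_one (x y z : ℤ) : π.ind x y z ≤ 1 := by unfold ind; split_ifs <;> simp

theorem ind_eq_one {x y z : ℤ} : π.ind x y z = 1 ↔ π.Ext x y z := by
  unfold ind; split_ifs with h <;> simp [h]

theorem ind_eq_zero {x y z : ℤ} : π.ind x y z = 0 ↔ ¬ π.Ext x y z := by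
  unfold ind; split_ifs with h <;> simp [h]

/-- The order of `ψ_π(u) / (u + σ₃)` at the weight of the box `p`, read off from the unit cube with
top corner `p`. -/
def ord (π : PlanePartition) (p : Box) : ℤ :=
  π.ind p.1 p.2.1 p.2.2
    - π.ind (p.1 - 1) p.2.1 p.2.2 - π.ind p.1 (p.2.1 - 1) p.2.2 - π.ind p.1 p.2.1 (p.2.2 - 1)
    + π.ind (p.1 - 1) (p.2.1 - 1) p.2.2 + π.ind (p.1 - 1) p.2.1 (p.2.2 - 1)
    + π.ind p.1 (p.2.1 - 1) (p.2.2 - 1) - π.ind (p.1 - 1) (p.2.1 - 1) (p.2.2 - 1)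

/-- The order is a mixed third difference of a decreasing 0-1 function on the eight corners of a
unit cube, so only the twelve edge inequalities matter. If the top corner is inside or the bottom
corner outside, it is 0. Otherwise it is -1 + (face corners) - (edge corners), and equality with -1
forces all six middle corners to agree. -/
theorem ord_cases (π : PlanePartition) (p : Box) :
    -1 ≤ π.ord p ∧ (π.ord p ≠ 0 → π.ind p.1 p.2.1 p.2.2 = 0 ∧
      π.ind (p.1 - 1) (p.2.1 - 1) (p.2.2 - 1) = 1) ∧
    (π.ord p = -1 ↔
      (π.ind p.1 p.2.1 p.2.2 = 0 ∧ π.ind (p.1 - 1) p.2.1 p.2.2 = 1 ∧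
        π.ind p.1 (p.2.1 - 1) p.2.2 = 1 ∧ π.ind p.1 p.2.1 (p.2.2 - 1) = 1) ∨
      (π.ind (p.1 - 1) (p.2.1 - 1) (p.2.2 - 1) = 1 ∧ π.ind (p.1 - 1) (p.2.1 - 1) p.2.2 = 0 ∧
        π.ind (p.1 - 1) p.2.1 (p.2.2 - 1) = 0 ∧ π.ind p.1 (p.2.1 - 1) (p.2.2 - 1) = 0)) := by
  obtain ⟨x, y, z⟩ := p
  simp only [ord]
  have m (x y z x' y' z' : ℤ) (hx : x' ≤ x) (hy : y' ≤ y) (hz : z' ≤ z) :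
    π.ind x y z ≤ π.ind x' y' z' := ind_mono hx hy hz
  have m1 := m x y z (x - 1) y z (by omega) le_rfl le_rfl
  have m2 := m x y z x (y - 1) z le_rfl (by omega) le_rfl
  have m3 := m x y z x y (z - 1) le_rfl le_rfl (by omega)
  have m4 := m (x - 1) y z (x - 1) (y - 1) z le_rfl (by omega) le_rfl
  have m5 := m (x - 1) y z (x - 1) y (z - 1) le_rfl le_rfl (by omega)
  have m6 := m x (y - 1) z (x - 1) (y - 1) z (by omega) le_rfl le_rfl
  have m7 := m x (y - 1) z x (y - 1) (z - 1) le_rfl le_rfl (by omega)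
  have m8 := m x y (z - 1) (x - 1) y (z - 1) (by omega) le_rfl le_rfl
  have m9 := m x y (z - 1) x (y - 1) (z - 1) le_rfl (by omega) le_rfl
  have m10 := m (x - 1) (y - 1) z (x - 1) (y - 1) (z - 1) le_rfl le_rfl (by omega)
  have m11 := m (x - 1) y (z - 1) (x - 1) (y - 1) (z - 1) le_rfl (by omega) le_rfl
  have m12 := m x (y - 1) (z - 1) (x - 1) (y - 1) (z - 1) (by omega) le_rfl le_rfl
  have n0 := π.ind_nonneg x y z
  have n1 := π.ind_le_one (x - 1) (y - 1) (z - 1)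
  generalize π.ind x y z = a0 at *
  generalize π.ind (x - 1) y z = a1 at *
  generalize π.ind x (y - 1) z = a2 at *
  generalize π.ind x y (z - 1) = a3 at *
  generalize π.ind (x - 1) (y - 1) z = a4 at *
  generalize π.ind (x - 1) y (z - 1) = a5 at *
  generalize π.ind x (y - 1) (z - 1) = a6 at *
  generalize π.ind (x - 1) (y - 1) (z - 1) = a7 at *
  clear m
  refine ⟨by omega, by omega, ?_⟩
  constructor
  · intro _; omega
  · rintro (⟨h1, h2, h3, h4⟩ | ⟨h1, h2, h3, h4⟩) <;> omega

theorem ext_natCast {x y z : ℕ} : π.Ext x y z ↔ (x, y, z) ∈ π.boxes := by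
  unfold Ext
  simp only [Int.toNat_natCast]
  exact ⟨fun h => by rcases h with h | h | h | h <;> [omega; omega; omega; exact h],
    fun h => Or.inr (Or.inr (Or.inr h))⟩

/-- The top corner of a box. -/
def up (b : Box) : Box := (b.1 + 1, b.2.1 + 1, b.2.2 + 1)

theorem addable_iff_ind (p : Box) : π.Addable p ↔
    π.ind p.1 p.2.1 p.2.2 = 0 ∧ π.ind (p.1 - 1) p.2.1 p.2.2 = 1 ∧
        π.ind p.1 (p.2.1 - 1) p.2.2 = 1 ∧ π.ind p.1 p.2.1 (p.2.2 - 1) = 1 := by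
  obtain ⟨x, y, z⟩ := p
  simp only [ind_eq_one, ind_eq_zero]
  rw [addable_iff, ext_natCast]
  refine and_congr_right fun hp => ⟨fun H => ⟨?_, ?_, ?_⟩, fun ⟨h1, h2, h3⟩ ⟨x', y', z'⟩ hc hne =>
      ?_⟩
  · rcases x with _ | x
    · exact Or.inl (by simp)
    · push_cast
      rw [add_sub_cancel_right, ext_natCast]
      exact H _ (by simp [Prod.le_def]) (by simp)
  · rcases y with _ | y
    · exact Or.inr (Or.inl (by simp))
    · push_cast
      rw [add_sub_cancel_right, ext_natCast]
      exact H _ (by simp [Prod.le_def]) (by simp)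
  · rcases z with _ | z
    · exact Or.inr (Or.inr (Or.inl (by simp)))
    · push_cast
      rw [add_sub_cancel_right, ext_natCast]
      exact H _ (by simp [Prod.le_def]) (by simp)
  · rw [← ext_natCast]
    simp only [Prod.le_def, ne_eq, Prod.mk.injEq, not_and] at hc hne
    by_cases hx : x' = x
    · by_cases hy : y' = y
      · have := hne hx hy
        exact h3.mono (by omega) (by omega) (by omega)
      · exact h2.mono (by omega) (by omega) (by omega)
    · exact h1.mono (by omega) (by omega) (by omega)

theorem removable_iff_ind (p : Box) : (∃ b, π.Removable b ∧ p = up b) ↔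
      (π.ind (p.1 - 1) (p.2.1 - 1) (p.2.2 - 1) = 1 ∧ π.ind (p.1 - 1) (p.2.1 - 1) p.2.2 = 0 ∧
        π.ind (p.1 - 1) p.2.1 (p.2.2 - 1) = 0 ∧ π.ind p.1 (p.2.1 - 1) (p.2.2 - 1) = 0) := by
  obtain ⟨x, y, z⟩ := p
  simp only [ind_eq_one, ind_eq_zero]
  constructor
  · rintro ⟨⟨x', y', z'⟩, hb, e⟩
    simp only [up, Prod.mk.injEq] at e
    obtain ⟨rfl, rfl, rfl⟩ := e
    rw [removable_iff] at hb
    push_cast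
    simp only [add_sub_cancel_right]
    rw [← Nat.cast_one, ← Nat.cast_add, ← Nat.cast_add, ← Nat.cast_add]
    simp only [ext_natCast]
    refine ⟨hb.1, fun hm => ?_, fun hm => ?_, fun hm => ?_⟩ <;>
      simpa using hb.2 _ hm (by simp [Prod.le_def])
  · rintro ⟨h0, h1, h2, h3⟩
    rcases x with _ | x
    · exact absurd (Or.inl (by simp)) h1
    rcases y with _ | y
    · exact absurd (Or.inr (Or.inl (by simp))) h1
    rcases z with _ | z
    · exact absurd (Or.inr (Or.inr (Or.inl (by simp)))) h2
    refine ⟨(x, y, z), ?_, rfl⟩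
    push_cast at h0 h1 h2 h3
    simp only [add_sub_cancel_right] at h0 h1 h2 h3
    rw [ext_natCast] at h0
    rw [removable_iff]
    refine ⟨h0, fun ⟨x', y', z'⟩ hc hle => ?_⟩
    rw [← ext_natCast] at hc
    simp only [Prod.le_def] at hle
    by_contra hne
    simp only [Prod.mk.injEq, not_and] at hne
    by_cases hx : x' = x
    · by_cases hy : y' = y
      · have := hne hx hy
        exact h1 (hc.mono (by omega) (by omega) (by omega))
      · exact h2 (hc.mono (by omega) (by omega) (by omega))
    · exact h3 (hc.mono (by omega) (by omega) (by omega))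

theorem ord_eq_neg_one (p : Box) :
    π.ord p = -1 ↔ π.Addable p ∨ ∃ b, π.Removable b ∧ p = up b := by
  rw [addable_iff_ind, removable_iff_ind]
  exact (π.ord_cases p).2.2

/-- Equal weights put both on one (1,1,1)-diagonal, and a nonzero order occurs only where that
diagonal leaves the diagram, which happens once. So factors of different boxes never merge, and the
poles are at most simple. -/
theorem weight_inj_of_ord {h : Fin 3 → ℂ} (H : Generic h) {p p' : Box} (hp : π.ord p ≠ 0)
    (hp' : π.ord p' ≠ 0) (e : boxWeight h p = boxWeight h p') : p = p' := by
  obtain ⟨x, y, z⟩ := p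
  obtain ⟨x', y', z'⟩ := p'
  have k := (π.ord_cases _).2.1 hp
  have k' := (π.ord_cases _).2.1 hp'
  simp only [ind_eq_one, ind_eq_zero] at k k'
  have := H.weight_sub (a := (x', y', z')) (b := (x, y, z)) (m := 0) (n := 0) (by rw [e]; simp)
  simp only at this
  rcases lt_trichotomy z z' with hz | hz | hz
  · exact absurd (k'.2.mono (by omega) (by omega) (by omega)) k.1
  · simp only [Prod.mk.injEq]; omega
  · exact absurd (k.2.mono (by omega) (by omega) (by omega)) k'.1

/-- The change of `ord` at `p` caused by adding the box `b`. -/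
def ordBox (b p : Box) : ℤ :=
  (if p = b then 1 else 0)
    - (if p = (b.1 + 1, b.2.1, b.2.2) then 1 else 0)
    - (if p = (b.1, b.2.1 + 1, b.2.2) then 1 else 0)
    - (if p = (b.1, b.2.1, b.2.2 + 1) then 1 else 0)
    + (if p = (b.1 + 1, b.2.1 + 1, b.2.2) then 1 else 0)
    + (if p = (b.1 + 1, b.2.1, b.2.2 + 1) then 1 else 0)
    + (if p = (b.1, b.2.1 + 1, b.2.2 + 1) then 1 else 0)
    - (if p = (b.1 + 1, b.2.1 + 1, b.2.2 + 1) then 1 else 0)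

theorem ind_ins (hb : π.Addable b) (x y z : ℤ) :
    (π.ins b).ind x y z = π.ind x y z + if (x = b.1 ∧ y = b.2.1 ∧ z = b.2.2) then 1 else 0 := by
  obtain ⟨b1, b2, b3⟩ := b
  unfold ind
  have e : (π.ins (b1, b2, b3)).Ext x y z ↔ π.Ext x y z ∨ (x = b1 ∧ y = b2 ∧ z = b3) := by
    unfold Ext
    rw [mem_ins hb]
    simp only [Prod.mk.injEq]
    constructor
    · rintro (h | h | h | h | h)
      · exact Or.inl (Or.inl h)
      · exact Or.inl (Or.inr (Or.inl h))
      · exact Or.inl (Or.inr (Or.inr (Or.inl h)))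
      · by_cases h1 : x < 0; · exact Or.inl (Or.inl h1)
        by_cases h2 : y < 0; · exact Or.inl (Or.inr (Or.inl h2))
        by_cases h3 : z < 0; · exact Or.inl (Or.inr (Or.inr (Or.inl h3)))
        exact Or.inr (by omega)
      · exact Or.inl (Or.inr (Or.inr (Or.inr h)))
    · rintro ((h | h | h | h) | ⟨h1, h2, h3⟩)
      · exact Or.inl h
      · exact Or.inr (Or.inl h)
      · exact Or.inr (Or.inr (Or.inl h))
      · exact Or.inr (Or.inr (Or.inr (Or.inr h)))
      · exact Or.inr (Or.inr (Or.inr (Or.inl (by omega))))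
  by_cases hc : x = b1 ∧ y = b2 ∧ z = b3
  · have hn : ¬ π.Ext x y z := by
      rw [hc.1, hc.2.1, hc.2.2, ext_natCast]; exact hb.1
    rw [if_pos (e.2 (Or.inr hc)), if_neg hn, if_pos hc]; rfl
  · rw [if_neg hc, add_zero]
    by_cases hn : π.Ext x y z
    · rw [if_pos hn, if_pos (e.2 (Or.inl hn))]
    · rw [if_neg hn, if_neg fun h => (e.1 h).elim hn hc]

theorem ord_ins (hb : π.Addable b) (p : Box) :
    (π.ins b).ord p = π.ord p + ordBox b p := by
  obtain ⟨b1, b2, b3⟩ := b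
  obtain ⟨x, y, z⟩ := p
  simp only [ord, ordBox, ind_ins hb, Prod.mk.injEq]
  have k (P Q : Prop) [Decidable P] [Decidable Q] (h : P ↔ Q) :
      (if P then (1 : ℤ) else 0) = if Q then 1 else 0 := by simp [h]
  rw [k ((x : ℤ) = b1 ∧ (y : ℤ) = b2 ∧ (z : ℤ) = b3) (x = b1 ∧ y = b2 ∧ z = b3) (by omega),
    k ((x : ℤ) - 1 = b1 ∧ (y : ℤ) = b2 ∧ (z : ℤ) = b3) (x = b1 + 1 ∧ y = b2 ∧ z = b3) (by omega),
    k ((x : ℤ) = b1 ∧ (y : ℤ) - 1 = b2 ∧ (z : ℤ) = b3) (x = b1 ∧ y = b2 + 1 ∧ z = b3) (by omega),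
    k ((x : ℤ) = b1 ∧ (y : ℤ) = b2 ∧ (z : ℤ) - 1 = b3) (x = b1 ∧ y = b2 ∧ z = b3 + 1) (by omega),
    k ((x : ℤ) - 1 = b1 ∧ (y : ℤ) - 1 = b2 ∧ (z : ℤ) = b3) (x = b1 + 1 ∧ y = b2 + 1 ∧ z = b3)
      (by omega),
    k ((x : ℤ) - 1 = b1 ∧ (y : ℤ) = b2 ∧ (z : ℤ) - 1 = b3) (x = b1 + 1 ∧ y = b2 ∧ z = b3 + 1)
      (by omega),
    k ((x : ℤ) = b1 ∧ (y : ℤ) - 1 = b2 ∧ (z : ℤ) - 1 = b3) (x = b1 ∧ y = b2 + 1 ∧ z = b3 + 1)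
      (by omega),
    k ((x : ℤ) - 1 = b1 ∧ (y : ℤ) - 1 = b2 ∧ (z : ℤ) - 1 = b3)
      (x = b1 + 1 ∧ y = b2 + 1 ∧ z = b3 + 1) (by omega)]
  ring

theorem ord_empty (p : Box) : empty.ord p = if p = (0, 0, 0) then -1 else 0 := by
  obtain ⟨x, y, z⟩ := p
  simp only [ord, ind, Ext, empty, Finset.notMem_empty, or_false, Prod.mk.injEq]
  rcases x with _ | x <;> rcases y with _ | y <;> rcases z with _ | z <;> simp <;> omega

end PlanePartition

open PlanePartition

theorem sum_ordBox {M : ℕ} {b : Box} (hb : b ∈ cube M) :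
    ∑ p ∈ cube (M + 1), ordBox b p = 0 := by
  rw [mem_cube] at hb
  simp only [ordBox, Finset.sum_add_distrib, Finset.sum_sub_distrib, Finset.sum_ite_eq']
  simp only [mem_cube]
  rw [if_pos (by omega), if_pos (by omega), if_pos (by omega), if_pos (by omega),
    if_pos (by omega), if_pos (by omega), if_pos (by omega), if_pos (by omega)]
  norm_num

/-- The total order -1 balances the factor u + σ₃; this is the statement that ψ_π has numerator and
denominator of equal degree. -/
theorem sum_ord (π : PlanePartition) {M : ℕ} (hM : π.boxes ⊆ cube M) :
    ∑ p ∈ cube (M + 1), π.ord p = -1 := by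
  induction π using induction_ins with
  | h0 => simp only [ord_empty, Finset.sum_ite_eq', mem_cube]; simp
  | h1 π b hb ih =>
    simp only [ins_boxes hb, Finset.insert_subset_iff] at hM
    simp only [ord_ins hb, Finset.sum_add_distrib, ih hM.2, sum_ordBox hM.1, add_zero]

/-- One unit step from `b` gives the weights h_b + h_i, hence the poles of φ(u - h_b). Two different
steps give h_b - h_k because h₁ + h₂ + h₃ = 0, hence the zeros. -/
theorem varphi_eq_prod {h : Fin 3 → ℂ} (H : Generic h) {M : ℕ} {b : Box} (hb : b ∈ cube M) {u : ℂ}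
    (hu : ∀ p ∈ cube (M + 1), u ≠ boxWeight h p) :
    varphi h (u - boxWeight h b) = ∏ p ∈ cube (M + 1), (u - boxWeight h p) ^ ordBox b p := by
  rw [mem_cube] at hb
  obtain ⟨x, y, z⟩ := b
  have n (p) (hp : p ∈ cube (M + 1)) : u - boxWeight h p ≠ 0 := sub_ne_zero.2 (hu p hp)
  have k (c : Box) (hc : c ∈ cube (M + 1)) : ∏ p ∈ cube (M + 1),
      (u - boxWeight h p) ^ (if p = c then (1 : ℤ) else 0) = u - boxWeight h c := by
    rw [Finset.prod_eq_single_of_mem c hc]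
    · simp
    · intro p _ hp; simp [hp]
  have m0 : (x, y, z) ∈ cube (M + 1) := by rw [mem_cube]; simp only at *; omega
  have m1 : (x + 1, y, z) ∈ cube (M + 1) := by rw [mem_cube]; simp only at *; omega
  have m2 : (x, y + 1, z) ∈ cube (M + 1) := by rw [mem_cube]; simp only at *; omega
  have m3 : (x, y, z + 1) ∈ cube (M + 1) := by rw [mem_cube]; simp only at *; omega
  have m4 : (x + 1, y + 1, z) ∈ cube (M + 1) := by rw [mem_cube]; simp only at *; omega
  have m5 : (x + 1, y, z + 1) ∈ cube (M + 1) := by rw [mem_cube]; simp only at *; omega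
  have m6 : (x, y + 1, z + 1) ∈ cube (M + 1) := by rw [mem_cube]; simp only at *; omega
  have m7 : (x + 1, y + 1, z + 1) ∈ cube (M + 1) := by rw [mem_cube]; simp only at *; omega
  have e : ∀ p ∈ cube (M + 1), (u - boxWeight h p) ^ ordBox (x, y, z) p =
      (u - boxWeight h p) ^ (if p = (x, y, z) then (1 : ℤ) else 0)
      / (u - boxWeight h p) ^ (if p = (x + 1, y, z) then (1 : ℤ) else 0)
      / (u - boxWeight h p) ^ (if p = (x, y + 1, z) then (1 : ℤ) else 0)
      / (u - boxWeight h p) ^ (if p = (x, y, z + 1) then (1 : ℤ) else 0)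
      * (u - boxWeight h p) ^ (if p = (x + 1, y + 1, z) then (1 : ℤ) else 0)
      * (u - boxWeight h p) ^ (if p = (x + 1, y, z + 1) then (1 : ℤ) else 0)
      * (u - boxWeight h p) ^ (if p = (x, y + 1, z + 1) then (1 : ℤ) else 0)
      / (u - boxWeight h p) ^ (if p = (x + 1, y + 1, z + 1) then (1 : ℤ) else 0) := by
    intro p hp
    rw [ordBox, zpow_sub₀ (n p hp), zpow_add₀ (n p hp), zpow_add₀ (n p hp), zpow_add₀ (n p hp),
      zpow_sub₀ (n p hp), zpow_sub₀ (n p hp), zpow_sub₀ (n p hp)]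
  rw [Finset.prod_congr rfl e]
  simp only [Finset.prod_mul_distrib, Finset.prod_div_distrib]
  rw [k _ m0, k _ m1, k _ m2, k _ m3, k _ m4, k _ m5, k _ m6, k _ m7]
  have n0 := n _ m0
  have n1 := n _ m1
  have n2 := n _ m2
  have n3 := n _ m3
  have n7 := n _ m7
  have s := H.sum
  -- The two extreme corners have the same weight and opposite exponents, so they cancel.
  have e0 : boxWeight h (x + 1, y + 1, z + 1) = boxWeight h (x, y, z) := by
    simp only [boxWeight]; push_cast; linear_combination s
  rw [e0]
  set v := u - boxWeight h (x, y, z) with hv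
  have e1 : u - boxWeight h (x + 1, y, z) = v - h 1 := by simp only [hv, boxWeight]; push_cast; ring
  have e2 : u - boxWeight h (x, y + 1, z) = v - h 0 := by simp only [hv, boxWeight]; push_cast; ring
  have e3 : u - boxWeight h (x, y, z + 1) = v - h 2 := by simp only [hv, boxWeight]; push_cast; ring
  have e4 : u - boxWeight h (x + 1, y + 1, z) = v + h 2 := by
    simp only [hv, boxWeight]; push_cast; linear_combination -s
  have e5 : u - boxWeight h (x + 1, y, z + 1) = v + h 0 := by
    simp only [hv, boxWeight]; push_cast; linear_combination -s
  have e6 : u - boxWeight h (x, y + 1, z + 1) = v + h 1 := by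
    simp only [hv, boxWeight]; push_cast; linear_combination -s
  rw [e1] at n1; rw [e2] at n2; rw [e3] at n3
  rw [e1, e2, e3, e4, e5, e6, varphi]
  field_simp

theorem psiFun_ins (h : Fin 3 → ℂ) {π : PlanePartition} {b : Box} (hb : π.Addable b) (u : ℂ) :
    psiFun h (π.ins b) u = psiFun h π u * varphi h (u - boxWeight h b) := by
  rw [psiFun, psiFun, ins_boxes hb, Finset.prod_insert hb.1]
  ring

theorem psiFun_eq_prod {h : Fin 3 → ℂ} (H : Generic h) (π : PlanePartition) {M : ℕ}
    (hM : π.boxes ⊆ cube M) {u : ℂ} (hu : ∀ p ∈ cube (M + 1), u ≠ boxWeight h p) :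
    psiFun h π u = (u + sigma3 h) * ∏ p ∈ cube (M + 1), (u - boxWeight h p) ^ π.ord p := by
  induction π using induction_ins with
  | h0 =>
    rw [Finset.prod_eq_single_of_mem ((0, 0, 0) : Box) (by simp [mem_cube])]
    · rw [ord_empty]; simp [psiFun, empty, boxWeight, div_eq_mul_inv]
    · intro p _ hp; simp [ord_empty, hp]
  | h1 π b hb ih =>
    simp only [ins_boxes hb, Finset.insert_subset_iff] at hM
    rw [psiFun_ins h hb, ih hM.2, varphi_eq_prod H hM.1 hu, mul_assoc, ← Finset.prod_mul_distrib]
    refine congrArg _ (Finset.prod_congr rfl fun p hp => ?_)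
    rw [ord_ins hb, zpow_add₀ (sub_ne_zero.2 (hu p hp))]

end

section

open Filter Topology PlanePartition

/-! ### Partial fractions of `ψ_π` -/

theorem eventually_ne_weights (h : Fin 3 → ℂ) (s : Finset Box) (x : ℂ) :
    ∀ᶠ u in 𝓝[≠] x, ∀ p ∈ s, u ≠ boxWeight h p := by
  rw [Filter.eventually_all_finset]
  intro p _
  by_cases e : x = boxWeight h p
  · rw [← e]; exact eventually_mem_nhdsWithin
  · exact eventually_nhdsWithin_of_eventually_nhds (eventually_ne_nhds e)

open Polynomial in
-- Write ψ_π = N/D with D the nodal polynomial of the simple poles. Both are monic of the same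
-- degree, so N - D has lower degree and is its own Lagrange interpolant at the poles; dividing by D
-- gives the expansion, with constant term 1.
theorem exists_partialFraction {h : Fin 3 → ℂ} (H : Generic h) (π : PlanePartition) {M : ℕ}
    (hM : π.boxes ⊆ cube M) : ∃ r : Box → ℂ,
      (∀ u, (∀ p ∈ cube (M + 1), u ≠ boxWeight h p) → psiFun h π u =
        1 + ∑ p ∈ cube (M + 1) with π.ord p = -1, r p / (u - boxWeight h p)) := by
  set P := (cube (M + 1)).filter fun p => π.ord p = -1 with hP
  set Z := (cube (M + 1)).filter fun p => ¬ π.ord p = -1 with hZ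
  set N : ℂ[X] := (X + C (sigma3 h)) * ∏ p ∈ Z, (X - C (boxWeight h p)) ^ (π.ord p).toNat with hN
  have hinj : Set.InjOn (boxWeight h) (P : Set Box) := by
    intro p hp p' hp' e
    rw [Finset.mem_coe, hP, Finset.mem_filter] at hp hp'
    exact weight_inj_of_ord H (by rw [hp.2]; simp) (by rw [hp'.2]; simp) e
  have hmon : (∏ p ∈ Z, (X - C (boxWeight h p)) ^ (π.ord p).toNat).Monic :=
    monic_prod_of_monic _ _ fun p _ => (monic_X_sub_C _).pow _
  have hNm : N.Monic := (monic_X_add_C _).mul hmon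
  have hdeg : N.natDegree = P.card := by
    rw [hN, (monic_X_add_C _).natDegree_mul hmon, natDegree_X_add_C,
      natDegree_prod_of_monic _ _ fun p _ => (monic_X_sub_C _).pow _]
    simp only [natDegree_pow, natDegree_X_sub_C, mul_one]
    have h1 := sum_ord π hM
    rw [← Finset.sum_filter_add_sum_filter_not _ (fun p => π.ord p = -1)] at h1
    have h2 : ∑ p ∈ cube (M + 1) with π.ord p = -1, π.ord p = -(P.card : ℤ) := by
      rw [Finset.sum_congr rfl fun p hp => (Finset.mem_filter.1 hp).2]; simp [hP]
    have h3 : ∑ p ∈ cube (M + 1) with ¬ π.ord p = -1, π.ord p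
        = ((∑ p ∈ Z, (π.ord p).toNat : ℕ) : ℤ) := by
      rw [Nat.cast_sum]
      refine Finset.sum_congr rfl fun p hp => ?_
      have := (π.ord_cases p).1
      have := (Finset.mem_filter.1 hp).2
      omega
    -- The total order is -1, so the positive orders sum to (number of poles) - 1; the factor u + σ₃
    -- supplies the missing degree.
    omega
  set D := Lagrange.nodal P (boxWeight h) with hD
  have hlt : (N - D).degree < P.card := by
    have e1 : N.degree = P.card := by rw [degree_eq_natDegree hNm.ne_zero, hdeg]
    have := degree_sub_lt_left (p := N) (q := D) (by rw [e1, hD, Lagrange.degree_nodal])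
      hNm.ne_zero (by rw [hNm.leadingCoeff, (Lagrange.nodal_monic).leadingCoeff])
    rwa [e1] at this
  have hint := Lagrange.eq_interpolate hinj hlt
  refine ⟨fun p => Lagrange.nodalWeight P (boxWeight h) p * (N - D).eval (boxWeight h p),
    fun u hu => ?_⟩
  have huP : ∀ p ∈ P, u ≠ boxWeight h p := fun p hp => hu p (Finset.mem_filter.1 hp).1
  have hDu : D.eval u ≠ 0 := by
    rw [hD, Lagrange.eval_nodal, Finset.prod_ne_zero_iff]
    exact fun p hp => sub_ne_zero.2 (huP p hp)
  have key : (N - D).eval u = _ := (congrArg (eval u) hint).trans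
    (Lagrange.eval_interpolate_not_at_node _ huP)
  have hprod : psiFun h π u = N.eval u / D.eval u := by
    rw [psiFun_eq_prod H π hM hu, ← Finset.prod_filter_mul_prod_filter_not _ (fun p => π.ord p =
        -1),
      hN, hD, Lagrange.eval_nodal, eval_mul, eval_prod]
    have h2 : ∏ p ∈ cube (M + 1) with π.ord p = -1, (u - boxWeight h p) ^ π.ord p
        = (∏ p ∈ P, (u - boxWeight h p))⁻¹ := by
      rw [← Finset.prod_inv_distrib]
      refine Finset.prod_congr rfl fun p hp => ?_
      rw [(Finset.mem_filter.1 hp).2, zpow_neg_one]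
    have h3 : ∏ p ∈ cube (M + 1) with ¬ π.ord p = -1, (u - boxWeight h p) ^ π.ord p
        = ∏ p ∈ Z, eval u ((X - C (boxWeight h p)) ^ (π.ord p).toNat) := by
      refine Finset.prod_congr rfl fun p hp => ?_
      have h4 := (π.ord_cases p).1
      have h5 := (Finset.mem_filter.1 hp).2
      rw [eval_pow, eval_sub, eval_X, eval_C, ← zpow_natCast, Int.toNat_of_nonneg (by omega)]
    rw [h2, h3]
    simp only [eval_add, eval_X, eval_C]
    ring
  have e2 : psiFun h π u = 1 + (N - D).eval u / D.eval u := by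
    rw [hprod, eval_sub]; field_simp; ring
  rw [e2, key, mul_div_cancel_left₀ _ hDu]
  refine congrArg _ (Finset.sum_congr rfl fun p _ => ?_)
  rw [div_eq_mul_inv]; ring

theorem tendsto_residue {h : Fin 3 → ℂ} {f : ℂ → ℂ} {s t : Finset Box} {r : Box → ℂ} {p : Box}
    (hf : ∀ u, (∀ p ∈ s, u ≠ boxWeight h p) → f u = 1 + ∑ p ∈ t, r p / (u - boxWeight h p))
    (hp : p ∈ t) (hinj : ∀ p' ∈ t, p' ≠ p → boxWeight h p' ≠ boxWeight h p) :
    Tendsto (fun u => (u - boxWeight h p) * f u) (𝓝[≠] boxWeight h p) (𝓝 (r p)) := by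
  have h1 : Tendsto (fun u => (u - boxWeight h p) * (1 + ∑ p' ∈ t.erase p,
      r p' / (u - boxWeight h p')) + r p) (𝓝[≠] boxWeight h p)
      (𝓝 ((boxWeight h p - boxWeight h p) * (1 + ∑ p' ∈ t.erase p,
      r p' / (boxWeight h p - boxWeight h p')) + r p)) := by
    refine Tendsto.mono_left ?_ nhdsWithin_le_nhds
    refine ((tendsto_id.sub_const _).mul (tendsto_const_nhds.add (tendsto_finsetSum _
        ?_))).add_const _
    intro p' hp'
    refine tendsto_const_nhds.div (tendsto_id.sub_const _) (sub_ne_zero.2 ?_)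
    exact (hinj p' (Finset.mem_of_mem_erase hp') (Finset.ne_of_mem_erase hp')).symm
  rw [sub_self, zero_mul, zero_add] at h1
  refine h1.congr' ?_
  filter_upwards [eventually_ne_weights h s (boxWeight h p), eventually_mem_nhdsWithin] with u hu
      hu'
  rw [hf u hu, ← Finset.add_sum_erase t _ hp]
  have : u - boxWeight h p ≠ 0 := sub_ne_zero.2 hu'
  field_simp
  ring

namespace PlanePartition

/-- The finite set of addable boxes. -/
def addFin (π : PlanePartition) : Finset Box :=
  Finset.univ.map (Function.Embedding.subtype π.Addable)

/-- The finite set of removable boxes. -/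
def remFin (π : PlanePartition) : Finset Box :=
  Finset.univ.map (Function.Embedding.subtype π.Removable)

variable {π : PlanePartition} {b : Box}

@[simp] theorem mem_addFin : b ∈ π.addFin ↔ π.Addable b := by simp [addFin]

@[simp] theorem mem_remFin : b ∈ π.remFin ↔ π.Removable b := by simp [remFin]

theorem sum_addFin {A : Type*} [AddCommMonoid A] (F : Box → A) :
    ∑ b ∈ π.addFin, F b = ∑ b : {b : Box // π.Addable b}, F b := by
  simp [addFin]

theorem sum_remFin {A : Type*} [AddCommMonoid A] (F : Box → A) :
    ∑ b ∈ π.remFin, F b = ∑ b : {b : Box // π.Removable b}, F b := by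
  simp [remFin]

end PlanePartition

theorem boxWeight_up {h : Fin 3 → ℂ} (H : Generic h) (b : Box) :
    boxWeight h (up b) = boxWeight h b := by
  simp only [boxWeight, up]; push_cast; linear_combination H.sum

theorem up_injective : Function.Injective up := by
  rintro ⟨x, y, z⟩ ⟨x', y', z'⟩ e
  simpa [up] using e

theorem exists_residue {h : Fin 3 → ℂ} (H : Generic h) {π : PlanePartition} {b : Box}
    (hb : π.Addable b) : ∃ r, Tendsto (fun u => (u - boxWeight h b) * psiFun h π u)
      (𝓝[≠] boxWeight h b) (𝓝 r) := by
  obtain ⟨M, hM⟩ := π.exists_cube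
  obtain ⟨r, hr⟩ := exists_partialFraction H π hM
  refine ⟨r b, tendsto_residue hr ?_ ?_⟩
  · rw [Finset.mem_filter, ord_eq_neg_one]
    exact ⟨hb.mem_cube hM, Or.inl hb⟩
  · intro p hp hne e
    rw [Finset.mem_filter] at hp
    refine hne (weight_inj_of_ord H (by rw [hp.2]; simp) ?_ e)
    rw [(ord_eq_neg_one b).2 (Or.inl hb)]; simp

theorem varphi_zero {h : Fin 3 → ℂ} (H : Generic h) : varphi h 0 = -1 := by
  have h0 := H.h0_ne
  have h1 := H.h1_ne
  have h2 := H.h2_ne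
  rw [varphi]; field_simp; ring

/-- `E(π → π+□)² ` is `1/σ₃` times the residue. -/
def HasResidues (h : Fin 3 → ℂ) (E : PlanePartition → Box → ℂ) : Prop :=
  ∀ (π : PlanePartition) (b : Box), π.Addable b →
    Tendsto (fun u => (u - boxWeight h b) * psiFun h π u)
        (𝓝[≠] boxWeight h b) (𝓝 (sigma3 h * E π b ^ 2))

/-- Since ψ_π(u) = ψ_{π-□}(u) φ(u - h_□) and φ(0) = -1, the residue at a removable box is minus the
one at the same box before it was added. -/
theorem HasResidues.removable {h : Fin 3 → ℂ} (H : Generic h) {E : PlanePartition → Box → ℂ}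
    (hE : HasResidues h E) {π : PlanePartition} {b : Box} (hb : π.Removable b) :
    Tendsto (fun u => (u - boxWeight h b) * psiFun h π u)
        (𝓝[≠] boxWeight h b) (𝓝 (-(sigma3 h * E (π.del b) b ^ 2))) := by
  have h1 := hE _ _ (addable_del hb)
  have h2 : Tendsto (fun u => varphi h (u - boxWeight h b)) (𝓝[≠] boxWeight h b) (𝓝 (-1)) := by
    rw [← varphi_zero H]
    have hc : ContinuousAt (varphi h) 0 := by
      unfold varphi
      have h0 := H.h0_ne
      have h1 := H.h1_ne
      have h2 := H.h2_ne
      refine ContinuousAt.div (by fun_prop) (by fun_prop) ?_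
      simp [h0, h1, h2]
    have h3 : Tendsto (fun u => u - boxWeight h b) (𝓝 (boxWeight h b)) (𝓝 0) := by
      rw [← sub_self (boxWeight h b)]
      exact tendsto_id.sub_const _
    exact (hc.tendsto.comp h3).mono_left nhdsWithin_le_nhds
  have h3 := h1.mul h2
  rw [mul_neg_one] at h3
  refine h3.congr fun u => ?_
  have := psiFun_ins h (addable_del hb) u
  rw [ins_del hb] at this
  rw [this, mul_assoc]

/-- The partial fraction expansion of `ψ_π(u)`. -/
theorem HasResidues.psiFun_eq {h : Fin 3 → ℂ} (H : Generic h) {E : PlanePartition → Box → ℂ}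
    (hE : HasResidues h E) (π : PlanePartition) : ∃ M, ∀ u, (∀ p ∈ cube M, u ≠ boxWeight h p) →
      psiFun h π u = 1 + sigma3 h * (∑ b ∈ π.addFin, E π b ^ 2 / (u - boxWeight h b)
        - ∑ b ∈ π.remFin, E (π.del b) b ^ 2 / (u - boxWeight h b)) := by
  obtain ⟨M, hM⟩ := π.exists_cube
  obtain ⟨r, hr⟩ := exists_partialFraction H π hM
  have hinj (p p' : Box) (hp : π.ord p = -1) (hp' : π.ord p' = -1) (hne : p' ≠ p) :
      boxWeight h p' ≠ boxWeight h p := fun e =>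
    hne (weight_inj_of_ord H (by rw [hp']; simp) (by rw [hp]; simp) e)
  -- A removable box contributes through its shift by (1,1,1), which has the same weight; the two
  -- kinds of poles are disjoint as boxes.
  have hset : (cube (M + 1)).filter (fun p => π.ord p = -1)
      = π.addFin ∪ π.remFin.image up := by
    ext p
    rw [Finset.mem_filter, ord_eq_neg_one, Finset.mem_union, mem_addFin, Finset.mem_image]
    constructor
    · rintro ⟨_, hp | ⟨b, hb, rfl⟩⟩
      · exact Or.inl hp
      · exact Or.inr ⟨b, mem_remFin.2 hb, rfl⟩
    · rintro (hp | ⟨b, hb, rfl⟩)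
      · exact ⟨hp.mem_cube hM, Or.inl hp⟩
      · rw [mem_remFin] at hb
        refine ⟨?_, Or.inr ⟨b, hb, rfl⟩⟩
        have := mem_cube.1 (hM hb.1)
        rw [mem_cube]; simp only [up]; omega
  have hdis : Disjoint π.addFin (π.remFin.image up) := by
    rw [Finset.disjoint_left]
    intro p hp hp'
    rw [mem_addFin] at hp
    obtain ⟨b, hb, rfl⟩ := Finset.mem_image.1 hp'
    rw [mem_remFin, removable_iff] at hb
    have h1 : (b.1 + 1, b.2.1, b.2.2) ∈ π.boxes :=
      (addable_iff.1 hp).2 _ (by simp [up, Prod.le_def])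
        (fun e => by have := congrArg (fun c : Box => c.2.1) e; simp [up] at this)
    have h2 := hb.2 _ h1 (by simp [Prod.le_def])
    have h3 := congrArg Prod.fst h2
    simp at h3
  refine ⟨M + 1, fun u hu => ?_⟩
  rw [hr u hu, hset, Finset.sum_union hdis, Finset.sum_image (fun _ _ _ _ e => up_injective e)]
  have e1 : ∀ b ∈ π.addFin, r b = sigma3 h * E π b ^ 2 := by
    intro b hb
    have hb' := mem_addFin.1 hb
    have ho := (ord_eq_neg_one b).2 (Or.inl hb')
    refine tendsto_nhds_unique (tendsto_residue hr ?_ ?_) (hE π b hb')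
    · rw [Finset.mem_filter]; exact ⟨hb'.mem_cube hM, ho⟩
    · exact fun p hp hne => hinj _ _ ho (Finset.mem_filter.1 hp).2 hne
  have e2 : ∀ b ∈ π.remFin, r (up b) = -(sigma3 h * E (π.del b) b ^ 2) := by
    intro b hb
    have hb' := mem_remFin.1 hb
    have ho := (ord_eq_neg_one (up b)).2 (Or.inr ⟨b, hb', rfl⟩)
    have hmem : up b ∈ (cube (M + 1)).filter (fun p => π.ord p = -1) := by
      rw [hset]; exact Finset.mem_union_right _ (Finset.mem_image_of_mem _ hb)
    have h1 := tendsto_residue hr hmem (fun p hp hne => hinj _ _ ho (Finset.mem_filter.1 hp).2 hne)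
    rw [boxWeight_up H] at h1
    exact tendsto_nhds_unique h1 (hE.removable H hb')
  rw [mul_sub, Finset.mul_sum, Finset.mul_sum, sub_eq_add_neg, ← Finset.sum_neg_distrib]
  congr 2
  · exact Finset.sum_congr rfl fun b hb => by rw [e1 b hb]; ring
  · exact Finset.sum_congr rfl fun b hb => by rw [e2 b hb, boxWeight_up H]; ring

end

section

open Filter Topology PlanePartition

/-! ### Raising, lowering and diagonal operators -/

/-- The raising operator `|π⟩ ↦ ∑ φ(h_□) E(π → π+□) |π+□⟩`. -/
def eOp (h : Fin 3 → ℂ) (E : PlanePartition → Box → ℂ) (φ : ℂ → ℂ) : Module.End ℂ Fock :=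
  Finsupp.linearCombination ℂ fun π : PlanePartition =>
    ∑ b ∈ π.addFin, (φ (boxWeight h b) * E π b) • ket (π.ins b)

/-- The lowering operator `|π⟩ ↦ -∑ φ(h_□) E(π-□ → π) |π-□⟩`. -/
def fOp (h : Fin 3 → ℂ) (E : PlanePartition → Box → ℂ) (φ : ℂ → ℂ) : Module.End ℂ Fock :=
  Finsupp.linearCombination ℂ fun π : PlanePartition =>
    ∑ b ∈ π.remFin, (φ (boxWeight h b) * -E (π.del b) b) • ket (π.del b)

/-- The diagonal operator `|π⟩ ↦ d(π) |π⟩`. -/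
def dOp (d : PlanePartition → ℂ) : Module.End ℂ Fock :=
  Finsupp.linearCombination ℂ fun π : PlanePartition => d π • ket π

/-- The symmetric bilinear form for which the basis `|π⟩` is orthonormal. -/
def form : Fock →ₗ[ℂ] Fock →ₗ[ℂ] ℂ :=
  Finsupp.linearCombination ℂ fun π : PlanePartition => Finsupp.lapply π

/-- The operators `X` and `Y` are transposes of each other. -/
def IsAdj (X Y : Module.End ℂ Fock) : Prop := ∀ x y, form (X x) y = form x (Y y)

theorem op_ext {X Y : Module.End ℂ Fock} (H : ∀ π, X (ket π) = Y (ket π)) : X = Y :=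
  Finsupp.lhom_ext' fun π => LinearMap.ext_ring (H π)

theorem eOp_ket (h : Fin 3 → ℂ) (E : PlanePartition → Box → ℂ) (φ : ℂ → ℂ) (π : PlanePartition) :
    eOp h E φ (ket π) = ∑ b ∈ π.addFin, (φ (boxWeight h b) * E π b) • ket (π.ins b) := by
  simp [eOp, ket, Finsupp.linearCombination_single]

theorem fOp_ket (h : Fin 3 → ℂ) (E : PlanePartition → Box → ℂ) (φ : ℂ → ℂ) (π : PlanePartition) :
    fOp h E φ (ket π) =
      ∑ b ∈ π.remFin, (φ (boxWeight h b) * -E (π.del b) b) • ket (π.del b) := by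
  simp [fOp, ket, Finsupp.linearCombination_single]

theorem dOp_ket (d : PlanePartition → ℂ) (π : PlanePartition) :
    dOp d (ket π) = d π • ket π := by
  simp [dOp, ket, Finsupp.linearCombination_single]

theorem ket_apply (π τ : PlanePartition) [Decidable (π = τ)] :
    ket π τ = if π = τ then 1 else 0 := by
  classical
  rw [ket, Finsupp.single_apply]

theorem form_ket_left (π : PlanePartition) (y : Fock) : form (ket π) y = y π := by
  simp [form, ket, Finsupp.linearCombination_single]

theorem form_bilin_ext {B B' : Fock →ₗ[ℂ] Fock →ₗ[ℂ] ℂ}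
    (H : ∀ π τ, B (ket π) (ket τ) = B' (ket π) (ket τ)) : B = B' :=
  Finsupp.lhom_ext' fun π => LinearMap.ext_ring
    (Finsupp.lhom_ext' fun τ => LinearMap.ext_ring (H π τ))

theorem form_symm (x y : Fock) : form x y = form y x := by
  classical
  have : form = form.flip := form_bilin_ext fun π τ => by
    rw [LinearMap.flip_apply, form_ket_left, form_ket_left, ket_apply, ket_apply]
    simp only [eq_comm]
  exact congrArg (fun B : Fock →ₗ[ℂ] Fock →ₗ[ℂ] ℂ => B x y) this

theorem form_ket_right (π : PlanePartition) (x : Fock) : form x (ket π) = x π := by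
  rw [form_symm, form_ket_left]

theorem eq_of_form {x y : Fock} (H : ∀ v, form v x = form v y) : x = y := by
  ext π
  rw [← form_ket_left, ← form_ket_left, H]

namespace IsAdj

variable {X Y X' Y' : Module.End ℂ Fock}

theorem of_ket (H : ∀ π τ, X (ket π) τ = Y (ket τ) π) : IsAdj X Y := by
  have : form.comp X = form.compl₂ Y := form_bilin_ext fun π τ => by
    rw [LinearMap.comp_apply, LinearMap.compl₂_apply, form_ket_right, form_ket_left, H]
  exact fun x y => congrArg (fun B : Fock →ₗ[ℂ] Fock →ₗ[ℂ] ℂ => B x y) this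

theorem symm (H : IsAdj X Y) : IsAdj Y X := fun x y => by
  rw [form_symm, ← H, form_symm]

theorem add (H : IsAdj X Y) (H' : IsAdj X' Y') : IsAdj (X + X') (Y + Y') := fun x y => by
  simp [H x y, H' x y]

theorem sub (H : IsAdj X Y) (H' : IsAdj X' Y') : IsAdj (X - X') (Y - Y') := fun x y => by
  simp [H x y, H' x y]

theorem smul (c : ℂ) (H : IsAdj X Y) : IsAdj (c • X) (c • Y) := fun x y => by simp [H x y]

theorem mul (H : IsAdj X Y) (H' : IsAdj X' Y') : IsAdj (X * X') (Y' * Y) := fun x y => by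
  rw [Module.End.mul_apply, Module.End.mul_apply, H, H']

theorem bracket (H : IsAdj X Y) (H' : IsAdj X' Y') : IsAdj ⁅X, X'⁆ ⁅Y', Y⁆ := by
  rw [Ring.lie_def, Ring.lie_def]
  exact (H.mul H').sub (H'.mul H)

theorem zero : IsAdj 0 0 := fun x y => by simp

theorem one : IsAdj 1 1 := fun x y => by simp

theorem sum {ι : Type*} {s : Finset ι} {F G : ι → Module.End ℂ Fock}
    (H : ∀ i ∈ s, IsAdj (F i) (G i)) : IsAdj (∑ i ∈ s, F i) (∑ i ∈ s, G i) := fun x y => by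
  simp only [LinearMap.sum_apply, map_sum]
  exact Finset.sum_congr rfl fun i hi => H i hi x y

theorem unique (H : IsAdj X Y) (H' : IsAdj X Y') : Y = Y' :=
  LinearMap.ext fun y => eq_of_form fun v => by rw [← H, ← H']

theorem eq_of_eq (H : IsAdj X Y) (H' : IsAdj X' Y') (e : X = X') : Y = Y' :=
  H.unique (e ▸ H')

end IsAdj

/-! ### Commutators of raising, lowering and diagonal operators -/

section

variable {h : Fin 3 → ℂ} {E : PlanePartition → Box → ℂ} {φ χ : ℂ → ℂ}

theorem isAdj_eOp (h : Fin 3 → ℂ) (E : PlanePartition → Box → ℂ) (φ : ℂ → ℂ) :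
    IsAdj (eOp h E φ) (-fOp h E φ) := by
  classical
  refine IsAdj.of_ket fun π τ => ?_
  rw [LinearMap.neg_apply, eOp_ket, fOp_ket, ← Finset.sum_neg_distrib]
  simp only [Finsupp.finsetSum_apply, Finsupp.smul_apply, Finsupp.neg_apply, ket_apply, smul_eq_mul,
    mul_ite, mul_one, mul_zero, mul_neg]
  have e : ∀ b ∈ τ.remFin, -(if τ.del b = π then -(φ (boxWeight h b) * E (τ.del b) b) else 0)
      = if τ.del b = π then φ (boxWeight h b) * E (τ.del b) b else 0 := by
    intro b _; split_ifs <;> simp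
  rw [Finset.sum_congr rfl e, ← Finset.sum_filter, ← Finset.sum_filter]
  have hs : π.addFin.filter (fun b => π.ins b = τ) = τ.remFin.filter fun b => τ.del b = π := by
    ext b
    simp only [Finset.mem_filter, mem_addFin, mem_remFin]
    constructor
    · rintro ⟨hb, rfl⟩; exact ⟨removable_ins hb, del_ins hb⟩
    · rintro ⟨hb, rfl⟩; exact ⟨addable_del hb, ins_del hb⟩
  rw [hs]
  exact Finset.sum_congr rfl fun b hb => by rw [(Finset.mem_filter.1 hb).2]

theorem isAdj_fOp (h : Fin 3 → ℂ) (E : PlanePartition → Box → ℂ) (φ : ℂ → ℂ) :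
    IsAdj (fOp h E φ) (-eOp h E φ) := fun x y => by
  have := isAdj_eOp h E φ y x
  simp only [LinearMap.neg_apply, map_neg] at this ⊢
  rw [form_symm, form_symm x, this, neg_neg]

theorem isAdj_dOp (d : PlanePartition → ℂ) : IsAdj (dOp d) (dOp d) := by
  classical
  refine IsAdj.of_ket fun π τ => ?_
  simp only [dOp_ket, Finsupp.smul_apply, ket_apply]
  by_cases e : π = τ
  · simp [e]
  · simp [e, Ne.symm e]

theorem fOp_apply (v : Fock) (μ : PlanePartition) : fOp h E φ v μ =
    -∑ b ∈ μ.addFin, φ (boxWeight h b) * E μ b * v (μ.ins b) := by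
  rw [← form_ket_right, isAdj_fOp h E φ, LinearMap.neg_apply, map_neg, eOp_ket, map_sum]
  simp [form_ket_right]

theorem eOp_apply (v : Fock) (τ : PlanePartition) : eOp h E φ v τ =
    ∑ b ∈ τ.remFin, φ (boxWeight h b) * E (τ.del b) b * v (τ.del b) := by
  rw [← form_ket_right, isAdj_eOp h E φ, LinearMap.neg_apply, map_neg, fOp_ket, map_sum]
  simp [form_ket_right]

theorem eOp_congr (H : ∀ b, φ (boxWeight h b) = χ (boxWeight h b)) : eOp h E φ = eOp h E χ :=
  op_ext fun π => by simp only [eOp_ket, H]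

theorem fOp_congr (H : ∀ b, φ (boxWeight h b) = χ (boxWeight h b)) : fOp h E φ = fOp h E χ :=
  op_ext fun π => by simp only [fOp_ket, H]

theorem eOp_add (φ χ : ℂ → ℂ) : eOp h E (fun w => φ w + χ w) = eOp h E φ + eOp h E χ :=
  op_ext fun π => by
    simp only [eOp_ket, LinearMap.add_apply, add_mul, add_smul, Finset.sum_add_distrib]

theorem eOp_smul (c : ℂ) (φ : ℂ → ℂ) : eOp h E (fun w => c * φ w) = c • eOp h E φ :=
  op_ext fun π => by
    simp only [eOp_ket, LinearMap.smul_apply, mul_assoc, mul_smul, Finset.smul_sum]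

theorem fOp_add (φ χ : ℂ → ℂ) : fOp h E (fun w => φ w + χ w) = fOp h E φ + fOp h E χ :=
  op_ext fun π => by
    simp only [fOp_ket, LinearMap.add_apply, add_mul, add_smul, Finset.sum_add_distrib]

theorem fOp_smul (c : ℂ) (φ : ℂ → ℂ) : fOp h E (fun w => c * φ w) = c • fOp h E φ :=
  op_ext fun π => by
    simp only [fOp_ket, LinearMap.smul_apply, mul_assoc, mul_smul, Finset.smul_sum]

theorem dOp_mul (d d' : PlanePartition → ℂ) : dOp d * dOp d' = dOp fun π => d π * d' π :=
  op_ext fun π => by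
    rw [Module.End.mul_apply, dOp_ket, map_smul, dOp_ket, dOp_ket, smul_smul, mul_comm]

theorem dOp_one : dOp (fun _ => 1) = 1 := op_ext fun π => by simp [dOp_ket]

theorem dOp_mul_eOp {d d' : PlanePartition → ℂ}
    (H : ∀ π b, π.Addable b →
      d (π.ins b) * φ (boxWeight h b) = χ (boxWeight h b) * d' π) :
    dOp d * eOp h E φ = eOp h E χ * dOp d' := op_ext fun π => by
  rw [Module.End.mul_apply, Module.End.mul_apply, dOp_ket, map_smul, eOp_ket, eOp_ket, map_sum,
    Finset.smul_sum]
  refine Finset.sum_congr rfl fun b hb => ?_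
  rw [map_smul, dOp_ket, smul_smul, smul_smul]
  congr 1
  linear_combination E π b * H π b (mem_addFin.1 hb)

theorem dOp_mul_fOp {d d' : PlanePartition → ℂ}
    (H : ∀ π b, π.Addable b →
      d π * φ (boxWeight h b) = χ (boxWeight h b) * d' (π.ins b)) :
    dOp d * fOp h E φ = fOp h E χ * dOp d' := op_ext fun π => by
  rw [Module.End.mul_apply, Module.End.mul_apply, dOp_ket, map_smul, fOp_ket, fOp_ket, map_sum,
    Finset.smul_sum]
  refine Finset.sum_congr rfl fun b hb => ?_
  rw [map_smul, dOp_ket, smul_smul, smul_smul]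
  congr 1
  have := H (π.del b) b (addable_del (mem_remFin.1 hb))
  rw [ins_del (mem_remFin.1 hb)] at this
  linear_combination -E (π.del b) b * this

/-- The compatibility of the square roots. -/
def Exchange (E : PlanePartition → Box → ℂ) : Prop :=
  ∀ (π : PlanePartition) (a b : Box), π.Addable a → π.Addable b → a ≠ b →
    E (π.ins a) b * E (π.ins b) a = E π a * E π b

/-- The moments of the residues of `ψ_π`. -/
def moment (h : Fin 3 → ℂ) (E : PlanePartition → Box → ℂ) (φ : ℂ → ℂ) (π : PlanePartition) : ℂ :=
  ∑ b ∈ π.addFin, φ (boxWeight h b) * E π b ^ 2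
    - ∑ b ∈ π.remFin, φ (boxWeight h b) * E (π.del b) b ^ 2

/-- Off the diagonal, a box is added and another removed; the two orders pass through opposite
corners of a square of diagrams, and `Exchange` makes their amplitudes equal. On the diagonal the
squares of the amplitudes remain, that is, the residues of ψ_π up to σ₃. -/
theorem eOp_fOp_bracket (hE : Exchange E) (φ χ : ℂ → ℂ) :
    eOp h E φ * fOp h E χ - fOp h E χ * eOp h E φ = dOp (moment h E fun w => φ w * χ w) := by
  refine op_ext fun π => ?_
  rw [LinearMap.sub_apply, Module.End.mul_apply, Module.End.mul_apply, eOp_ket, fOp_ket, map_sum,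
    map_sum, dOp_ket]
  have e1 : ∑ b ∈ π.remFin, eOp h E φ ((χ (boxWeight h b) * -E (π.del b) b) • ket (π.del b))
      = -(∑ b ∈ π.remFin, φ (boxWeight h b) * χ (boxWeight h b) * E (π.del b) b ^ 2) • ket π
        + ∑ b ∈ π.remFin, ∑ a ∈ (π.del b).addFin.erase b,
          (-(φ (boxWeight h a) * χ (boxWeight h b) * E (π.del b) b * E (π.del b) a)) •
            ket ((π.del b).ins a) := by
    rw [← Finset.sum_neg_distrib, Finset.sum_smul, ← Finset.sum_add_distrib]
    refine Finset.sum_congr rfl fun b hb => ?_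
    rw [mem_remFin] at hb
    rw [map_smul, eOp_ket, Finset.smul_sum,
      ← Finset.add_sum_erase _ _ (mem_addFin.2 (addable_del hb)), ins_del hb]
    congr 1
    · rw [smul_smul]; congr 1; ring
    · refine Finset.sum_congr rfl fun a _ => ?_
      rw [smul_smul]; congr 1; ring
  have e2 : ∑ a ∈ π.addFin, fOp h E χ ((φ (boxWeight h a) * E π a) • ket (π.ins a))
      = -(∑ a ∈ π.addFin, φ (boxWeight h a) * χ (boxWeight h a) * E π a ^ 2) • ket π
        + ∑ a ∈ π.addFin, ∑ b ∈ (π.ins a).remFin.erase a,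
          (-(φ (boxWeight h a) * χ (boxWeight h b) * E π a * E ((π.ins a).del b) b)) •
            ket ((π.ins a).del b) := by
    rw [← Finset.sum_neg_distrib, Finset.sum_smul, ← Finset.sum_add_distrib]
    refine Finset.sum_congr rfl fun a ha => ?_
    rw [mem_addFin] at ha
    rw [map_smul, fOp_ket, Finset.smul_sum,
      ← Finset.add_sum_erase _ _ (mem_remFin.2 (removable_ins ha)), del_ins ha]
    congr 1
    · rw [smul_smul]; congr 1; ring
    · refine Finset.sum_congr rfl fun b _ => ?_
      rw [smul_smul]; congr 1; ring
  have e3 : ∑ b ∈ π.remFin, ∑ a ∈ (π.del b).addFin.erase b,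
          (-(φ (boxWeight h a) * χ (boxWeight h b) * E (π.del b) b * E (π.del b) a)) •
            ket ((π.del b).ins a)
      = ∑ a ∈ π.addFin, ∑ b ∈ (π.ins a).remFin.erase a,
          (-(φ (boxWeight h a) * χ (boxWeight h b) * E π a * E ((π.ins a).del b) b)) •
            ket ((π.ins a).del b) := by
    -- Reindexes the pairs "remove b, add a ≠ b" by the pairs "add a, remove b ≠ a".
    rw [Finset.sum_comm' (t' := π.addFin) (s' := fun a => (π.ins a).remFin.erase a)]
    · refine Finset.sum_congr rfl fun a ha => Finset.sum_congr rfl fun b hb => ?_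
      rw [mem_addFin] at ha
      rw [Finset.mem_erase, mem_remFin] at hb
      obtain ⟨hr, hd, e⟩ := exists_of_addable_removable ha hb.2 (Ne.symm hb.1)
      have := hE (π.del b) b a (addable_del hr) hd hb.1
      rw [ins_del hr] at this
      rw [e]
      congr 1
      linear_combination φ (boxWeight h a) * χ (boxWeight h b) * this
    · intro b a
      simp only [Finset.mem_erase, mem_addFin, mem_remFin]
      constructor
      · rintro ⟨hb, hne, ha⟩
        have := removable_ins_of hb ha hne
        exact ⟨⟨Ne.symm hne, this.2⟩, this.1⟩
      · rintro ⟨⟨hne, hb⟩, ha⟩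
        obtain ⟨hr, hd, _⟩ := exists_of_addable_removable ha hb (Ne.symm hne)
        exact ⟨hr, Ne.symm hne, hd⟩
  rw [e1, e2, e3, moment]
  module

/-- A linear independence property of the functions `1/(z - x)`. -/
theorem eq_zero_of_sum_div {s : Finset Box} {x c : Box → ℂ} (hx : Set.InjOn x (s : Set Box))
    {Z : Set ℂ} (hZ : Z.Infinite) (hne : ∀ z ∈ Z, ∀ b ∈ s, z ≠ x b)
    (H : ∀ z ∈ Z, ∑ b ∈ s, c b / (z - x b) = 0) : ∀ b ∈ s, c b = 0 := by
  classical
  -- The sum with denominators cleared: infinitely many roots make it zero, and its value at a node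
  -- isolates one coefficient.
  set p : Polynomial ℂ := ∑ b ∈ s, Polynomial.C (c b) *
    ∏ b' ∈ s.erase b, (Polynomial.X - Polynomial.C (x b')) with hp
  have hp0 : p = 0 := by
    refine Polynomial.eq_zero_of_infinite_isRoot p (hZ.mono fun z hz => ?_)
    have : p.eval z = (∏ b ∈ s, (z - x b)) * ∑ b ∈ s, c b / (z - x b) := by
      rw [hp, Polynomial.eval_finsetSum, Finset.mul_sum]
      refine Finset.sum_congr rfl fun b hb => ?_
      rw [← Finset.mul_prod_erase s _ hb, Polynomial.eval_mul, Polynomial.eval_prod]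
      have := sub_ne_zero.2 (hne z hz b hb)
      simp only [Polynomial.eval_C, Polynomial.eval_sub, Polynomial.eval_X]
      field_simp
    simp [Polynomial.IsRoot, this, H z hz]
  intro b hb
  have h1 : p.eval (x b) = c b * ∏ b' ∈ s.erase b, (x b - x b') := by
    rw [hp, Polynomial.eval_finsetSum, Finset.sum_eq_single_of_mem b hb]
    · simp [Polynomial.eval_prod]
    · intro b' hb' hne'
      rw [Polynomial.eval_mul, Polynomial.eval_prod,
        Finset.prod_eq_zero (Finset.mem_erase.2 ⟨Ne.symm hne', hb⟩) (by simp), mul_zero]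
  rw [hp0, Polynomial.eval_zero, eq_comm, mul_eq_zero] at h1
  refine h1.resolve_right (Finset.prod_ne_zero_iff.2 fun b' hb' => sub_ne_zero.2 fun e => ?_)
  exact Finset.ne_of_mem_erase hb' (hx (Finset.mem_of_mem_erase hb') hb e.symm)

/-- The span of the images of the raising operators. -/
def raised (h : Fin 3 → ℂ) (E : PlanePartition → Box → ℂ) : Submodule ℂ Fock :=
  ⨆ φ : ℂ → ℂ, LinearMap.range (eOp h E φ)

theorem eOp_mem_raised (φ : ℂ → ℂ) (v : Fock) : eOp h E φ v ∈ raised h E :=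
  (le_iSup (fun φ : ℂ → ℂ => LinearMap.range (eOp h E φ)) φ) ⟨v, rfl⟩

theorem apply_eq_zero_of_raised {v : Fock} (hv : v ∈ raised h E) {τ : PlanePartition}
    (hτ : ∀ b, τ.Removable b → E (τ.del b) b = 0) : v τ = 0 := by
  have : raised h E ≤ LinearMap.ker (Finsupp.lapply τ : Fock →ₗ[ℂ] ℂ) := by
    refine iSup_le fun φ => ?_
    rintro _ ⟨u, rfl⟩
    rw [LinearMap.mem_ker, Finsupp.lapply_apply, eOp_apply]
    exact Finset.sum_eq_zero fun b hb => by rw [hτ b (mem_remFin.1 hb)]; ring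
  exact this hv

/-- Varying z separates the addable boxes, so E(τ-□ → τ) v(τ) = 0 for every removable □ of τ. If
v(τ) ≠ 0, no raising operator reaches τ, contradicting that v is raised. The restriction to raised
vectors is needed since amplitudes may vanish, when -σ₃ is the weight of a box. -/
theorem eq_zero_of_lowering (H : Generic h) {v : Fock} (hv : v ∈ raised h E) {Z : Set ℂ}
    (hZ : Z.Infinite) (hne : ∀ z ∈ Z, ∀ b, z ≠ boxWeight h b)
    (hf : ∀ z ∈ Z, fOp h E (fun w => 1 / (z - w)) v = 0) : v = 0 := by
  ext τ
  rw [Finsupp.zero_apply]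
  by_contra h0
  refine h0 (apply_eq_zero_of_raised hv fun b hb => ?_)
  have key := eq_zero_of_sum_div (s := (τ.del b).addFin) (x := boxWeight h)
    (c := fun b' => E (τ.del b) b' * v ((τ.del b).ins b')) ?_ hZ
    (fun z hz b _ => hne z hz b) ?_ b (mem_addFin.2 (addable_del hb))
  · rw [ins_del hb] at key
    exact (mul_eq_zero.1 key).resolve_right h0
  · intro b1 h1 b2 h2 e
    rw [Finset.mem_coe, mem_addFin] at h1 h2
    by_contra hn
    exact weight_ne_of_addable H h1 h2 hn e.symm
  · intro z hz
    have := congrArg (fun u : Fock => u (τ.del b)) (hf z hz)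
    simp only [fOp_apply, Finsupp.zero_apply, neg_eq_zero] at this
    rw [← this]
    exact Finset.sum_congr rfl fun b' _ => by ring

/-- An operator with values in the raised subspace is zero if it commutes with the lowering
operators. -/
theorem op_eq_zero_of_commute (H : Generic h) {X : Module.End ℂ Fock}
    (hX : ∀ v, X v ∈ raised h E) {Z : Set ℂ}
    (hZ : Z.Infinite) (hne : ∀ z ∈ Z, ∀ b, z ≠ boxWeight h b)
    (hf : ∀ z ∈ Z, fOp h E (fun w => 1 / (z - w)) * X = X * fOp h E (fun w => 1 / (z - w))) :
    X = 0 := by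
  refine op_ext fun π => ?_
  rw [LinearMap.zero_apply]
  induction hn : π.boxes.card using Nat.strong_induction_on generalizing π with
  | _ n ih =>
    -- f(z) X|π⟩ = X f(z)|π⟩, and f(z)|π⟩ only involves smaller diagrams, on which X vanishes by
    -- induction.
    refine eq_zero_of_lowering H (hX _) hZ hne fun z hz => ?_
    rw [← Module.End.mul_apply, hf z hz, Module.End.mul_apply, fOp_ket, map_sum]
    refine Finset.sum_eq_zero fun b hb => ?_
    rw [map_smul, ih _ ?_ (π.del b) rfl, smul_zero]
    have := card_del (mem_remFin.1 hb)
    omega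

end

end

section

open Filter Topology PlanePartition Bornology

/-! ### Moments of the residues -/

section

variable {h : Fin 3 → ℂ} {E : PlanePartition → Box → ℂ} {φ χ : ℂ → ℂ} {π : PlanePartition}

theorem moment_congr (H : ∀ b, π.Addable b ∨ π.Removable b →
    φ (boxWeight h b) = χ (boxWeight h b)) : moment h E φ π = moment h E χ π := by
  rw [moment, moment]
  congr 1
  · exact Finset.sum_congr rfl fun b hb => by rw [H b (Or.inl (mem_addFin.1 hb))]
  · exact Finset.sum_congr rfl fun b hb => by rw [H b (Or.inr (mem_remFin.1 hb))]

theorem moment_add (φ χ : ℂ → ℂ) :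
    moment h E (fun w => φ w + χ w) π = moment h E φ π + moment h E χ π := by
  simp only [moment, add_mul, Finset.sum_add_distrib]; ring

theorem moment_smul (c : ℂ) (φ : ℂ → ℂ) :
    moment h E (fun w => c * φ w) π = c * moment h E φ π := by
  simp only [moment, mul_assoc, ← Finset.mul_sum]; ring

theorem moment_sub (φ χ : ℂ → ℂ) :
    moment h E (fun w => φ w - χ w) π = moment h E φ π - moment h E χ π := by
  simp only [moment, sub_mul, Finset.sum_sub_distrib]; ring

theorem tendsto_div_sub_cobounded (c x : ℂ) :
    Tendsto (fun u : ℂ => c / (u - x)) (cobounded ℂ) (𝓝 0) := by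
  have := (tendsto_inv₀_cobounded.comp (tendsto_sub_const_cobounded x)).const_mul c
  rw [mul_zero] at this
  exact this.congr fun u => (div_eq_mul_inv _ _).symm

theorem tendsto_moment (h : Fin 3 → ℂ) (E : PlanePartition → Box → ℂ) (φ : ℂ → ℂ)
    (π : PlanePartition) :
    Tendsto (fun u : ℂ => moment h E (fun w => φ w / (u - w)) π) (cobounded ℂ) (𝓝 0) := by
  have k (s : Finset Box) (c : Box → ℂ) : Tendsto (fun u : ℂ => ∑ b ∈ s,
      φ (boxWeight h b) / (u - boxWeight h b) * c b) (cobounded ℂ) (𝓝 0) := by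
    rw [← Finset.sum_const_zero (s := s)]
    refine tendsto_finsetSum _ fun b _ => ?_
    simpa using (tendsto_div_sub_cobounded (φ (boxWeight h b)) (boxWeight h b)).mul_const (c b)
  simpa [moment] using (k π.addFin fun b => E π b ^ 2).sub (k π.remFin fun b => E (π.del b) b ^ 2)

theorem eventually_cobounded_ne (h : Fin 3 → ℂ) (s : Finset Box) :
    ∀ᶠ u in cobounded ℂ, ∀ p ∈ s, u ≠ boxWeight h p := by
  rw [Filter.eventually_all_finset]
  intro p _
  have : (({boxWeight h p} : Set ℂ))ᶜ ∈ cobounded ℂ :=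
    isBounded_def.1 (Set.finite_singleton (boxWeight h p)).isBounded
  exact this

theorem quadratic_eq_zero {A B C : ℂ} {D : ℂ → ℂ} (hD : Tendsto D (cobounded ℂ) (𝓝 0))
    (H : ∀ᶠ u in cobounded ℂ, A * u ^ 2 + B * u + C + D u = 0) : A = 0 ∧ B = 0 ∧ C = 0 := by
  have hi : Tendsto (fun u : ℂ => u⁻¹) (cobounded ℂ) (𝓝 0) := tendsto_inv₀_cobounded
  have h0 : ∀ᶠ u : ℂ in cobounded ℂ, u ≠ 0 := by
    have : (({0} : Set ℂ))ᶜ ∈ cobounded ℂ := isBounded_def.1 (Set.finite_singleton (0 :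
        ℂ)).isBounded
    exact this
  have hA : A = 0 := by
    have h1 : Tendsto (fun u : ℂ => A + B * u⁻¹ + C * u⁻¹ ^ 2 + D u * u⁻¹ ^ 2) (cobounded ℂ)
        (𝓝 (A + B * 0 + C * 0 ^ 2 + 0 * 0 ^ 2)) :=
      ((tendsto_const_nhds.add (hi.const_mul B)).add ((hi.pow 2).const_mul C)).add (hD.mul (hi.pow
          2))
    have h2 := tendsto_nhds_unique (h1.congr' (f₂ := fun _ => 0) (by
      filter_upwards [H, h0] with u hu hu0
      field_simp
      linear_combination hu)) tendsto_const_nhds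
    linear_combination h2
  subst hA
  have hB : B = 0 := by
    have h1 : Tendsto (fun u : ℂ => B + C * u⁻¹ + D u * u⁻¹) (cobounded ℂ)
        (𝓝 (B + C * 0 + 0 * 0)) :=
      (tendsto_const_nhds.add (hi.const_mul C)).add (hD.mul hi)
    have h2 := tendsto_nhds_unique (h1.congr' (f₂ := fun _ => 0) (by
      filter_upwards [H, h0] with u hu hu0
      field_simp
      linear_combination hu)) tendsto_const_nhds
    linear_combination h2
  subst hB
  refine ⟨rfl, rfl, ?_⟩
  have h1 : Tendsto (fun u : ℂ => C + D u) (cobounded ℂ) (𝓝 (C + 0)) := hD.const_add C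
  have h2 := tendsto_nhds_unique (h1.congr' (f₂ := fun _ => 0) (by
      filter_upwards [H] with u hu
      linear_combination hu)) tendsto_const_nhds
  linear_combination h2

theorem HasResidues.moment_eq (H : Generic h) (hE : HasResidues h E) (π : PlanePartition) :
    ∃ M, ∀ u, (∀ p ∈ cube M, u ≠ boxWeight h p) →
      psiFun h π u = 1 + sigma3 h * moment h E (fun w => 1 / (u - w)) π := by
  obtain ⟨M, hM⟩ := hE.psiFun_eq H π
  refine ⟨M, fun u hu => ?_⟩
  rw [hM u hu, moment]
  congr 3
  · exact Finset.sum_congr rfl fun b _ => by ring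
  · exact Finset.sum_congr rfl fun b _ => by ring

theorem eventually_ne_nodes (h : Fin 3 → ℂ) (π : PlanePartition) :
    ∀ᶠ u in cobounded ℂ, ∀ b, π.Addable b ∨ π.Removable b → u ≠ boxWeight h b := by
  filter_upwards [eventually_cobounded_ne h π.addFin, eventually_cobounded_ne h π.remFin]
    with u h1 h2 b hb
  rcases hb with hb | hb
  · exact h1 b (mem_addFin.2 hb)
  · exact h2 b (mem_remFin.2 hb)

theorem varphi_eq {h : Fin 3 → ℂ} (H : Generic h) (v : ℂ) : varphi h v =
    (v ^ 3 + sigma2 h * v + sigma3 h) / (v ^ 3 + sigma2 h * v - sigma3 h) := by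
  have s := H.sum
  rw [varphi]
  congr 1
  · rw [sigma2, sigma3]; linear_combination v ^ 2 * s
  · rw [sigma2, sigma3]; linear_combination -v ^ 2 * s

theorem eventually_cubic_ne (c d x : ℂ) :
    ∀ᶠ u in cobounded ℂ, (u - x) ^ 3 + c * (u - x) - d ≠ 0 := by
  set p : Polynomial ℂ := Polynomial.X ^ 3 + Polynomial.C c * Polynomial.X - Polynomial.C d with hp
  have hm : p ≠ 0 := fun h0 => by
    have := congrArg (fun r => Polynomial.coeff r 3) h0
    simp [hp] at this
  have h1 : ∀ᶠ v in cobounded ℂ, p.eval v ≠ 0 := by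
    have : {v | p.IsRoot v}ᶜ ∈ cobounded ℂ :=
      isBounded_def.1 (Polynomial.finite_setOfPred_isRoot hm).isBounded
    exact this
  filter_upwards [(tendsto_sub_const_cobounded x).eventually h1] with u hu
  simpa [hp] using hu

/-- The effect of adding a box on the moments. -/
theorem HasResidues.moment_ins (H : Generic h) (hE : HasResidues h E) {b : Box}
    (hb : π.Addable b) :
    moment h E (fun _ => 1) (π.ins b) = moment h E (fun _ => 1) π ∧
    moment h E (fun w => w) (π.ins b) = moment h E (fun w => w) π ∧
    moment h E (fun w => w ^ 2) (π.ins b) = moment h E (fun w => w ^ 2) π + 2 ∧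
    ∀ j : ℕ, moment h E (fun w => w ^ j * ((w - boxWeight h b) ^ 3
        + sigma2 h * (w - boxWeight h b) - sigma3 h)) (π.ins b)
      = moment h E (fun w => w ^ j * ((w - boxWeight h b) ^ 3
        + sigma2 h * (w - boxWeight h b) + sigma3 h)) π := by
  have hs := H.sigma3_ne
  obtain ⟨M, hM⟩ := hE.moment_eq H π
  obtain ⟨M', hM'⟩ := hE.moment_eq H (π.ins b)
  set x := boxWeight h b with hx
  set p : ℂ → ℂ := fun w => (w - x) ^ 3 + sigma2 h * (w - x) - sigma3 h with hp
  set g : ℂ → ℂ := fun w => (w - x) ^ 3 + sigma2 h * (w - x) + sigma3 h with hg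
  -- The part vanishing at infinity of the cleared identity ψ_{π+□} p = ψ_π g, where φ = g/p in the
  -- variable u - h_□. The four claims are the comparison of its expansion at infinity, order by
  -- order.
  set D : ℕ → ℂ → ℂ := fun j u => moment h E (fun w => (w ^ j * p w) / (u - w)) (π.ins b)
    - moment h E (fun w => (w ^ j * g w) / (u - w)) π with hD
  have hD0 (j : ℕ) : Tendsto (D j) (cobounded ℂ) (𝓝 0) := by
    simpa using (tendsto_moment h E (fun w => w ^ j * p w) (π.ins b)).sub
      (tendsto_moment h E (fun w => w ^ j * g w) π)
  -- Polynomial division of the cubic in u by u - w; the quotient brings in the moments of order 0,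
  -- 1 and 2.
  have expand (c : ℂ) (π' : PlanePartition) (u : ℂ)
      (hu : ∀ b, π'.Addable b ∨ π'.Removable b → u ≠ boxWeight h b) :
      ((u - x) ^ 3 + sigma2 h * (u - x) + c) * moment h E (fun w => 1 / (u - w)) π'
      = moment h E (fun w => (w ^ 0 * ((w - x) ^ 3 + sigma2 h * (w - x) + c)) / (u - w)) π'
        + ((u - x) ^ 2 + sigma2 h - x * (u - x) + x ^ 2) * moment h E (fun _ => 1) π'
        + ((u - x) - 2 * x) * moment h E (fun w => w) π' + moment h E (fun w => w ^ 2) π' := by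
    rw [← moment_smul, ← moment_smul, ← moment_smul, ← moment_add, ← moment_add, ← moment_add]
    refine moment_congr fun b' hb' => ?_
    have := sub_ne_zero.2 (hu b' hb')
    field_simp
    ring
  have e0 : ∀ᶠ u in cobounded ℂ, (moment h E (fun _ => 1) (π.ins b) - moment h E (fun _ => 1) π)
      * u ^ 2 + ((-3 * x) * (moment h E (fun _ => 1) (π.ins b) - moment h E (fun _ => 1) π)
        + (moment h E (fun w => w) (π.ins b) - moment h E (fun w => w) π)) * u
      + ((3 * x ^ 2 + sigma2 h) * (moment h E (fun _ => 1) (π.ins b) - moment h E (fun _ => 1) π)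
        - 3 * x * (moment h E (fun w => w) (π.ins b) - moment h E (fun w => w) π)
        + (moment h E (fun w => w ^ 2) (π.ins b) - moment h E (fun w => w ^ 2) π) - 2)
      + D 0 u = 0 := by
    filter_upwards [eventually_ne_nodes h π, eventually_ne_nodes h (π.ins b),
      eventually_cobounded_ne h (cube M), eventually_cobounded_ne h (cube M'),
      eventually_cubic_ne (sigma2 h) (sigma3 h) x] with u h1 h2 h3 h4 h5
    have k1 := hM u h3
    have k2 := hM' u h4
    have k3 := psiFun_ins h hb u
    rw [varphi_eq H, ← hx, k1, k2] at k3
    have k4 := expand (-sigma3 h) (π.ins b) u h2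
    have k5 := expand (sigma3 h) π u h1
    rw [mul_div_assoc', eq_div_iff h5] at k3
    -- Here g - p = 2σ₃; after division by σ₃ this leaves the 2 by which ψ₂ grows with each box.
    have k6 : ((u - x) ^ 3 + sigma2 h * (u - x) + -sigma3 h) *
        moment h E (fun w => 1 / (u - w)) (π.ins b)
        - ((u - x) ^ 3 + sigma2 h * (u - x) + sigma3 h) * moment h E (fun w => 1 / (u - w)) π
        - 2 = 0 := by
      refine (mul_eq_zero.1 ?_).resolve_left hs
      linear_combination k3
    rw [k4, k5] at k6
    simp only [hD, hp, hg, sub_eq_add_neg] at k6 ⊢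
    linear_combination k6
  obtain ⟨q2, q1, q0⟩ := quadratic_eq_zero (hD0 0) e0
  have m0 := sub_eq_zero.1 q2
  rw [m0, sub_self, mul_zero, zero_add] at q1
  have m1 := sub_eq_zero.1 q1
  rw [m0, m1, sub_self, sub_self, mul_zero, mul_zero, sub_zero, zero_add] at q0
  refine ⟨m0, m1, by linear_combination q0, ?_⟩
  have hD00 : ∀ᶠ u in cobounded ℂ, D 0 u = 0 := by
    filter_upwards [e0] with u hu
    rw [m0, m1] at hu
    linear_combination hu - q0
  -- D (j+1) is u · D j minus a constant, the difference of the two moments. Once D j vanishes near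
  -- infinity, the constant is a limit of D (j+1), hence 0.
  have step (j : ℕ) (hj : ∀ᶠ u in cobounded ℂ, D j u = 0) :
      (moment h E (fun w => w ^ j * p w) (π.ins b) = moment h E (fun w => w ^ j * g w) π) ∧
        ∀ᶠ u in cobounded ℂ, D (j + 1) u = 0 := by
    have e1 : ∀ᶠ u in cobounded ℂ, D (j + 1) u = -(moment h E (fun w => w ^ j * p w) (π.ins b)
        - moment h E (fun w => w ^ j * g w) π) := by
      filter_upwards [hj, eventually_ne_nodes h π, eventually_ne_nodes h (π.ins b)] with u h0 h1 h2
      have ex (G : ℂ → ℂ) (π' : PlanePartition)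
          (hu : ∀ b, π'.Addable b ∨ π'.Removable b → u ≠ boxWeight h b) :
          moment h E (fun w => w ^ (j + 1) * G w / (u - w)) π'
          = u * moment h E (fun w => w ^ j * G w / (u - w)) π'
            - moment h E (fun w => w ^ j * G w) π' := by
        rw [← moment_smul, ← moment_sub]
        refine moment_congr fun b' hb' => ?_
        have := sub_ne_zero.2 (hu b' hb')
        field_simp
        ring
      simp only [hD] at h0 ⊢
      rw [ex p _ h2, ex g _ h1]
      linear_combination u * h0
    have e2 := tendsto_nhds_unique ((hD0 (j + 1)).congr' e1) tendsto_const_nhds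
    have e3 : moment h E (fun w => w ^ j * p w) (π.ins b)
        = moment h E (fun w => w ^ j * g w) π := by
      linear_combination e2
    refine ⟨e3, ?_⟩
    filter_upwards [e1] with u hu
    rw [hu, e3, sub_self, neg_zero]
  have all (j : ℕ) : ∀ᶠ u in cobounded ℂ, D j u = 0 := by
    induction j with
    | zero => exact hD00
    | succ j ih => exact (step j ih).2
  exact fun j => (step j (all j)).1

theorem addFin_empty : PlanePartition.empty.addFin = {(0, 0, 0)} := by
  ext b
  rw [mem_addFin, addable_iff, Finset.mem_singleton]
  constructor
  · intro hb
    by_contra hne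
    have := hb.2 (0, 0, 0) (by simp [Prod.le_def]) (Ne.symm hne)
    simp [PlanePartition.empty] at this
  · rintro rfl
    refine ⟨by simp [PlanePartition.empty], fun c hc hne => absurd ?_ hne⟩
    simp only [Prod.le_def] at hc
    ext <;> simp <;> omega

theorem remFin_empty : PlanePartition.empty.remFin = ∅ := by
  ext b
  simp [PlanePartition.Removable, PlanePartition.empty]

theorem boxWeight_zero (h : Fin 3 → ℂ) : boxWeight h (0, 0, 0) = 0 := by simp [boxWeight]

theorem addable_empty : PlanePartition.empty.Addable (0, 0, 0) := by
  rw [← mem_addFin, addFin_empty]; simp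

theorem HasResidues.sq_empty (H : Generic h) (hE : HasResidues h E) :
    E PlanePartition.empty (0, 0, 0) ^ 2 = 1 := by
  have h1 := hE _ _ addable_empty
  rw [boxWeight_zero] at h1
  have h2 : Tendsto (fun u : ℂ => u + sigma3 h) (𝓝[≠] 0) (𝓝 (0 + sigma3 h)) :=
    (tendsto_id.add_const (sigma3 h)).mono_left nhdsWithin_le_nhds
  have h3 := tendsto_nhds_unique (h1.congr' ?_) h2
  · rw [zero_add] at h3
    exact mul_left_cancel₀ H.sigma3_ne (by rw [h3, mul_one])
  · filter_upwards [eventually_mem_nhdsWithin] with u hu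
    have : u ≠ 0 := hu
    simp [psiFun, PlanePartition.empty]
    field_simp

theorem HasResidues.moment_empty (H : Generic h) (hE : HasResidues h E) (φ : ℂ → ℂ) :
    moment h E φ PlanePartition.empty = φ 0 := by
  simp [moment, addFin_empty, remFin_empty, boxWeight_zero, hE.sq_empty H]

theorem HasResidues.moment_one (H : Generic h) (hE : HasResidues h E) (π : PlanePartition) :
    moment h E (fun _ => 1) π = 1 := by
  induction π using induction_ins with
  | h0 => rw [hE.moment_empty H]
  | h1 π b hb ih => rw [(hE.moment_ins H hb).1, ih]

theorem HasResidues.moment_id (H : Generic h) (hE : HasResidues h E) (π : PlanePartition) :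
    moment h E (fun w => w) π = 0 := by
  induction π using induction_ins with
  | h0 => rw [hE.moment_empty H]
  | h1 π b hb ih => rw [(hE.moment_ins H hb).2.1, ih]

theorem HasResidues.moment_sq (H : Generic h) (hE : HasResidues h E) (π : PlanePartition) :
    moment h E (fun w => w ^ 2) π = 2 * π.boxes.card := by
  induction π using induction_ins with
  | h0 => rw [hE.moment_empty H]; simp [PlanePartition.empty]
  | h1 π b hb ih => rw [(hE.moment_ins H hb).2.2.1, ih, card_ins hb]; push_cast; ring

end

end

section

/-! ### Noncommutative identities for dressed currents -/

/-- Inductive step for `LoweringRel`, isolated as ring algebra. Dictionary for this and the next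
lemmas: a = h₁, q = h₂h₃, f = f(z), A and B the dressings at z, ε, ε', ε'' three consecutive ε's,
and the suffixes `a`, `p` (`ma`, `m`) for an argument shifted by +h₁ (-h₁). The bracket of f with
the recursion e₁ε' - ε'(e₁ + a e₀) is expanded, and the quadratic relations collapse it. -/
theorem lowering_step {R : Type*} [Ring R] [Algebra ℂ R] {a q s z : ℂ} (ha : a ≠ 0) (hq : q ≠ 0)
    {n : ℂ} (hn : n + 1 ≠ 0) {f e0 e1 A B ε ε' ε'' ez eza ezma Bp Am : R}
    (hF : f * ε' = ε' * f + (q⁻¹ ^ 2) • (s • (A * ε * B) - ε))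
    (fe1 : f * e1 = e1 * f - (z • ((a * q)⁻¹ • (s • (A * B) - 1)) - 1))
    (fe0 : f * e0 = e0 * f - (a * q)⁻¹ • (s • (A * B) - 1))
    (eA1 : e1 * A = A * (e1 + (q / a) • (z • ez - (z + a) • eza)))
    (Be1 : B * (e1 + a • e0) = (e1 + a • e0 + (q / a) • (z • ezma - (z + a) • ez)) * B)
    (hG : ez * ε - ε * ezma = B * ε' * Am - ε')
    (hGp : eza * ε - ε * ez = Bp * ε' * A - ε')
    (hr : e1 * ε - ε * (e1 + a • e0) = (n * q) • ε')
    (hr' : e1 * ε' - ε' * (e1 + a • e0) = ((n + 1) * q) • ε'')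
    (h1 : Am * B = 1) (h2 : A * Bp = 1) :
    f * ε'' = ε'' * f + (q⁻¹ ^ 2) • (s • (A * ε' * B) - ε') := by
  have key : f * (e1 * ε' - ε' * (e1 + a • e0)) - (e1 * ε' - ε' * (e1 + a • e0)) * f
      = ((n + 1) * q⁻¹) • (s • (A * ε' * B) - ε') := by
    linear_combination (norm := skip) fe1 * ε' + e1 * hF - hF * (e1 + a • e0) - ε' * fe1
      - a • (ε' * fe0)
      + (q⁻¹ ^ 2 * s) • (eA1 * (ε * B)) - (q⁻¹ ^ 2 * s) • ((A * ε) * Be1)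
      + (q⁻¹ ^ 2 * s * (q / a) * z) • (A * hG * B)
      - (q⁻¹ ^ 2 * s * (q / a) * (z + a)) • (A * hGp * B) + (q⁻¹ ^ 2 * s) • (A * hr * B)
      - (q⁻¹ ^ 2) • hr + (q⁻¹ ^ 2 * s * (q / a) * z) • (A * B * ε' * h1)
      - (q⁻¹ ^ 2 * s * (q / a) * (z + a)) • (h2 * (ε' * A * B))
    -- The combination is one of noncommutative equations; after expansion into monomials only
    -- scalar identities remain, one per monomial.
    simp only [mul_add, add_mul, mul_sub, sub_mul, smul_mul_assoc, mul_smul_comm, mul_assoc,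
      mul_one, one_mul, smul_add, smul_sub, smul_smul]
    match_scalars <;> field_simp <;> ring
  rw [hr'] at key
  have h3 : ((n + 1) * q) • (f * ε'' - (ε'' * f + (q⁻¹ ^ 2) • (s • (A * ε' * B) - ε'))) = 0 := by
    linear_combination (norm := skip) key
    simp only [smul_mul_assoc, mul_smul_comm]
    match_scalars <;> field_simp <;> ring
  exact sub_eq_zero.1 ((smul_eq_zero.1 h3).resolve_left (mul_ne_zero hn hq))

theorem lowering_base {R : Type*} [Ring R] [Algebra ℂ R] {a q s : ℂ} (ha : a ≠ 0) (hq : q ≠ 0)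
    {f e0 e1 A B ε' : R}
    (fe0 : f * e0 = e0 * f - (a * q)⁻¹ • (s • (A * B) - 1))
    (hr : e1 * 1 - 1 * (e1 + a • e0) = q • ε') :
    f * ε' = ε' * f + (q⁻¹ ^ 2) • (s • (A * 1 * B) - 1) := by
  have h1 : ε' = (-(a / q)) • e0 := by
    have : q • (ε' + (a / q) • e0) = 0 := by
      rw [smul_add, ← hr]
      simp only [mul_one, one_mul]
      match_scalars <;> field_simp <;> ring
    linear_combination (norm := module) (smul_eq_zero.1 this).resolve_left hq
  rw [h1]
  linear_combination (norm := skip) (-(a / q)) • fe0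
  simp only [smul_mul_assoc, mul_smul_comm, mul_one]
  match_scalars <;> field_simp <;> ring

/-- The defect of `RaisingRel` at the next index commutes with f(z'). Primes on A, B, s and on e(·)
refer to z', d = z' - z, and κ is the factor β produced at argument z - z'. -/
theorem lowering_comm_current {R : Type*} [Ring R] [Algebra ℂ R] {a q s s' sm κ d : ℂ} (ha : a ≠ 0)
    (hq : q ≠ 0)
    (hd : d ≠ 0) (hda : d + a ≠ 0) (hκ : κ = 1 + q / (d * (d + a)))
    {f fz fm A B A' B' ε ε' ε'' ez ezma ez' ez'a ez'ma Bm Am A'm B'p : R}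
    (feZ : f * ez = ez * f + (-d⁻¹) • ((a*q)⁻¹ • (s • (A * B) - s' • (A' * B'))))
    (feZm : f * ezma = ezma * f + (-(d+a)⁻¹) • ((a*q)⁻¹ • (sm • (Am * Bm) - s' • (A' * B'))))
    (hF1 : f * ε' = ε' * f + (q⁻¹^2) • (s' • (A' * ε * B') - ε))
    (hF2 : f * ε'' = ε'' * f + (q⁻¹^2) • (s' • (A' * ε' * B') - ε'))
    (hF2z : fz * ε'' = ε'' * fz + (q⁻¹^2) • (s • (A * ε' * B) - ε'))
    (hF2m : fm * ε'' = ε'' * fm + (q⁻¹^2) • (sm • (Am * ε' * Bm) - ε'))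
    (fB : f * B = B * (κ • f + (q/a) • ((d+a)⁻¹ • fm - d⁻¹ • fz)))
    (fAm : Am * f = (κ • f + (q/a) • ((d+a)⁻¹ • fm - d⁻¹ • fz)) * Am)
    (eA : ez * A' = A' * (κ • ez - (q/a) • (d⁻¹ • ez' - (d+a)⁻¹ • ez'a)))
    (Be : B' * ezma = (κ • ezma - (q/a) • (d⁻¹ • ez'ma - (d+a)⁻¹ • ez')) * B')
    (hG : ez * ε - ε * ezma = B * ε' * Am - ε')
    (hG' : ez' * ε - ε * ez'ma = B' * ε' * A'm - ε')
    (hG'p : ez'a * ε - ε * ez' = B'p * ε' * A' - ε')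
    (h1 : A'm * B' = 1) (h2 : A' * B'p = 1) (h3 : B * Am = 1)
    (c1 : A' * B = B * A') (c2 : Am * B' = B' * Am) (c3 : Bm * Am = Am * Bm) (c4 : B * A = A * B) :
    f * (ez * ε' - ε' * ezma - (B * ε'' * Am - ε'')) - (ez * ε' - ε' * ezma - (B * ε'' * Am - ε''))
        * f = 0 := by
  subst hκ
  linear_combination (norm := skip) feZ * ε' + ez * hF1 - hF1 * ezma - ε' * feZm
    - (fB * (ε'' * Am) + (1 + q / (d * (d + a))) • (B * hF2 * Am) + (q/a*(d+a)⁻¹) • (B * hF2m * Am)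
      - (q/a*d⁻¹) • (B * hF2z * Am) - (B * ε'') * fAm) + hF2
    + (q⁻¹^2*s') • (eA * (ε * B')) - (q⁻¹^2*s') • ((A' * ε) * Be)
    + (q⁻¹^2*s'*(1 + q / (d * (d + a)))) • (A' * hG * B') - (q⁻¹^2*s'*(q/a)*d⁻¹) • (A' * hG' * B')
    + (q⁻¹^2*s'*(q/a)*(d+a)⁻¹) • (A' * hG'p * B') - (q⁻¹^2) • hG
    + (q⁻¹^2*s'*(1 + q / (d * (d + a)))) • (c1 * (ε' * (Am * B')))
    + (q⁻¹^2*s'*(1 + q / (d * (d + a)))) • ((B * A' * ε') * c2)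
    - (q⁻¹^2*s'*(q/a)*d⁻¹) • ((A' * B' * ε') * h1)
    + (q⁻¹^2*s'*(q/a)*(d+a)⁻¹) • (h2 * (ε' * (A' * B')))
    - (q⁻¹^2*sm*(q/a)*(d+a)⁻¹) • (h3 * (ε' * Bm * Am))
    - (q⁻¹^2*sm*(q/a)*(d+a)⁻¹) • (ε' * c3)
    + (q⁻¹^2*s*(q/a)*d⁻¹) • ((B * A * ε') * h3) + (q⁻¹^2*s*(q/a)*d⁻¹) • (c4 * ε')
  simp only [mul_add, add_mul, mul_sub, sub_mul, smul_mul_assoc, mul_smul_comm, mul_assoc,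
    mul_one, one_mul, smul_add, smul_sub, neg_mul, smul_smul]
  match_scalars <;> field_simp <;> ring

theorem lowering_comm_zeroth {R : Type*} [Ring R] [Algebra ℂ R] {a q s : ℂ} (ha : a ≠ 0)
    (hq : q ≠ 0)
    {f e0 A B ε ε' ez eza ezma Bp Am : R}
    (hF : f * ε' = ε' * f + (q⁻¹^2) • (s • (A * ε * B) - ε))
    (fe0 : f * e0 = e0 * f - (a*q)⁻¹ • (s • (A * B) - 1))
    (eA0 : e0 * A = A * (e0 + (q/a) • (ez - eza)))
    (Be0 : B * e0 = (e0 + (q/a) • (ezma - ez)) * B)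
    (hG : ez * ε - ε * ezma = B * ε' * Am - ε')
    (hGp : eza * ε - ε * ez = Bp * ε' * A - ε')
    (hC : e0 * ε = ε * e0)
    (h1 : Am * B = 1) (h2 : A * Bp = 1) :
    f * (e0 * ε' - ε' * e0) - (e0 * ε' - ε' * e0) * f = 0 := by
  linear_combination (norm := skip) fe0 * ε' + e0 * hF - hF * e0 - ε' * fe0
    + (q⁻¹^2*s) • (eA0 * (ε * B)) - (q⁻¹^2*s) • ((A * ε) * Be0)
    + (q⁻¹^2*s*(q/a)) • (A * hG * B) - (q⁻¹^2*s*(q/a)) • (A * hGp * B) + (q⁻¹^2*s) • (A * hC * B)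
    - (q⁻¹^2) • hC + (q⁻¹^2*s*(q/a)) • (A * B * ε' * h1) - (q⁻¹^2*s*(q/a)) • (h2 * (ε' * A * B))
  simp only [mul_add, add_mul, mul_sub, sub_mul, smul_mul_assoc, mul_smul_comm, mul_assoc,
    mul_one, one_mul, smul_add, smul_sub, smul_smul]
  match_scalars <;> field_simp <;> ring

/-- The same for the relation of ε_n with e₂. P is the diagonal operator ∑ h_□: it commutes with the
dressings and moves f(z) to z f(z) - f₀, which is why f₀ enters. -/
theorem lowering_comm_second {R : Type*} [Ring R] [Algebra ℂ R] {a q s z : ℂ} (ha : a ≠ 0)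
    (hq : q ≠ 0) (n : ℂ)
    {f f0 e0 e1 e2 P A B ε ε' ε'' ez eza ezma Bp Am : R}
    (hF1 : f * ε' = ε' * f + (q⁻¹^2) • (s • (A * ε * B) - ε))
    (hF2 : f * ε'' = ε'' * f + (q⁻¹^2) • (s • (A * ε' * B) - ε'))
    (hf0 : f0 * ε'' = ε'' * f0 + (a*q⁻¹) • ε')
    (fe0 : f * e0 = e0 * f - (a*q)⁻¹ • (s • (A * B) - 1))
    (fe1 : f * e1 = e1 * f - (z • ((a*q)⁻¹ • (s • (A * B) - 1)) - 1))
    (fe2 : f * e2 = e2 * f - (z^2 • ((a*q)⁻¹ • (s • (A * B) - 1)) - z • 1))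
    (eA2 : e2 * A = A * (e2 + (q/a) • (z^2 • ez - (z+a)^2 • eza + a • e0)))
    (Be2 : B * (e2 + (2*a) • e1 + (a^2) • e0) = (e2 + (2*a) • e1 + (a^2) • e0 + (q/a) • (z^2 • ezma
        - (z+a)^2 • ez + a • e0)) * B)
    (PA : P * A = A * P) (PB : P * B = B * P) (Pf : P * f = f * P - (z • f - f0))
    (hG : ez * ε - ε * ezma = B * ε' * Am - ε')
    (hGp : eza * ε - ε * ez = Bp * ε' * A - ε')
    (hC : e0 * ε = ε * e0)
    (hY : e2 * ε - ε * (e2 + (2*a) • e1 + (a^2) • e0) = q • ((2:ℂ) • (P * ε' - ε' * P) + (n * a) •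
        ε'))
    (h1 : Am * B = 1) (h2 : A * Bp = 1) :
    f * (e2 * ε' - ε' * (e2 + (2*a) • e1 + (a^2) • e0) - q • ((2:ℂ) • (P * ε'' - ε'' * P) + ((n +
        1) * a) • ε'')) - (e2 * ε' - ε' * (e2 + (2*a) • e1 + (a^2) • e0) - q • ((2:ℂ) • (P * ε'' -
        ε'' * P) + ((n + 1) * a) • ε'')) * f = 0 := by
  linear_combination (norm := skip) fe2 * ε' + e2 * hF1 - hF1 * (e2 + (2*a) • e1 + (a^2) • e0)
    - ε' * fe2 - (2*a) • (ε' * fe1) - (a^2) • (ε' * fe0)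
    - (2*q) • (-(Pf * ε'') + ε'' * Pf + P * hF2 - hF2 * P + z • hF2 - hf0)
    - ((n+1)*a*q) • hF2
    + (q⁻¹^2*s) • (eA2 * (ε * B)) - (q⁻¹^2*s) • ((A * ε) * Be2)
    + (q⁻¹^2*s*(q/a)*z^2) • (A * hG * B) - (q⁻¹^2*s*(q/a)*(z+a)^2) • (A * hGp * B)
    + (q⁻¹^2*s*q) • (A * hC * B)
    + (q⁻¹^2*s) • (A * hY * B)
    - (q⁻¹^2) • hY + (q⁻¹^2*s*(q/a)*z^2) • (A * B * ε' * h1) - (q⁻¹^2*s*(q/a)*(z+a)^2) • (h2 * (ε'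
        * A * B))
    - (2*q*q⁻¹^2*s) • (PA * (ε' * B)) - (2*q*q⁻¹^2*s) • ((A * ε') * PB)
  simp only [mul_add, add_mul, mul_sub, sub_mul, smul_mul_assoc, mul_smul_comm, mul_assoc,
    mul_one, one_mul, smul_add, smul_sub, smul_smul]
  match_scalars <;> field_simp <;> ring

end

section

open Filter Topology PlanePartition

/-! ### Currents and the dressing operators -/

section

variable {h : Fin 3 → ℂ} {E : PlanePartition → Box → ℂ}

/-- `z` is not the weight of a box. -/
def Off (h : Fin 3 → ℂ) (z : ℂ) : Prop := ∀ b, z ≠ boxWeight h b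

theorem Off.sub_ne {z : ℂ} (hz : Off h z) (b : Box) : z - boxWeight h b ≠ 0 :=
  sub_ne_zero.2 (hz b)

theorem Off.sub_h0 (_ : Generic h) {z : ℂ} (hz : Off h z) : Off h (z - h 0) := fun b e =>
  hz (b.1, b.2.1 + 1, b.2.2) (by simp only [boxWeight] at e ⊢; push_cast; linear_combination e)

theorem Off.add_h0 (H : Generic h) {z : ℂ} (hz : Off h z) : Off h (z + h 0) := fun b e =>
  hz (b.1 + 1, b.2.1, b.2.2 + 1) (by
    have := H.sum
    simp only [boxWeight] at e ⊢; push_cast; linear_combination e - this)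

theorem Off.add_h1 (H : Generic h) {z : ℂ} (hz : Off h z) : Off h (z + h 1) := fun b e =>
  hz (b.1, b.2.1 + 1, b.2.2 + 1) (by
    have := H.sum
    simp only [boxWeight] at e ⊢; push_cast; linear_combination e - this)

theorem Off.add_h2 (H : Generic h) {z : ℂ} (hz : Off h z) : Off h (z + h 2) := fun b e =>
  hz (b.1 + 1, b.2.1 + 1, b.2.2) (by
    have := H.sum
    simp only [boxWeight] at e ⊢; push_cast; linear_combination e - this)

/-- Box weights are countably many. The finite set `s` later excludes the spectral parameters at
which two currents collide. -/
theorem infinite_off (h : Fin 3 → ℂ) (s : Finset ℂ) : {z | Off h z ∧ z ∉ s}.Infinite := by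
  intro hf
  have hc : (Set.range (boxWeight h) ∪ (s : Set ℂ) ∪ {z | Off h z ∧ z ∉ s}).Countable :=
    ((Set.countable_range _).union s.countable_toSet).union hf.countable
  refine not_countable_complex (hc.mono ?_)
  intro z _
  by_cases h1 : z ∈ Set.range (boxWeight h)
  · exact Or.inl (Or.inl h1)
  · by_cases h2 : z ∈ s
    · exact Or.inl (Or.inr h2)
    · exact Or.inr ⟨fun b e => h1 ⟨b, e.symm⟩, h2⟩

/-- The factor `β(v) = 1 + h₂h₃ / (v (v - h₁))`. -/
def beta (h : Fin 3 → ℂ) (v : ℂ) : ℂ := 1 + h 1 * h 2 / (v * (v - h 0))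

theorem beta_ne (H : Generic h) {z : ℂ} (hz : Off h z) (b : Box) :
    beta h (z - boxWeight h b) ≠ 0 := by
  have h0 := hz.sub_ne b
  have h1 := (hz.sub_h0 H).sub_ne b
  have h2 := (hz.add_h1 H).sub_ne b
  have h3 := (hz.add_h2 H).sub_ne b
  have e : beta h (z - boxWeight h b) = (z + h 1 - boxWeight h b) * (z + h 2 - boxWeight h b) /
      ((z - boxWeight h b) * (z - h 0 - boxWeight h b)) := by
    have h1' : z - boxWeight h b - h 0 ≠ 0 := by rw [sub_right_comm]; exact h1
    rw [beta, H.h2_eq]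
    field_simp
    ring
  rw [e]
  exact div_ne_zero (mul_ne_zero h2 h3) (mul_ne_zero h0 h1)

/-- β(v) = (v + h₂)(v + h₃)/(v(v - h₁)), so φ is the multiplicative difference quotient of β under
the shift by h₁. -/
theorem varphi_eq_beta (H : Generic h) {z : ℂ} (hz : Off h z) (b : Box) :
    varphi h (z - boxWeight h b) =
      (beta h (z + h 0 - boxWeight h b))⁻¹ * beta h (z - boxWeight h b) := by
  have h0 := hz.sub_ne b
  have h1 := (hz.sub_h0 H).sub_ne b
  have h4 := (hz.add_h0 H).sub_ne b
  have h5 := beta_ne H (hz.add_h0 H) b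
  rw [sub_right_comm] at h1
  rw [add_sub_right_comm] at h4 h5 ⊢
  generalize z - boxWeight h b = v at *
  have e : beta h (v + h 0) = (v - h 1) * (v - h 2) / (v * (v + h 0)) := by
    rw [beta, H.h2_eq, add_sub_cancel_right]
    field_simp
    ring
  have e' : beta h v = (v + h 1) * (v + h 2) / (v * (v - h 0)) := by
    rw [beta, H.h2_eq]
    field_simp
    ring
  rw [e] at h5 ⊢
  have h6 := (div_ne_zero_iff.1 h5).1
  have h7 := left_ne_zero_of_mul h6
  have h8 := right_ne_zero_of_mul h6
  rw [e', varphi]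
  field_simp

/-- The current `e(z)`. -/
def eCur (h : Fin 3 → ℂ) (E : PlanePartition → Box → ℂ) (z : ℂ) : Module.End ℂ Fock :=
  eOp h E fun w => 1 / (z - w)

/-- The current `f(z)`. -/
def fCur (h : Fin 3 → ℂ) (E : PlanePartition → Box → ℂ) (z : ℂ) : Module.End ℂ Fock :=
  fOp h E fun w => 1 / (z - w)

/-- The diagonal operator with eigenvalues `∏ β(z - h_□)`. -/
def dB (h : Fin 3 → ℂ) (z : ℂ) : Module.End ℂ Fock :=
  dOp fun π => ∏ b ∈ π.boxes, beta h (z - boxWeight h b)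

/-- The inverse of `dB h (z + h 0)`. -/
def dA (h : Fin 3 → ℂ) (z : ℂ) : Module.End ℂ Fock :=
  dOp fun π => ∏ b ∈ π.boxes, (beta h (z + h 0 - boxWeight h b))⁻¹

theorem prod_ins {π : PlanePartition} {b : Box} (hb : π.Addable b) (g : Box → ℂ) :
    ∏ c ∈ (π.ins b).boxes, g c = g b * ∏ c ∈ π.boxes, g c := by
  rw [ins_boxes hb, Finset.prod_insert hb.1]

theorem sum_ins {π : PlanePartition} {b : Box} (hb : π.Addable b) (g : Box → ℂ) :
    ∑ c ∈ (π.ins b).boxes, g c = g b + ∑ c ∈ π.boxes, g c := by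
  rw [ins_boxes hb, Finset.sum_insert hb.1]

theorem dOp_comm (d d' : PlanePartition → ℂ) : dOp d * dOp d' = dOp d' * dOp d := by
  rw [dOp_mul, dOp_mul]; simp only [mul_comm]

theorem dA_mul_dB (H : Generic h) {z : ℂ} (hz : Off h z) : dA h z * dB h (z + h 0) = 1 := by
  rw [dA, dB, dOp_mul, ← dOp_one]
  congr 1
  funext π
  rw [← Finset.prod_mul_distrib]
  exact Finset.prod_eq_one fun b _ => inv_mul_cancel₀ (beta_ne H (hz.add_h0 H) b)

theorem dA_sub_mul_dB (H : Generic h) {z : ℂ} (hz : Off h z) : dA h (z - h 0) * dB h z = 1 := by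
  have := dA_mul_dB H (hz.sub_h0 H)
  rwa [sub_add_cancel] at this

theorem dB_mul_dA (H : Generic h) {z : ℂ} (hz : Off h z) : dB h z * dA h (z - h 0) = 1 := by
  rw [← dA_sub_mul_dB H hz, dA, dB, dOp_comm]

/-- The factorisation of φ through β turns the eigenvalue of ψ(z) into a product of two dressings
and the vacuum factor. This lets ψ(z) be distributed on the two sides of an operator. -/
theorem psi_eq (H : Generic h) (hE : HasResidues h E) {z : ℂ} (hz : Off h z) :
    dOp (moment h E fun w => 1 / (z - w)) = (h 0 * (h 1 * h 2))⁻¹ •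
      (((z + h 0 * (h 1 * h 2)) / z) • (dA h z * dB h z) - 1) := by
  have hs : sigma3 h = h 0 * (h 1 * h 2) := by rw [sigma3]; ring
  have h0 := H.sigma3_ne
  refine op_ext fun π => ?_
  obtain ⟨M, hM⟩ := hE.moment_eq H π
  have h1 := hM z fun p _ => hz p
  rw [dA, dB, dOp_mul, LinearMap.smul_apply, LinearMap.sub_apply, LinearMap.smul_apply, dOp_ket,
    dOp_ket, Module.End.one_apply, ← Finset.prod_mul_distrib, smul_smul]
  rw [psiFun, Finset.prod_congr rfl fun b _ => varphi_eq_beta H hz b] at h1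
  rw [← hs, h1]
  match_scalars
  field_simp
  ring

theorem e_mul_dA (H : Generic h) {z : ℂ} (hz : Off h z) (φ : ℂ → ℂ) :
    eOp h E φ * dA h z = dA h z * eOp h E fun w => φ w * beta h (z + h 0 - w) := by
  refine (dOp_mul_eOp fun π b hb => ?_).symm
  have := beta_ne H (hz.add_h0 H) b
  rw [prod_ins hb]
  field_simp

theorem dB_mul_e (z : ℂ) (φ : ℂ → ℂ) :
    dB h z * eOp h E φ = (eOp h E fun w => φ w * beta h (z - w)) * dB h z := by
  refine dOp_mul_eOp fun π b hb => ?_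
  rw [prod_ins hb]
  ring

theorem f_mul_dB (z : ℂ) (φ : ℂ → ℂ) :
    fOp h E φ * dB h z = dB h z * fOp h E fun w => φ w * beta h (z - w) := by
  refine (dOp_mul_fOp fun π b hb => ?_).symm
  rw [prod_ins hb]
  ring

theorem dA_mul_f (H : Generic h) {z : ℂ} (hz : Off h z) (φ : ℂ → ℂ) :
    dA h z * fOp h E φ = (fOp h E fun w => φ w * beta h (z + h 0 - w)) * dA h z := by
  refine dOp_mul_fOp fun π b hb => ?_
  have := beta_ne H (hz.add_h0 H) b
  rw [prod_ins hb]
  field_simp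

theorem eOp_sub (φ χ : ℂ → ℂ) : eOp h E (fun w => φ w - χ w) = eOp h E φ - eOp h E χ :=
  op_ext fun π => by
    simp only [eOp_ket, LinearMap.sub_apply, sub_mul, sub_smul, Finset.sum_sub_distrib]

theorem fOp_sub (φ χ : ℂ → ℂ) : fOp h E (fun w => φ w - χ w) = fOp h E φ - fOp h E χ :=
  op_ext fun π => by
    simp only [fOp_ket, LinearMap.sub_apply, sub_mul, sub_smul, Finset.sum_sub_distrib]

/-- The modes `e_j`. -/
def eMode (h : Fin 3 → ℂ) (E : PlanePartition → Box → ℂ) (j : ℕ) : Module.End ℂ Fock :=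
  eOp h E fun w => w ^ j

/-- The modes `f_j`. -/
def fMode (h : Fin 3 → ℂ) (E : PlanePartition → Box → ℂ) (j : ℕ) : Module.End ℂ Fock :=
  fOp h E fun w => w ^ j

theorem f_mul_e (hX : Exchange E) (φ χ : ℂ → ℂ) :
    fOp h E χ * eOp h E φ = eOp h E φ * fOp h E χ - dOp (moment h E fun w => φ w * χ w) := by
  rw [← eOp_fOp_bracket hX]; abel

/-- The scalar factor of `ψ(z)`. -/
def sc (h : Fin 3 → ℂ) (z : ℂ) : ℂ := (z + h 0 * (h 1 * h 2)) / z

theorem fCur_mul_eMode_zero (H : Generic h) (hE : HasResidues h E) (hX : Exchange E) {z : ℂ}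
    (hz : Off h z) : fCur h E z * eMode h E 0 = eMode h E 0 * fCur h E z
      - (h 0 * (h 1 * h 2))⁻¹ • (sc h z • (dA h z * dB h z) - 1) := by
  rw [sc, ← psi_eq H hE hz, fCur, eMode, f_mul_e hX]
  simp only [pow_zero, one_mul]

theorem moment_node (H : Generic h) (hE : HasResidues h E) {z : ℂ} (hz : Off h z) :
    dOp (moment h E fun w => w * (1 / (z - w)))
      = z • dOp (moment h E fun w => 1 / (z - w)) - 1 := by
  refine op_ext fun π => ?_
  rw [LinearMap.sub_apply, LinearMap.smul_apply, dOp_ket, dOp_ket, Module.End.one_apply, smul_smul]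
  rw [moment_congr (χ := fun w => z * (1 / (z - w)) - 1), moment_sub, moment_smul,
    hE.moment_one H, sub_smul, one_smul]
  intro b _
  have := hz.sub_ne b
  field_simp
  ring

theorem moment_node_sq (H : Generic h) (hE : HasResidues h E) {z : ℂ} (hz : Off h z) :
    dOp (moment h E fun w => w ^ 2 * (1 / (z - w)))
      = z ^ 2 • dOp (moment h E fun w => 1 / (z - w)) - z • 1 := by
  refine op_ext fun π => ?_
  rw [LinearMap.sub_apply, LinearMap.smul_apply, dOp_ket, dOp_ket, LinearMap.smul_apply,
    Module.End.one_apply, smul_smul]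
  rw [moment_congr (χ := fun w => z ^ 2 * (1 / (z - w)) - (z * 1 + w)), moment_sub, moment_smul,
    moment_add, moment_smul, hE.moment_one H, hE.moment_id H, add_zero, mul_one, sub_smul]
  intro b _
  have := hz.sub_ne b
  field_simp
  ring

theorem fCur_mul_eMode_one (H : Generic h) (hE : HasResidues h E) (hX : Exchange E) {z : ℂ}
    (hz : Off h z) : fCur h E z * eMode h E 1 = eMode h E 1 * fCur h E z
      - (z • ((h 0 * (h 1 * h 2))⁻¹ • (sc h z • (dA h z * dB h z) - 1)) - 1) := by
  rw [sc, ← psi_eq H hE hz, fCur, eMode, f_mul_e hX]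
  simp only [pow_one, moment_node H hE hz]

theorem fCur_mul_eMode_two (H : Generic h) (hE : HasResidues h E) (hX : Exchange E) {z : ℂ}
    (hz : Off h z) : fCur h E z * eMode h E 2 = eMode h E 2 * fCur h E z
      - (z ^ 2 • ((h 0 * (h 1 * h 2))⁻¹ • (sc h z • (dA h z * dB h z) - 1)) - z • 1) := by
  rw [sc, ← psi_eq H hE hz, fCur, eMode, f_mul_e hX]
  simp only [moment_node_sq H hE hz]

theorem sub_smul_smul_sub_one {R : Type*} [Ring R] [Algebra ℂ R] (A X Y : R) (d c : ℂ) :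
    A - d • (c • (X - 1) - c • (Y - 1)) = A + (-d) • (c • (X - Y)) := by
  module

/-- [e(z), f(z')] has the moment of 1/((z-w)(z'-w)), which partial fractions reduce to ψ(z) and
ψ(z'). -/
theorem fCur_mul_eCur (H : Generic h) (hE : HasResidues h E) (hX : Exchange E) {z z' d : ℂ}
    (hz : Off h z) (hz' : Off h z') (hd : d = z' - z) (hd0 : d ≠ 0) :
    fCur h E z' * eCur h E z = eCur h E z * fCur h E z' + (-d⁻¹) • ((h 0 * (h 1 * h 2))⁻¹ •
      (sc h z • (dA h z * dB h z) - sc h z' • (dA h z' * dB h z'))) := by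
  have h1 : dOp (moment h E fun w => 1 / (z - w) * (1 / (z' - w)))
      = d⁻¹ • (dOp (moment h E fun w => 1 / (z - w)) - dOp (moment h E fun w => 1 / (z' - w))) := by
    refine op_ext fun π => ?_
    rw [LinearMap.smul_apply, LinearMap.sub_apply, dOp_ket, dOp_ket, dOp_ket, ← sub_smul, smul_smul,
      ← moment_sub, ← moment_smul]
    congr 1
    refine moment_congr fun b _ => ?_
    have h1 := hz.sub_ne b
    have h2 := hz'.sub_ne b
    field_simp
    rw [hd]; ring
  rw [fCur, eCur, f_mul_e hX, h1, psi_eq H hE hz, psi_eq H hE hz', sc, sc]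
  exact sub_smul_smul_sub_one (R := Module.End ℂ Fock) _ _ _ _ _

end

end

/-! ### Passing modes and currents through the dressings; the family ε_n -/

section

open Filter Topology PlanePartition

section

variable {h : Fin 3 → ℂ} {E : PlanePartition → Box → ℂ}

/-- Adding a box of weight w multiplies the dressing by a value of β, and the partial fractions β(v)
= 1 + (h₂h₃/h₁)(1/(v - h₁) - 1/v) turn it into currents. The following exchange rules have the same
proof. -/
theorem eMode_zero_mul_dA (H : Generic h) {z : ℂ} (hz : Off h z) :
    eMode h E 0 * dA h z = dA h z * (eMode h E 0 + (h 1 * h 2 / h 0) •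
      (eCur h E z - eCur h E (z + h 0))) := by
  have h0 := H.h0_ne
  rw [eMode, e_mul_dA H hz]
  simp only [eCur, ← eOp_smul, ← eOp_sub, ← eOp_add]
  refine congrArg _ (eOp_congr fun b => ?_)
  have h1 := hz.sub_ne b
  have h2 := (hz.add_h0 H).sub_ne b
  have h3 : z + h 0 - boxWeight h b - h 0 ≠ 0 := by convert h1 using 1; ring
  rw [beta]
  field_simp
  ring

theorem eMode_one_mul_dA (H : Generic h) {z : ℂ} (hz : Off h z) :
    eMode h E 1 * dA h z = dA h z * (eMode h E 1 + (h 1 * h 2 / h 0) •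
      (z • eCur h E z - (z + h 0) • eCur h E (z + h 0))) := by
  have h0 := H.h0_ne
  rw [eMode, e_mul_dA H hz]
  simp only [eCur, ← eOp_smul, ← eOp_sub, ← eOp_add]
  refine congrArg _ (eOp_congr fun b => ?_)
  have h1 := hz.sub_ne b
  have h2 := (hz.add_h0 H).sub_ne b
  have h3 : z + h 0 - boxWeight h b - h 0 ≠ 0 := by convert h1 using 1; ring
  rw [beta]
  field_simp
  ring

theorem eMode_two_mul_dA (H : Generic h) {z : ℂ} (hz : Off h z) :
    eMode h E 2 * dA h z = dA h z * (eMode h E 2 + (h 1 * h 2 / h 0) •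
      (z ^ 2 • eCur h E z - (z + h 0) ^ 2 • eCur h E (z + h 0) + h 0 • eMode h E 0)) := by
  have h0 := H.h0_ne
  rw [eMode, e_mul_dA H hz]
  simp only [eCur, eMode, ← eOp_smul, ← eOp_sub, ← eOp_add]
  refine congrArg _ (eOp_congr fun b => ?_)
  have h1 := hz.sub_ne b
  have h2 := (hz.add_h0 H).sub_ne b
  have h3 : z + h 0 - boxWeight h b - h 0 ≠ 0 := by convert h1 using 1; ring
  rw [beta]
  field_simp
  ring

theorem dB_mul_eMode_zero (H : Generic h) {z : ℂ} (hz : Off h z) :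
    dB h z * eMode h E 0 = (eMode h E 0 + (h 1 * h 2 / h 0) •
      (eCur h E (z - h 0) - eCur h E z)) * dB h z := by
  have h0 := H.h0_ne
  rw [eMode, dB_mul_e]
  simp only [eCur, ← eOp_smul, ← eOp_sub, ← eOp_add]
  refine congrArg (· * dB h z) (eOp_congr fun b => ?_)
  have h1 := hz.sub_ne b
  have h2 := (hz.sub_h0 H).sub_ne b
  have h3 : z - boxWeight h b - h 0 ≠ 0 := by convert h2 using 1; ring
  rw [beta]
  field_simp
  ring

/-- e₁ + h₁e₀ is the mode with weight function w + h₁, the first mode seen from the shifted spectral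
parameter; next comes (w + h₁)². -/
theorem dB_mul_eMode_one (H : Generic h) {z : ℂ} (hz : Off h z) :
    dB h z * (eMode h E 1 + h 0 • eMode h E 0) = (eMode h E 1 + h 0 • eMode h E 0
      + (h 1 * h 2 / h 0) • (z • eCur h E (z - h 0) - (z + h 0) • eCur h E z)) * dB h z := by
  have h0 := H.h0_ne
  simp only [eCur, eMode, ← eOp_smul, ← eOp_sub, ← eOp_add]
  rw [dB_mul_e]
  refine congrArg (· * dB h z) (eOp_congr fun b => ?_)
  have h1 := hz.sub_ne b
  have h2 := (hz.sub_h0 H).sub_ne b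
  have h3 : z - boxWeight h b - h 0 ≠ 0 := by convert h2 using 1; ring
  rw [beta]
  field_simp
  ring

theorem dB_mul_eMode_two (H : Generic h) {z : ℂ} (hz : Off h z) :
    dB h z * (eMode h E 2 + (2 * h 0) • eMode h E 1 + (h 0 ^ 2) • eMode h E 0)
      = (eMode h E 2 + (2 * h 0) • eMode h E 1 + (h 0 ^ 2) • eMode h E 0 + (h 1 * h 2 / h 0) •
        (z ^ 2 • eCur h E (z - h 0) - (z + h 0) ^ 2 • eCur h E z + h 0 • eMode h E 0))
        * dB h z := by
  have h0 := H.h0_ne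
  simp only [eCur, eMode, ← eOp_smul, ← eOp_sub, ← eOp_add]
  rw [dB_mul_e]
  refine congrArg (· * dB h z) (eOp_congr fun b => ?_)
  have h1 := hz.sub_ne b
  have h2 := (hz.sub_h0 H).sub_ne b
  have h3 : z - boxWeight h b - h 0 ≠ 0 := by convert h2 using 1; ring
  rw [beta]
  field_simp
  ring

/-- Partial fractions in w of β(z' + h₁ - w)/(z - w). The coefficient κ is β at w = z, namely 1 +
h₂h₃/(d(d + h₁)). -/
theorem eCur_mul_dA (H : Generic h) {z z' d κ : ℂ} (hz : Off h z) (hz' : Off h z')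
    (hd : d = z' - z) (hd0 : d ≠ 0) (hda : d + h 0 ≠ 0)
    (hκ : κ = 1 + h 1 * h 2 / (d * (d + h 0))) :
    eCur h E z * dA h z' = dA h z' * (κ • eCur h E z - (h 1 * h 2 / h 0) •
      (d⁻¹ • eCur h E z' - (d + h 0)⁻¹ • eCur h E (z' + h 0))) := by
  have h0 := H.h0_ne
  rw [eCur, e_mul_dA H hz']
  simp only [eCur, ← eOp_smul, ← eOp_sub]
  refine congrArg _ (eOp_congr fun b => ?_)
  have h1 := hz.sub_ne b
  have h4 := hz'.sub_ne b
  have h2 := (hz'.add_h0 H).sub_ne b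
  have h3 : z' + h 0 - boxWeight h b - h 0 ≠ 0 := by convert h4 using 1; ring
  rw [beta, hκ]
  field_simp
  rw [hd]
  ring

theorem dB_mul_eCur (H : Generic h) {z z' d κ : ℂ} (hz : Off h z) (hz' : Off h z')
    (hd : d = z' - z) (hd0 : d ≠ 0) (hda : d + h 0 ≠ 0)
    (hκ : κ = 1 + h 1 * h 2 / (d * (d + h 0))) :
    dB h z' * eCur h E (z - h 0) = (κ • eCur h E (z - h 0) - (h 1 * h 2 / h 0) •
      (d⁻¹ • eCur h E (z' - h 0) - (d + h 0)⁻¹ • eCur h E z')) * dB h z' := by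
  have h0 := H.h0_ne
  rw [eCur, dB_mul_e]
  simp only [eCur, ← eOp_smul, ← eOp_sub]
  refine congrArg (· * dB h z') (eOp_congr fun b => ?_)
  have h1 := (hz.sub_h0 H).sub_ne b
  have h4 := hz'.sub_ne b
  have h2 := (hz'.sub_h0 H).sub_ne b
  have h3 : z' - boxWeight h b - h 0 ≠ 0 := by convert h2 using 1; ring
  rw [beta, hκ]
  field_simp
  rw [hd]
  ring

theorem fCur_beta (H : Generic h) {z z' d κ : ℂ} (hz : Off h z) (hz' : Off h z')
    (hd : d = z' - z) (hd0 : d ≠ 0) (hda : d + h 0 ≠ 0)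
    (hκ : κ = 1 + h 1 * h 2 / (d * (d + h 0))) :
    (fOp h E fun w => 1 / (z' - w) * beta h (z - w)) = κ • fCur h E z' + (h 1 * h 2 / h 0) •
      ((d + h 0)⁻¹ • fCur h E (z - h 0) - d⁻¹ • fCur h E z) := by
  have h0 := H.h0_ne
  simp only [fCur, ← fOp_smul, ← fOp_sub, ← fOp_add]
  refine fOp_congr fun b => ?_
  have h1 := (hz.sub_h0 H).sub_ne b
  have h4 := hz'.sub_ne b
  have h2 := hz.sub_ne b
  have h3 : z - boxWeight h b - h 0 ≠ 0 := by convert h1 using 1; ring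
  rw [beta, hκ]
  field_simp
  rw [hd]
  ring

theorem fCur_mul_dB (H : Generic h) {z z' d κ : ℂ} (hz : Off h z) (hz' : Off h z')
    (hd : d = z' - z) (hd0 : d ≠ 0) (hda : d + h 0 ≠ 0)
    (hκ : κ = 1 + h 1 * h 2 / (d * (d + h 0))) :
    fCur h E z' * dB h z = dB h z * (κ • fCur h E z' + (h 1 * h 2 / h 0) •
      ((d + h 0)⁻¹ • fCur h E (z - h 0) - d⁻¹ • fCur h E z)) := by
  rw [← fCur_beta H hz hz' hd hd0 hda hκ, fCur, f_mul_dB]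

theorem dA_mul_fCur (H : Generic h) {z z' d κ : ℂ} (hz : Off h z) (hz' : Off h z')
    (hd : d = z' - z) (hd0 : d ≠ 0) (hda : d + h 0 ≠ 0)
    (hκ : κ = 1 + h 1 * h 2 / (d * (d + h 0))) :
    dA h (z - h 0) * fCur h E z' = (κ • fCur h E z' + (h 1 * h 2 / h 0) •
      ((d + h 0)⁻¹ • fCur h E (z - h 0) - d⁻¹ • fCur h E z)) * dA h (z - h 0) := by
  rw [← fCur_beta H hz hz' hd hd0 hda hκ, fCur, dA_mul_f H (hz.sub_h0 H), sub_add_cancel]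

/-- The diagonal operator with eigenvalues `∑ h_□`. -/
def dP (h : Fin 3 → ℂ) : Module.End ℂ Fock := dOp fun π => ∑ b ∈ π.boxes, boxWeight h b

theorem dP_mul_e (φ : ℂ → ℂ) :
    dP h * eOp h E φ = eOp h E φ * dP h + eOp h E fun w => w * φ w := by
  refine op_ext fun π => ?_
  simp only [LinearMap.add_apply, Module.End.mul_apply, dP, dOp_ket, eOp_ket, map_sum, map_smul,
    Finset.smul_sum, ← Finset.sum_add_distrib]
  refine Finset.sum_congr rfl fun b hb => ?_
  rw [sum_ins (mem_addFin.1 hb)]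
  module

theorem dP_mul_f (φ : ℂ → ℂ) :
    dP h * fOp h E φ = fOp h E φ * dP h - fOp h E fun w => w * φ w := by
  refine op_ext fun π => ?_
  simp only [LinearMap.sub_apply, Module.End.mul_apply, dP, dOp_ket, fOp_ket, map_sum, map_smul,
    Finset.smul_sum, ← Finset.sum_sub_distrib]
  refine Finset.sum_congr rfl fun b hb => ?_
  have := sum_ins (addable_del (mem_remFin.1 hb)) (boxWeight h)
  rw [ins_del (mem_remFin.1 hb)] at this
  rw [this]
  module

theorem dP_mul_fCur {z : ℂ} (hz : Off h z) :
    dP h * fCur h E z = fCur h E z * dP h - (z • fCur h E z - fMode h E 0) := by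
  rw [fCur, dP_mul_f, fMode, ← fOp_smul, ← fOp_sub]
  refine congrArg _ (fOp_congr fun b => ?_)
  have := hz.sub_ne b
  field_simp
  ring

/-- The operators `ε_n`, with `ε_0 = 1` and
`(n + 1) h₂h₃ ε_{n+1} = e₁ ε_n - ε_n (e₁ + h₁ e₀)`. -/
def eps (h : Fin 3 → ℂ) (E : PlanePartition → Box → ℂ) : ℕ → Module.End ℂ Fock
  | 0 => 1
  | n + 1 => (((n : ℂ) + 1) * (h 1 * h 2))⁻¹ •
      (eMode h E 1 * eps h E n - eps h E n * (eMode h E 1 + h 0 • eMode h E 0))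

theorem eps_rec (H : Generic h) (n : ℕ) :
    eMode h E 1 * eps h E n - eps h E n * (eMode h E 1 + h 0 • eMode h E 0)
      = (((n : ℂ) + 1) * (h 1 * h 2)) • eps h E (n + 1) := by
  rw [eps, smul_smul, mul_inv_cancel₀, one_smul]
  exact mul_ne_zero (Nat.cast_add_one_ne_zero n) (mul_ne_zero H.h1_ne H.h2_ne)

theorem eps_one (H : Generic h) : eps h E 1 = (-(h 0 / (h 1 * h 2))) • eMode h E 0 := by
  have h1 := H.h1_ne
  have h2 := H.h2_ne
  rw [eps, eps]
  simp only [mul_one, one_mul]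
  match_scalars
  · simp
  · field_simp; ring

/-- The range of `X` lies in the raised subspace. -/
def IsRaised (h : Fin 3 → ℂ) (E : PlanePartition → Box → ℂ) (X : Module.End ℂ Fock) : Prop :=
  ∀ v, X v ∈ raised h E

namespace IsRaised

variable {X Y : Module.End ℂ Fock}

theorem eOp (φ : ℂ → ℂ) : IsRaised h E (eOp h E φ) := eOp_mem_raised φ

theorem add (hX : IsRaised h E X) (hY : IsRaised h E Y) : IsRaised h E (X + Y) :=
  fun v => add_mem (hX v) (hY v)

theorem sub (hX : IsRaised h E X) (hY : IsRaised h E Y) : IsRaised h E (X - Y) :=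
  fun v => sub_mem (hX v) (hY v)

theorem smul (c : ℂ) (hX : IsRaised h E X) : IsRaised h E (c • X) :=
  fun v => Submodule.smul_mem _ c (hX v)

theorem mul (hX : IsRaised h E X) (Y : Module.End ℂ Fock) : IsRaised h E (X * Y) :=
  fun v => hX (Y v)

theorem dOp_mul (hX : IsRaised h E X) {d : PlanePartition → ℂ}
    (hd : ∀ φ, IsRaised h E (dOp d * PlanePartitionYangian.eOp h E φ)) :
    IsRaised h E (dOp d * X) := by
  have : raised h E ≤ (raised h E).comap (dOp d) := by
    refine iSup_le fun φ => ?_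
    rintro _ ⟨u, rfl⟩
    exact hd φ u
  exact fun v => this (hX v)

theorem dB_mul (hX : IsRaised h E X) (z : ℂ) : IsRaised h E (dB h z * X) :=
  hX.dOp_mul fun φ => by
    have := dB_mul_e (h := h) (E := E) z φ
    rw [dB] at this
    rw [this]
    exact (eOp _).mul _

theorem dP_mul (hX : IsRaised h E X) : IsRaised h E (dP h * X) :=
  hX.dOp_mul fun φ => by
    have := dP_mul_e (h := h) (E := E) φ
    rw [dP] at this
    rw [this]
    exact ((eOp _).mul _).add (eOp _)

theorem eps_succ (H : Generic h) (n : ℕ) : IsRaised h E (eps h E (n + 1)) := by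
  induction n with
  | zero => rw [eps_one H]; exact (eOp _).smul _
  | succ n ih => rw [eps]; exact (((eOp _).mul _).sub (ih.mul _)).smul _

end IsRaised

/-- Commutation of `f(z)` with `ε_{n+1}`. -/
def LoweringRel (h : Fin 3 → ℂ) (E : PlanePartition → Box → ℂ) (n : ℕ) : Prop :=
  ∀ z, Off h z → fCur h E z * eps h E (n + 1) = eps h E (n + 1) * fCur h E z
    + ((h 1 * h 2)⁻¹ ^ 2) • (sc h z • (dA h z * eps h E n * dB h z) - eps h E n)

/-- The quadratic relation between `e(z)` and `ε_n`. -/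
def RaisingRel (h : Fin 3 → ℂ) (E : PlanePartition → Box → ℂ) (n : ℕ) : Prop :=
  ∀ z, Off h z → eCur h E z * eps h E n - eps h E n * eCur h E (z - h 0)
    = dB h z * eps h E (n + 1) * dA h (z - h 0) - eps h E (n + 1)

theorem RaisingRel.shift (H : Generic h) {n : ℕ} (hG : RaisingRel h E n) {z : ℂ} (hz : Off h z) :
    eCur h E (z + h 0) * eps h E n - eps h E n * eCur h E z
      = dB h (z + h 0) * eps h E (n + 1) * dA h z - eps h E (n + 1) := by
  have := hG _ (hz.add_h0 H)
  rwa [add_sub_cancel_right] at this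

/-- As ε_1 is a multiple of e₀, this is 1/v - 1/(v - h₁) = -(h₁/(h₂h₃))(β(v) - 1) under e₀. -/
theorem raisingRel_zero (H : Generic h) : RaisingRel h E 0 := by
  intro z hz
  have h0 := H.h0_ne
  have h1 := H.h1_ne
  have h2 := H.h2_ne
  rw [eps_one H, eps, mul_one, one_mul, mul_smul_comm, smul_mul_assoc, eMode, dB_mul_e, mul_assoc,
    dB_mul_dA H hz, mul_one, ← eOp_smul, ← eOp_smul, ← eOp_sub, eCur, eCur, ← eOp_sub]
  refine eOp_congr fun b => ?_
  have h3 := hz.sub_ne b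
  have h4 := (hz.sub_h0 H).sub_ne b
  have h5 : z - boxWeight h b - h 0 ≠ 0 := by convert h4 using 1; ring
  rw [beta]
  field_simp
  ring

theorem loweringRel_zero (H : Generic h) (hE : HasResidues h E) (hX : Exchange E) :
    LoweringRel h E 0 := by
  intro z hz
  refine lowering_base (R := Module.End ℂ Fock) H.h0_ne (mul_ne_zero H.h1_ne H.h2_ne)
      (fCur_mul_eMode_zero H hE hX hz)
    (e1 := eMode h E 1) ?_
  have := eps_rec (E := E) H 0
  simpa [eps] using this

theorem loweringRel_succ (H : Generic h) (hE : HasResidues h E) (hX : Exchange E) {n : ℕ}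
    (hF : LoweringRel h E n) (hG : RaisingRel h E n) : LoweringRel h E (n + 1) := by
  intro z hz
  have hr := eps_rec (E := E) H (n + 1)
  push_cast at hr
  exact lowering_step (R := Module.End ℂ Fock) H.h0_ne (mul_ne_zero H.h1_ne H.h2_ne) (n := (n : ℂ)
      + 1)
    (by exact_mod_cast Nat.cast_add_one_ne_zero (R := ℂ) (n + 1)) (hF z hz)
    (fCur_mul_eMode_one H hE hX hz) (fCur_mul_eMode_zero H hE hX hz) (eMode_one_mul_dA H hz)
    (dB_mul_eMode_one H hz) (hG z hz) (hG.shift H hz) (eps_rec H n) hr (dA_sub_mul_dB H hz)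
    (dA_mul_dB H hz)

/-- The difference of the two sides has raised values and commutes with f(z') for all admissible z',
hence vanishes. Only the lowering relations at n and n + 1 and the raising relation at n enter, so
the two families climb together. -/
theorem raisingRel_succ (H : Generic h) (hE : HasResidues h E) (hX : Exchange E) {n : ℕ}
    (hF : LoweringRel h E n) (hF' : LoweringRel h E (n + 1)) (hG : RaisingRel h E n) :
    RaisingRel h E (n + 1) := by
  intro z hz
  refine sub_eq_zero.1 (op_eq_zero_of_commute H (E := E) ?_
    -- The exchange rules divide by z' - z and z' - z + h₁.
    (infinite_off h {z, z - h 0}) (fun z' hz' => hz'.1) ?_)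
  · exact (((IsRaised.eOp _).mul _).sub ((IsRaised.eps_succ H n).mul _)).sub
      ((((IsRaised.eps_succ H (n + 1)).dB_mul z).mul _).sub (IsRaised.eps_succ H (n + 1)))
  · rintro z' ⟨hz', hn⟩
    simp only [Finset.mem_insert, Finset.mem_singleton, not_or] at hn
    have hd : z' - z ≠ 0 := sub_ne_zero.2 hn.1
    have hda : z' - z + h 0 ≠ 0 := fun e => hn.2 (by linear_combination e)
    refine sub_eq_zero.1 ?_
    exact lowering_comm_current (R := Module.End ℂ Fock) H.h0_ne (mul_ne_zero H.h1_ne H.h2_ne) hd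
        hda rfl
      (fCur_mul_eCur H hE hX hz hz' rfl hd)
      (fCur_mul_eCur H hE hX (hz.sub_h0 H) hz' (by ring) hda)
      (hF z' hz') (hF' z' hz') (hF' z hz) (hF' _ (hz.sub_h0 H))
      (fCur_mul_dB H hz hz' rfl hd hda rfl) (dA_mul_fCur H hz hz' rfl hd hda rfl)
      (eCur_mul_dA H hz hz' rfl hd hda rfl) (dB_mul_eCur H hz hz' rfl hd hda rfl)
      (hG z hz) (hG z' hz') (hG.shift H hz') (dA_sub_mul_dB H hz') (dA_mul_dB H hz')
      (dB_mul_dA H hz) (dOp_comm _ _) (dOp_comm _ _) (dOp_comm _ _) (dOp_comm _ _)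

theorem eps_rels (H : Generic h) (hE : HasResidues h E) (hX : Exchange E) (n : ℕ) :
    LoweringRel h E n ∧ RaisingRel h E n := by
  induction n with
  | zero => exact ⟨loweringRel_zero H hE hX, raisingRel_zero H⟩
  | succ n ih =>
    have := loweringRel_succ H hE hX ih.1 ih.2
    exact ⟨this, raisingRel_succ H hE hX ih.1 this ih.2⟩

/-- The germ of the commutativity of all creation modes: bracketing repeatedly with e₁ spreads it
from e₀ to every J_{-k}. -/
theorem eMode_zero_comm_eps (H : Generic h) (hE : HasResidues h E) (hX : Exchange E) (n : ℕ) :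
    eMode h E 0 * eps h E n = eps h E n * eMode h E 0 := by
  induction n with
  | zero => rw [eps, mul_one, one_mul]
  | succ n ih =>
    refine sub_eq_zero.1 (op_eq_zero_of_commute H (E := E) ?_
      (infinite_off h ∅) (fun z' hz' => hz'.1) ?_)
    · exact ((IsRaised.eOp _).mul _).sub ((IsRaised.eps_succ H n).mul _)
    · rintro z ⟨hz, -⟩
      have hG := (eps_rels H hE hX n).2
      refine sub_eq_zero.1 ?_
      exact lowering_comm_zeroth (R := Module.End ℂ Fock) H.h0_ne (mul_ne_zero H.h1_ne H.h2_ne)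
        ((eps_rels H hE hX n).1 z hz) (fCur_mul_eMode_zero H hE hX hz) (eMode_zero_mul_dA H hz)
        (dB_mul_eMode_zero H hz) (hG z hz) (hG.shift H hz) ih (dA_sub_mul_dB H hz)
        (dA_mul_dB H hz)

theorem fMode_zero_mul_eMode_zero (H : Generic h) (hE : HasResidues h E) (hX : Exchange E) :
    fMode h E 0 * eMode h E 0 = eMode h E 0 * fMode h E 0 - 1 := by
  rw [fMode, eMode, f_mul_e hX, ← dOp_one]
  congr 2
  funext π
  rw [← hE.moment_one H π]
  simp

theorem fMode_zero_mul_eMode_one (H : Generic h) (hE : HasResidues h E) (hX : Exchange E) :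
    fMode h E 0 * eMode h E 1 = eMode h E 1 * fMode h E 0 := by
  rw [fMode, eMode, f_mul_e hX]
  have : dOp (moment h E fun w => w ^ 1 * w ^ 0) = 0 := op_ext fun π => by
    simp [dOp_ket, hE.moment_id H π]
  rw [this]
  exact sub_zero (G := Module.End ℂ Fock) _

theorem lowering_zeroth_step {R : Type*} [Ring R] [Algebra ℂ R] {a q n : ℂ} (hq : q ≠ 0)
    (hn : n + 1 ≠ 0) {f e0 e1 ε ε' ε'' : R} (h0 : f * e0 = e0 * f - 1) (h1 : f * e1 = e1 * f)
    (hr : e1 * ε - ε * (e1 + a • e0) = (n * q) • ε')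
    (hr' : e1 * ε' - ε' * (e1 + a • e0) = ((n + 1) * q) • ε'')
    (ih : f * ε' = ε' * f + (a * q⁻¹) • ε) : f * ε'' = ε'' * f + (a * q⁻¹) • ε' := by
  have h3 : ((n + 1) * q) • (f * ε'' - (ε'' * f + (a * q⁻¹) • ε')) = 0 := by
    linear_combination (norm := skip) hr' * f - f * hr' + (a * q⁻¹) • hr + h1 * ε' + e1 * ih
      - ih * (e1 + a • e0) - ε' * h1 - a • (ε' * h0)
    simp only [mul_add, add_mul, mul_sub, sub_mul, smul_mul_assoc, mul_smul_comm, mul_assoc,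
      mul_one, one_mul, smul_add, smul_sub, smul_smul]
    match_scalars <;> field_simp <;> ring
  exact sub_eq_zero.1 ((smul_eq_zero.1 h3).resolve_left (mul_ne_zero hn hq))

theorem fMode_zero_mul_eps (H : Generic h) (hE : HasResidues h E) (hX : Exchange E) (n : ℕ) :
    fMode h E 0 * eps h E (n + 1) = eps h E (n + 1) * fMode h E 0
      + (h 0 * (h 1 * h 2)⁻¹) • eps h E n := by
  induction n with
  | zero =>
    rw [eps_one H, eps, mul_smul_comm, fMode_zero_mul_eMode_zero H hE hX, smul_mul_assoc]
    module
  | succ n ih =>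
    have hr := eps_rec (E := E) H (n + 1)
    push_cast at hr
    exact lowering_zeroth_step (R := Module.End ℂ Fock) (n := (n : ℂ) + 1) (mul_ne_zero H.h1_ne
        H.h2_ne)
      (by exact_mod_cast Nat.cast_add_one_ne_zero (R := ℂ) (n + 1))
      (fMode_zero_mul_eMode_zero H hE hX) (fMode_zero_mul_eMode_one H hE hX) (eps_rec H n) hr ih

theorem second_base {R : Type*} [Ring R] [Algebra ℂ R] {a q : ℂ} (hq : q ≠ 0) {e0 e1 e2 P : R}
    (hP : P * e0 = e0 * P + e1) :
    e2 * 1 - 1 * (e2 + (2 * a) • e1 + (a ^ 2) • e0) = q • ((2 : ℂ) •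
      (P * ((-(a / q)) • e0) - ((-(a / q)) • e0) * P)
        + (((0 : ℕ) + 1 : ℂ) * a) • ((-(a / q)) • e0)) := by
  rw [mul_smul_comm, hP]
  simp only [smul_mul_assoc, mul_one, one_mul]
  match_scalars <;> field_simp <;> ring

/-- Needed to bring V_{-2} into play, since V_{-2} contains e₂. Proved once more by showing that the
defect commutes with f(z). -/
theorem eMode_two_eps (H : Generic h) (hE : HasResidues h E) (hX : Exchange E) (n : ℕ) :
    eMode h E 2 * eps h E n - eps h E n * (eMode h E 2 + (2 * h 0) • eMode h E 1
      + (h 0 ^ 2) • eMode h E 0) = (h 1 * h 2) • ((2 : ℂ) • (dP h * eps h E (n + 1)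
        - eps h E (n + 1) * dP h) + (((n : ℂ) + 1) * h 0) • eps h E (n + 1)) := by
  induction n with
  | zero =>
    have h1 := H.h1_ne
    have h2 := H.h2_ne
    have h3 : dP h * eMode h E 0 = eMode h E 0 * dP h + eMode h E 1 := by
      rw [eMode, dP_mul_e]
      congr 2
      funext w
      ring
    rw [eps_one H, eps]
    exact second_base (R := Module.End ℂ Fock) (mul_ne_zero h1 h2) h3
  | succ n ih =>
    refine sub_eq_zero.1 (op_eq_zero_of_commute H (E := E) ?_
      (infinite_off h ∅) (fun z' hz' => hz'.1) ?_)
    · exact (((IsRaised.eOp _).mul _).sub ((IsRaised.eps_succ H n).mul _)).sub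
        (((((IsRaised.eps_succ H (n + 1)).dP_mul).sub
          ((IsRaised.eps_succ H (n + 1)).mul _)).smul _).add
            ((IsRaised.eps_succ H (n + 1)).smul _) |>.smul _)
    · rintro z ⟨hz, -⟩
      have hG := (eps_rels H hE hX n).2
      refine sub_eq_zero.1 ?_
      push_cast
      exact lowering_comm_second (R := Module.End ℂ Fock) H.h0_ne (mul_ne_zero H.h1_ne H.h2_ne) _
        ((eps_rels H hE hX n).1 z hz) ((eps_rels H hE hX (n + 1)).1 z hz)
        (fMode_zero_mul_eps H hE hX (n + 1))
        (fCur_mul_eMode_zero H hE hX hz) (fCur_mul_eMode_one H hE hX hz)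
        (fCur_mul_eMode_two H hE hX hz) (eMode_two_mul_dA H hz)
        (dB_mul_eMode_two H hz) (dOp_comm _ _) (dOp_comm _ _) (dP_mul_fCur hz)
        (hG z hz) (hG.shift H hz) (eMode_zero_comm_eps H hE hX n) ih (dA_sub_mul_dB H hz)
        (dA_mul_dB H hz)

end

end

section

/-! ### The Heisenberg modes and the mode `V₋₂` -/

section

variable {R : Type} [Ring R]

theorem bracket_add (x y z : R) : ⁅x, y + z⁆ = ⁅x, y⁆ + ⁅x, z⁆ := by
  simp only [Ring.lie_def]; noncomm_ring

theorem bracket_sub (x y z : R) : ⁅x, y - z⁆ = ⁅x, y⁆ - ⁅x, z⁆ := by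
  simp only [Ring.lie_def]; noncomm_ring

theorem sub_bracket (x y z : R) : ⁅x - y, z⁆ = ⁅x, z⁆ - ⁅y, z⁆ := by
  simp only [Ring.lie_def]; noncomm_ring

@[simp]
theorem bracket_zero (x : R) : ⁅x, (0 : R)⁆ = 0 := by simp [Ring.lie_def]

@[simp]
theorem zero_bracket (x : R) : ⁅(0 : R), x⁆ = 0 := by simp [Ring.lie_def]

@[simp]
theorem bracket_one (x : R) : ⁅x, (1 : R)⁆ = 0 := by simp [Ring.lie_def]

theorem bracket_mul (x y z : R) : ⁅x, y * z⁆ = ⁅x, y⁆ * z + y * ⁅x, z⁆ := by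
  simp only [Ring.lie_def]; noncomm_ring

theorem bracket_bracket_right (x y z : R) : ⁅x, ⁅y, z⁆⁆ = ⁅⁅x, y⁆, z⁆ + ⁅y, ⁅x, z⁆⁆ := by
  simp only [Ring.lie_def]; noncomm_ring

theorem bracket_bracket_left (x y z : R) : ⁅⁅x, y⁆, z⁆ = ⁅x, ⁅y, z⁆⁆ - ⁅y, ⁅x, z⁆⁆ := by
  simp only [Ring.lie_def]; noncomm_ring

theorem adPow_succ (x y : R) (n : ℕ) : adPow x (n + 1) y = ⁅x, adPow x n y⁆ :=
  Function.iterate_succ_apply' _ _ _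

variable [Algebra ℂ R]

theorem bracket_smul_right (c : ℂ) (x y : R) : ⁅x, c • y⁆ = c • ⁅x, y⁆ := by
  simp only [Ring.lie_def, mul_smul_comm, smul_mul_assoc, smul_sub]

theorem bracket_smul_left (c : ℂ) (x y : R) : ⁅c • x, y⁆ = c • ⁅x, y⁆ := by
  simp only [Ring.lie_def, mul_smul_comm, smul_mul_assoc, smul_sub]

/-- The modes `a_{n,1}` for families `e` and `f` of elements of a ring. -/
def modeJ (e f : ℕ → R) : ℤ → R
  | Int.ofNat 0 => 0
  | Int.ofNat (n + 1) => -((1 / (n.factorial : ℂ)) • adPow (f 1) n (f 0))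
  | Int.negSucc n => (1 / (n.factorial : ℂ)) • adPow (e 1) n (e 0)

/-- The element `[e₂, e₀] - σ₃ [e₁, e₀]`. -/
def modeV (s₃ : ℂ) (e : ℕ → R) : R := ⁅e 2, e 0⁆ - s₃ • ⁅e 1, e 0⁆

/-- The relations of the Yangian that involve few modes only, with `ψ₁ = 0`. -/
structure LowRelations (s₂ s₃ : ℂ) (e f psi : ℕ → R) : Prop where
  ef : ∀ j k, ⁅e j, f k⁆ = psi (j + k)
  psi_zero : psi 0 = 1
  psi_one : psi 1 = 0
  psi_two_e : ∀ j, ⁅psi 2, e j⁆ = (2 : ℂ) • e j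
  psi_two_f : ∀ j, ⁅psi 2, f j⁆ = -((2 : ℂ) • f j)
  psi_three_e : ∀ j, ⁅psi 3, e j⁆ = (6 : ℂ) • e (j + 1) + (2 * s₃) • e j
  psi_four_e : ⁅psi 4, e 0⁆ = (12 : ℂ) • e 2 + (6 * s₃) • e 1 - (2 * s₂) • e 0

variable {s₂ s₃ : ℂ} {e f psi : ℕ → R}

theorem modeJ_zero : modeJ e f 0 = 0 := rfl

theorem modeJ_pos (k : ℕ) :
    modeJ e f ((k : ℤ) + 1) = -((1 / (k.factorial : ℂ)) • adPow (f 1) k (f 0)) := rfl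

theorem modeJ_neg (k : ℕ) :
    modeJ e f (-((k : ℤ) + 1)) = (1 / (k.factorial : ℂ)) • adPow (e 1) k (e 0) := by
  rw [← Int.negSucc_eq]; rfl

theorem modeJ_one : modeJ e f 1 = -f 0 := by
  have := modeJ_pos (e := e) (f := f) 0
  simpa [adPow] using this

theorem modeJ_neg_one : modeJ e f (-1) = e 0 := by
  have := modeJ_neg (e := e) (f := f) 0
  simpa [adPow] using this

theorem lie_f_modeJ_pos (k : ℕ) :
    ⁅f 1, modeJ e f ((k : ℤ) + 1)⁆ = ((k : ℂ) + 1) • modeJ e f ((k : ℤ) + 2) := by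
  have h2 : ((k : ℤ) + 2) = ((k + 1 : ℕ) : ℤ) + 1 := by push_cast; ring
  rw [h2, modeJ_pos, modeJ_pos, adPow_succ, Nat.factorial_succ, bracket_neg_right,
      bracket_smul_right, smul_neg,
    smul_smul]
  congr 2
  have := Nat.cast_add_one_ne_zero (R := ℂ) k
  have := Nat.cast_ne_zero (R := ℂ).2 k.factorial_ne_zero
  push_cast
  field_simp

theorem lie_e_modeJ_neg (k : ℕ) :
    ⁅e 1, modeJ e f (-((k : ℤ) + 1))⁆ = ((k : ℂ) + 1) • modeJ e f (-((k : ℤ) + 2)) := by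
  have h2 : ((k : ℤ) + 2) = ((k + 1 : ℕ) : ℤ) + 1 := by push_cast; ring
  rw [h2, modeJ_neg, modeJ_neg, adPow_succ, Nat.factorial_succ, bracket_smul_right, smul_smul]
  congr 1
  have := Nat.cast_add_one_ne_zero (R := ℂ) k
  have := Nat.cast_ne_zero (R := ℂ).2 k.factorial_ne_zero
  push_cast
  field_simp

theorem smul_right_cancel_of_ne {c : ℂ} (hc : c ≠ 0) {x y : R} (H : c • x = c • y) : x = y := by
  rw [← one_smul ℂ x, ← one_smul ℂ y, ← inv_mul_cancel₀ hc, mul_smul, mul_smul, H]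

namespace LowRelations

variable (L : LowRelations s₂ s₃ e f psi)
include L

theorem fe (j k : ℕ) : ⁅f j, e k⁆ = -psi (k + j) := by rw [← L.ef, neg_bracket]

theorem psi_two_modeJ_pos (k : ℕ) :
    ⁅psi 2, modeJ e f ((k : ℤ) + 1)⁆ = (-(2 * ((k : ℂ) + 1))) • modeJ e f ((k : ℤ) + 1) := by
  induction k with
  | zero =>
    simp only [Nat.cast_zero, zero_add, modeJ_one, bracket_neg_right, L.psi_two_f]
    module
  | succ k ih =>
    have hk := Nat.cast_add_one_ne_zero (R := ℂ) k
    refine smul_right_cancel_of_ne hk ?_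
    have h2 : (((k + 1 : ℕ) : ℤ) + 1) = (k : ℤ) + 2 := by push_cast; ring
    rw [h2, ← bracket_smul_right, ← lie_f_modeJ_pos, bracket_bracket_right, ih, L.psi_two_f,
        smul_comm, bracket_smul_right,
      ← lie_f_modeJ_pos, bracket_neg_left, bracket_smul_left]
    push_cast
    module

theorem psi_two_modeJ_neg (k : ℕ) :
    ⁅psi 2, modeJ e f (-((k : ℤ) + 1))⁆ = (2 * ((k : ℂ) + 1)) • modeJ e f (-((k : ℤ) + 1)) := by
  induction k with
  | zero =>
    simp only [Nat.cast_zero, zero_add, modeJ_neg_one, L.psi_two_e, mul_one]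
  | succ k ih =>
    have hk := Nat.cast_add_one_ne_zero (R := ℂ) k
    refine smul_right_cancel_of_ne hk ?_
    have h2 : (((k + 1 : ℕ) : ℤ) + 1) = (k : ℤ) + 2 := by push_cast; ring
    rw [h2, ← bracket_smul_right, ← lie_e_modeJ_neg, bracket_bracket_right, ih, L.psi_two_e,
        smul_comm, bracket_smul_right,
      ← lie_e_modeJ_neg, bracket_smul_left]
    push_cast
    module

/-- e₁, f₁, ψ₂ span an sl₂ (they act as L_{-1}, -L_1, 2L_0), and [e₁, J_1] = 0 because ψ₁ = 0. The
coefficients are those of a spin-one current. -/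
theorem lie_e_modeJ_pos (k : ℕ) :
    ⁅e 1, modeJ e f ((k : ℤ) + 1)⁆ = (-((k : ℂ) + 1)) • modeJ e f (k : ℤ) := by
  induction k with
  | zero =>
    simp [modeJ_zero, modeJ_one, bracket_neg_right, L.ef, L.psi_one]
  | succ k ih =>
    have hk := Nat.cast_add_one_ne_zero (R := ℂ) k
    refine smul_right_cancel_of_ne hk ?_
    have h2 : (((k + 1 : ℕ) : ℤ) + 1) = (k : ℤ) + 2 := by push_cast; ring
    have h3 : ⁅f 1, modeJ e f (k : ℤ)⁆ = (k : ℂ) • modeJ e f ((k : ℤ) + 1) := by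
      rcases k with _ | k
      · simp [modeJ_zero]
      · have := lie_f_modeJ_pos (e := e) (f := f) k
        push_cast
        rw [this]
        congr 2
    rw [h2, ← bracket_smul_right, ← lie_f_modeJ_pos, bracket_bracket_right, ih, L.ef,
        L.psi_two_modeJ_pos, bracket_smul_right, h3]
    push_cast
    module

theorem lie_f_modeJ_neg (k : ℕ) :
    ⁅f 1, modeJ e f (-((k : ℤ) + 1))⁆ = (-((k : ℂ) + 1)) • modeJ e f (-(k : ℤ)) := by
  induction k with
  | zero =>
    simp [modeJ_zero, modeJ_neg_one, L.fe, L.psi_one]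
  | succ k ih =>
    have hk := Nat.cast_add_one_ne_zero (R := ℂ) k
    refine smul_right_cancel_of_ne hk ?_
    have h2 : (((k + 1 : ℕ) : ℤ) + 1) = (k : ℤ) + 2 := by push_cast; ring
    have h3 : ⁅e 1, modeJ e f (-(k : ℤ))⁆ = (k : ℂ) • modeJ e f (-((k : ℤ) + 1)) := by
      rcases k with _ | k
      · simp [modeJ_zero]
      · have := lie_e_modeJ_neg (e := e) (f := f) k
        push_cast
        rw [this]
        congr 3
    rw [h2, ← bracket_smul_right, ← lie_e_modeJ_neg, bracket_bracket_right, ih, L.fe,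
        bracket_neg_left, L.psi_two_modeJ_neg,
      bracket_smul_right, h3]
    push_cast
    module

theorem lie_e_modeJ (n : ℤ) : ⁅e 1, modeJ e f n⁆ = (-(n : ℂ)) • modeJ e f (n - 1) := by
  rcases lt_trichotomy n 0 with hn | rfl | hn
  · obtain ⟨k, rfl⟩ : ∃ k : ℕ, n = -((k : ℤ) + 1) := ⟨(-n - 1).toNat, by omega⟩
    rw [lie_e_modeJ_neg, show -((k : ℤ) + 1) - 1 = -((k : ℤ) + 2) by ring]
    congr 1; push_cast; ring
  · simp [modeJ_zero]
  · obtain ⟨k, rfl⟩ : ∃ k : ℕ, n = (k : ℤ) + 1 := ⟨(n - 1).toNat, by omega⟩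
    rw [L.lie_e_modeJ_pos, add_sub_cancel_right]; congr 1; push_cast; ring

theorem lie_f_modeJ (n : ℤ) : ⁅f 1, modeJ e f n⁆ = (n : ℂ) • modeJ e f (n + 1) := by
  rcases lt_trichotomy n 0 with hn | rfl | hn
  · obtain ⟨k, rfl⟩ : ∃ k : ℕ, n = -((k : ℤ) + 1) := ⟨(-n - 1).toNat, by omega⟩
    rw [L.lie_f_modeJ_neg, show -((k : ℤ) + 1) + 1 = -(k : ℤ) by ring]
    congr 1; push_cast; ring
  · simp [modeJ_zero]
  · obtain ⟨k, rfl⟩ : ∃ k : ℕ, n = (k : ℤ) + 1 := ⟨(n - 1).toNat, by omega⟩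
    rw [lie_f_modeJ_pos, show (k : ℤ) + 1 + 1 = (k : ℤ) + 2 by ring]; congr 1; push_cast; ring

theorem lie_modeJ_one (k : ℕ) :
    ⁅modeJ e f 1, modeJ e f (-(k : ℤ))⁆ = if k = 1 then 1 else 0 := by
  have h1 : ⁅modeJ e f 1, e 1⁆ = 0 := by
    rw [← neg_bracket, L.lie_e_modeJ]; simp [modeJ_zero]
  induction k with
  | zero => simp [modeJ_zero]
  | succ k ih =>
    rcases k with _ | k
    · simp [modeJ_one, modeJ_neg_one, bracket_neg_left, L.fe, L.psi_zero]
    · have hk := Nat.cast_add_one_ne_zero (R := ℂ) k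
      refine smul_right_cancel_of_ne hk ?_
      have h2 : (((k + 1 + 1 : ℕ) : ℤ)) = (k : ℤ) + 2 := by push_cast; ring
      have h3 : ⁅e 1, (if k + 1 = 1 then (1 : R) else 0)⁆ = 0 := by
        split_ifs <;> simp [Ring.lie_def]
      rw [h2, ← bracket_smul_right, ← lie_e_modeJ_neg, bracket_bracket_right, h1, zero_bracket,
          zero_add]
      have h4 : (((k + 1 : ℕ) : ℤ)) = (k : ℤ) + 1 := by push_cast; ring
      rw [← h4, ih, h3]
      simp

/-- Climbing with f₁ from [J_1, J_{-k}], which comes from ψ₀ = 1. No cubic relation is used;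
same-sign brackets are not accessible this way. -/
theorem lie_modeJ_pos_neg (m k : ℕ) :
    ⁅modeJ e f ((m : ℤ) + 1), modeJ e f (-(k : ℤ))⁆
      = if k = m + 1 then ((m : ℂ) + 1) • 1 else 0 := by
  induction m generalizing k with
  | zero => simp [L.lie_modeJ_one]
  | succ m ih =>
    have hm := Nat.cast_add_one_ne_zero (R := ℂ) m
    refine smul_right_cancel_of_ne hm ?_
    have h2 : (((m + 1 : ℕ) : ℤ) + 1) = (m : ℤ) + 2 := by push_cast; ring
    have h3 : ⁅f 1, (if k = m + 1 then ((m : ℂ) + 1) • (1 : R) else 0)⁆ = 0 := by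
      split_ifs <;> simp [Ring.lie_def]
    rw [h2, ← bracket_smul_left, ← lie_f_modeJ_pos, bracket_bracket_left, ih, h3, zero_sub,
        L.lie_f_modeJ, bracket_smul_right]
    rcases k with _ | k
    · simp
    · have h4 : -(((k + 1 : ℕ) : ℤ)) + 1 = -(k : ℤ) := by push_cast; ring
      rw [h4, ih]
      by_cases hkm : k = m + 1
      · subst hkm
        simp only [if_true]
        push_cast
        module
      · simp [hkm]

theorem lie_f_zero_modeV : ⁅f 0, modeV s₃ e⁆ = (-2 : ℂ) • e 0 := by
  rw [modeV, bracket_sub, bracket_smul_right, bracket_bracket_right,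
    bracket_bracket_right (f 0) (e 1)]
  simp only [L.fe, add_zero, L.psi_zero, L.psi_one, bracket_neg_left, L.psi_two_e, zero_bracket,
      neg_zero]
  simp [Ring.lie_def]

theorem lie_f_one_modeV : ⁅f 1, modeV s₃ e⁆ = (-6 : ℂ) • e 1 := by
  rw [modeV, bracket_sub, bracket_smul_right, bracket_bracket_right,
    bracket_bracket_right (f 1) (e 1)]
  simp only [L.fe, zero_add, Nat.reduceAdd, L.psi_one, bracket_neg_left, L.psi_two_e,
      L.psi_three_e, neg_zero,
    bracket_zero]
  module

theorem lie_f_two_modeV : ⁅f 2, modeV s₃ e⁆ =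
    (-10 : ℂ) • e 2 - (2 * s₃) • e 1 + (2 * (s₂ + s₃ ^ 2)) • e 0 := by
  have h2 (j : ℕ) : ⁅e j, psi 2⁆ = -((2 : ℂ) • e j) := by rw [← neg_bracket, L.psi_two_e]
  rw [modeV, bracket_sub, bracket_smul_right, bracket_bracket_right,
    bracket_bracket_right (f 2) (e 1)]
  simp only [L.fe, zero_add, Nat.reduceAdd, bracket_neg_left, bracket_neg_right, h2, L.psi_three_e,
      L.psi_four_e]
  module

/-- The brackets of f₀, f₁, f₂ with V_{-2} are linear in e₀, e₁, e₂, so Jacobi leaves only ψ₀, ψ₁,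
ψ₂. The term in σ₂ enters through [ψ₄, e₀]. -/
theorem lie_modeV_modeV :
    ⁅-modeV s₃ f, modeV s₃ e⁆ = (8 : ℂ) • psi 2 - (2 * (s₂ + s₃ ^ 2)) • 1 := by
  rw [modeV, bracket_neg_left, sub_bracket, bracket_smul_left, bracket_bracket_left,
      bracket_bracket_left, L.lie_f_zero_modeV, L.lie_f_two_modeV,
    L.lie_f_one_modeV]
  simp only [bracket_smul_right, bracket_add, bracket_sub, L.fe, L.psi_one, L.psi_zero, zero_add,
    add_zero]
  module

theorem lie_modeV_modeJ_nonneg (k : ℕ) :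
    ⁅modeV s₃ e, modeJ e f (k : ℤ)⁆ = (-(2 * (k : ℂ))) • modeJ e f ((k : ℤ) - 2) := by
  rcases k with _ | k
  · simp [modeJ_zero]
  induction k with
  | zero =>
    simp only [zero_add, Nat.cast_one, modeJ_one, bracket_neg_right]
    rw [neg_bracket, L.lie_f_zero_modeV, show (1 : ℤ) - 2 = -1 by ring, modeJ_neg_one]
    module
  | succ k ih =>
    have hk := Nat.cast_add_one_ne_zero (R := ℂ) k
    refine smul_right_cancel_of_ne hk ?_
    have h2 : (((k + 1 + 1 : ℕ) : ℤ)) = (k : ℤ) + 2 := by push_cast; ring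
    have h3 : (((k + 1 : ℕ) : ℤ)) = (k : ℤ) + 1 := by push_cast; ring
    have h4 : ⁅modeV s₃ e, f 1⁆ = (6 : ℂ) • e 1 := by
      rw [← neg_bracket, L.lie_f_one_modeV]; module
    rw [h3] at ih
    rw [h2, ← bracket_smul_right, ← lie_f_modeJ_pos, bracket_bracket_right, ih, h4,
        bracket_smul_left, bracket_smul_right, L.lie_e_modeJ,
      L.lie_f_modeJ, show (k : ℤ) + 1 - 2 + 1 = k by ring, show (k : ℤ) + 1 - 1 = k by ring,
      show (k : ℤ) + 2 - 2 = k by ring]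
    push_cast
    module

end LowRelations

/-- The relations of the family `ε`. -/
structure EpsRelations (a q : ℂ) (e : ℕ → R) (P : R) (eps : ℕ → R) : Prop where
  zero : eps 0 = 1
  step : ∀ n, e 1 * eps n - eps n * (e 1 + a • e 0) = (((n : ℂ) + 1) * q) • eps (n + 1)
  comm : ∀ n, e 0 * eps n = eps n * e 0
  second : ∀ n, e 2 * eps n - eps n * (e 2 + (2 * a) • e 1 + (a ^ 2) • e 0)
    = q • ((2 : ℂ) • (P * eps (n + 1) - eps (n + 1) * P) + (((n : ℂ) + 1) * a) • eps (n + 1))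
  level : P * e 0 = e 0 * P + e 1

namespace EpsRelations

variable {a q : ℂ} {P : R} {eps : ℕ → R} (ha : a ≠ 0) (hq : q ≠ 0)
  (D : EpsRelations a q e P eps)

/-- A derivation that maps generators into the subalgebra preserves it. -/
theorem lie_mem_adjoin {s : Set R} {x : R} (H : ∀ y ∈ s, ⁅x, y⁆ ∈ Algebra.adjoin ℂ s) {y : R}
    (hy : y ∈ Algebra.adjoin ℂ s) : ⁅x, y⁆ ∈ Algebra.adjoin ℂ s := by
  induction hy using Algebra.adjoin_induction with
  | mem y hy => exact H y hy
  | algebraMap r =>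
    rw [Ring.lie_def, Algebra.commutes, sub_self]; exact zero_mem _
  | add y z _ _ h1 h2 => rw [bracket_add]; exact add_mem h1 h2
  | mul y z hy hz h1 h2 =>
    rw [bracket_mul]
    exact add_mem (mul_mem h1 hz) (mul_mem hy h2)

theorem lie_eq_zero_of_adjoin {s : Set R} {x : R} (H : ∀ y ∈ s, ⁅x, y⁆ = 0) {y : R}
    (hy : y ∈ Algebra.adjoin ℂ s) : ⁅x, y⁆ = 0 := by
  induction hy using Algebra.adjoin_induction with
  | mem y hy => exact H y hy
  | algebraMap r => rw [Ring.lie_def, Algebra.commutes, sub_self]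
  | add y z _ _ h1 h2 => rw [bracket_add, h1, h2, add_zero]
  | mul y z hy hz h1 h2 =>
    rw [bracket_mul, h1, h2, zero_mul, mul_zero, add_zero]

theorem mem_adjoin_range (eps : ℕ → R) (n : ℕ) : eps n ∈ Algebra.adjoin ℂ (Set.range eps) :=
  Algebra.subset_adjoin ⟨n, rfl⟩

include D

theorem lie_e_one (n : ℕ) :
    ⁅e 1, eps n⁆ = (((n : ℂ) + 1) * q) • eps (n + 1) + a • (eps n * e 0) := by
  rw [← D.step, Ring.lie_def, mul_add, mul_smul_comm]; abel

include ha in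
theorem e_zero_mem : e 0 ∈ Algebra.adjoin ℂ (Set.range eps) := by
  have h1 := D.step 0
  rw [D.zero, mul_one, one_mul] at h1
  have h2 : e 0 = (-(a⁻¹ * q)) • eps 1 := by
    refine smul_right_cancel_of_ne ha ?_
    have : a • e 0 = -(e 1 - (e 1 + a • e 0)) := by abel
    rw [this, h1]
    simp only [zero_add, Nat.cast_zero, one_mul, smul_smul]
    match_scalars
    field_simp
  rw [h2]
  exact Subalgebra.smul_mem _ (mem_adjoin_range eps 1) _

include ha in
theorem lie_e_one_mem {x : R} (hx : x ∈ Algebra.adjoin ℂ (Set.range eps)) :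
    ⁅e 1, x⁆ ∈ Algebra.adjoin ℂ (Set.range eps) := by
  refine lie_mem_adjoin ?_ hx
  rintro _ ⟨n, rfl⟩
  rw [D.lie_e_one]
  exact add_mem (Subalgebra.smul_mem _ (mem_adjoin_range eps _) _)
    (Subalgebra.smul_mem _ (mul_mem (mem_adjoin_range eps _) (D.e_zero_mem ha)) _)

include ha in
theorem modeJ_mem (f : ℕ → R) (k : ℕ) :
    modeJ e f (-((k : ℤ) + 1)) ∈ Algebra.adjoin ℂ (Set.range eps) := by
  induction k with
  | zero =>
    simp only [Nat.cast_zero, zero_add, modeJ_neg_one]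
    exact D.e_zero_mem ha
  | succ k ih =>
    have hk := Nat.cast_add_one_ne_zero (R := ℂ) k
    have h1 := D.lie_e_one_mem ha ih
    rw [lie_e_modeJ_neg] at h1
    have := Subalgebra.smul_mem _ h1 ((k : ℂ) + 1)⁻¹
    rw [smul_smul, inv_mul_cancel₀ hk, one_smul] at this
    convert this using 2
    push_cast
    ring

include ha in
theorem lie_modeJ_mem (f : ℕ → R) (k : ℕ) {x : R}
    (hx : x ∈ Algebra.adjoin ℂ (Set.range eps)) : ⁅modeJ e f (-((k : ℤ) + 1)), x⁆ = 0 := by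
  induction k generalizing x with
  | zero =>
    simp only [Nat.cast_zero, zero_add, modeJ_neg_one]
    refine lie_eq_zero_of_adjoin ?_ hx
    rintro _ ⟨n, rfl⟩
    rw [Ring.lie_def, D.comm, sub_self]
  | succ k ih =>
    have hk := Nat.cast_add_one_ne_zero (R := ℂ) k
    refine smul_right_cancel_of_ne hk ?_
    have h2 : (((k + 1 : ℕ) : ℤ) + 1) = (k : ℤ) + 2 := by push_cast; ring
    rw [h2, ← bracket_smul_left, ← lie_e_modeJ_neg, bracket_bracket_left, ih hx, ih
        (D.lie_e_one_mem ha hx), bracket_zero,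
      sub_zero, smul_zero]

include ha in
-- A priori [V_{-2}, J_{-k}] is an unknown operator; this places it in the commutative algebra of
-- the ε's, where it can be recognised by its degree and its brackets with annihilation modes.
theorem lie_modeV_mem {x : R} (hx : x ∈ Algebra.adjoin ℂ (Set.range eps)) :
    ⁅modeV s₃ e, x⁆ ∈ Algebra.adjoin ℂ (Set.range eps) := by
  refine lie_mem_adjoin ?_ hx
  rintro _ ⟨n, rfl⟩
  have h1 : ⁅e 1, e 0⁆ = modeJ e 0 (-((1 : ℕ) + 1 : ℤ)) := by
    rw [modeJ_neg]; simp [adPow]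
  have h2 : ⁅⁅e 1, e 0⁆, eps n⁆ = 0 := by rw [h1]; exact D.lie_modeJ_mem ha 0 1 (mem_adjoin_range
      eps n)
  -- The second-order relation is bracketed with e₀. As e₀ commutes with the ε's and [P, e₀] = e₁,
  -- the operator P is replaced by e₁.
  have h3 : ⁅⁅e 2, e 0⁆, eps n⁆ = (2 * a) • (eps n * ⁅e 1, e 0⁆)
      + (2 * q) • ⁅e 1, eps (n + 1)⁆ := by
    simp only [Ring.lie_def]
    linear_combination (norm := skip) D.second n * e 0 - e 0 * D.second n - D.comm n * e 2
      + e 2 * D.comm n - (a ^ 2) • (D.comm n * e 0) - (2 * a) • (D.comm n * e 1)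
      - (2 * q) • (P * D.comm (n + 1)) + (2 * q) • (D.comm (n + 1) * P)
      + (2 * q) • (D.level * eps (n + 1))
      - (2 * q) • (eps (n + 1) * D.level)
      - (((n : ℂ) + 1) * a * q) • D.comm (n + 1)
    simp only [mul_add, add_mul, mul_sub, sub_mul, smul_mul_assoc, mul_smul_comm, mul_assoc,
      smul_add, smul_sub, smul_smul]
    match_scalars <;> ring
  rw [modeV, sub_bracket, bracket_smul_left, h2, smul_zero, sub_zero, h3, h1]
  exact add_mem (Subalgebra.smul_mem _ (mul_mem (mem_adjoin_range eps _) (D.modeJ_mem ha 0 1)) _)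
    (Subalgebra.smul_mem _ (D.lie_e_one_mem ha (mem_adjoin_range eps _)) _)

end EpsRelations

end

end

/-! ### The creation algebra, Euler's identity and the Sugawara sums -/

section

section

variable {R : Type} [Ring R] [Algebra ℂ R] {s₂ s₃ : ℂ} {e f psi : ℕ → R}

/-- The Heisenberg creation modes generate this commutative subalgebra. -/
def creationAlg (e f : ℕ → R) : Subalgebra ℂ R :=
  Algebra.adjoin ℂ (Set.range fun k : ℕ => modeJ e f (-((k : ℤ) + 1)))

theorem modeJ_mem_creationAlg (k : ℕ) : modeJ e f (-((k : ℤ) + 1)) ∈ creationAlg e f :=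
  Algebra.subset_adjoin ⟨k, rfl⟩

namespace EpsRelations

variable {a q : ℂ} {P : R} {eps : ℕ → R}

/-- The recursion for ε_n only uses e₀ and ad e₁, both of which preserve the algebra generated by
the J_{-k}. -/
theorem eps_mem_creationAlg (hq : q ≠ 0) (D : EpsRelations a q e P eps) (f : ℕ → R) (n : ℕ) :
    eps n ∈ creationAlg e f := by
  have h0 : e 0 ∈ creationAlg e f := by
    have := modeJ_mem_creationAlg (e := e) (f := f) 0
    simpa [modeJ_neg_one] using this
  induction n with
  | zero => rw [D.zero]; exact one_mem _
  | succ n ih =>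
    have hn := Nat.cast_add_one_ne_zero (R := ℂ) n
    have h1 : ⁅e 1, eps n⁆ ∈ creationAlg e f := by
      refine lie_mem_adjoin ?_ ih
      rintro _ ⟨k, rfl⟩
      simp only [lie_e_modeJ_neg]
      refine Subalgebra.smul_mem _ ?_ _
      rw [show (k : ℤ) + 2 = ((k + 1 : ℕ) : ℤ) + 1 by push_cast; ring]
      exact modeJ_mem_creationAlg (k + 1)
    have h2 : eps (n + 1) = (((n : ℂ) + 1) * q)⁻¹ • (⁅e 1, eps n⁆ - a • (eps n * e 0)) := by
      rw [D.lie_e_one, add_sub_cancel_right, smul_smul, inv_mul_cancel₀ (mul_ne_zero hn hq),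
        one_smul]
    rw [h2]
    exact Subalgebra.smul_mem _ (sub_mem h1 (Subalgebra.smul_mem _ (mul_mem ih h0) _)) _

theorem adjoin_eps_le (hq : q ≠ 0) (D : EpsRelations a q e P eps) (f : ℕ → R) :
    Algebra.adjoin ℂ (Set.range eps) ≤ creationAlg e f := by
  refine Algebra.adjoin_le ?_
  rintro _ ⟨n, rfl⟩
  exact D.eps_mem_creationAlg hq f n

end EpsRelations

/-- On polynomials in the commuting J_{-k}, [J_k, ·] acts as k ∂/∂J_{-k}, so the sum is the operator
weighting J_{-k} by k; ψ₂ measures twice that degree. Any long enough sum will do, since x involves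
finitely many modes. -/
theorem euler_identity (L : LowRelations s₂ s₃ e f psi)
    (hc : ∀ (k : ℕ) (x : R), x ∈ creationAlg e f → ⁅modeJ e f (-((k : ℤ) + 1)), x⁆ = 0)
    {x : R} (hx : x ∈ creationAlg e f) :
    ∃ N : ℕ, ∀ M, N ≤ M → ∑ k ∈ Finset.range M, modeJ e f (-((k : ℤ) + 1)) *
      ⁅modeJ e f ((k : ℤ) + 1), x⁆ = (1 / 2 : ℂ) • ⁅psi 2, x⁆ := by
  induction hx using Algebra.adjoin_induction with
  | mem y hy =>
    obtain ⟨k, rfl⟩ := hy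
    refine ⟨k + 1, fun M hM => ?_⟩
    rw [Finset.sum_eq_single_of_mem k (Finset.mem_range.2 hM)]
    · have h4 : -((k : ℤ) + 1) = -((k + 1 : ℕ) : ℤ) := by push_cast; ring
      simp only [L.psi_two_modeJ_neg]
      rw [h4, L.lie_modeJ_pos_neg, if_pos rfl, mul_smul_comm, mul_one]
      module
    · intro m _ hm
      have h4 : -((k : ℤ) + 1) = -((k + 1 : ℕ) : ℤ) := by push_cast; ring
      simp only
      rw [h4, L.lie_modeJ_pos_neg, if_neg (by omega), mul_zero]
  | algebraMap r =>
    refine ⟨0, fun M _ => ?_⟩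
    have h0 (y : R) : ⁅y, algebraMap ℂ R r⁆ = 0 := by
      rw [Ring.lie_def, Algebra.commutes, sub_self]
    simp [h0]
  | add y z _ _ h1 h2 =>
    obtain ⟨N1, h1⟩ := h1
    obtain ⟨N2, h2⟩ := h2
    refine ⟨max N1 N2, fun M hM => ?_⟩
    simp only [bracket_add, mul_add, Finset.sum_add_distrib]
    rw [h1 M (by omega), h2 M (by omega), smul_add]
  | mul y z hy hz h1 h2 =>
    obtain ⟨N1, h1⟩ := h1
    obtain ⟨N2, h2⟩ := h2
    refine ⟨max N1 N2, fun M hM => ?_⟩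
    have h3 (k : ℕ) : modeJ e f (-((k : ℤ) + 1)) * ⁅modeJ e f ((k : ℤ) + 1), y * z⁆
        = modeJ e f (-((k : ℤ) + 1)) * ⁅modeJ e f ((k : ℤ) + 1), y⁆ * z
          + y * (modeJ e f (-((k : ℤ) + 1)) * ⁅modeJ e f ((k : ℤ) + 1), z⁆) := by
      have := hc k y hy
      rw [Ring.lie_def, sub_eq_zero] at this
      rw [bracket_mul, mul_add, ← mul_assoc, ← mul_assoc, ← mul_assoc, this]
    simp only [h3, Finset.sum_add_distrib, ← Finset.sum_mul, ← Finset.mul_sum]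
    rw [h1 M (by omega), h2 M (by omega), bracket_mul, smul_add, smul_mul_assoc, mul_smul_comm]

theorem eq_zero_of_euler (L : LowRelations s₂ s₃ e f psi)
    (hc : ∀ (k : ℕ) (x : R), x ∈ creationAlg e f → ⁅modeJ e f (-((k : ℤ) + 1)), x⁆ = 0)
    {x : R} (hx : x ∈ creationAlg e f) (h0 : ∀ k : ℕ, ⁅modeJ e f ((k : ℤ) + 1), x⁆ = 0) {c : ℂ}
    (hc0 : c ≠ 0) (hd : ⁅psi 2, x⁆ = c • x) : x = 0 := by
  obtain ⟨N, hN⟩ := euler_identity L hc hx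
  have h1 := hN N le_rfl
  simp only [h0, mul_zero, Finset.sum_const_zero] at h1
  rw [hd, smul_smul, eq_comm, smul_eq_zero] at h1
  exact h1.resolve_left (by simpa using hc0)

section

variable {a q : ℂ} {P : R} {eps : ℕ → R}

theorem lie_creationAlg (ha : a ≠ 0) (D : EpsRelations a q e P eps) (f : ℕ → R)
    (k : ℕ) (x : R) (hx : x ∈ creationAlg e f) : ⁅modeJ e f (-((k : ℤ) + 1)), x⁆ = 0 := by
  refine D.lie_modeJ_mem ha f k ?_
  refine Algebra.adjoin_le ?_ hx
  rintro _ ⟨k, rfl⟩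
  exact D.modeJ_mem ha f k

theorem lie_modeJ_neg_neg (ha : a ≠ 0) (D : EpsRelations a q e P eps) (f : ℕ → R) (k l : ℕ) :
    ⁅modeJ e f (-((k : ℤ) + 1)), modeJ e f (-((l : ℤ) + 1))⁆ = 0 :=
  D.lie_modeJ_mem ha f k (D.modeJ_mem ha f l)

theorem psi_two_modeV (L : LowRelations s₂ s₃ e f psi) :
    ⁅psi 2, modeV s₃ e⁆ = (4 : ℂ) • modeV s₃ e := by
  rw [modeV, bracket_sub, bracket_smul_right, bracket_bracket_right,
    bracket_bracket_right (psi 2) (e 1)]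
  simp only [L.psi_two_e, bracket_smul_right, bracket_smul_left]
  module

/-- For n < 0 the difference of the sides lies in the creation algebra. It commutes with all J_m, m
> 0, by Jacobi and the already known case n ≥ 0, and has nonzero degree; Euler's identity kills it.
-/
theorem lie_modeV_modeJ (ha : a ≠ 0) (hq : q ≠ 0) (L : LowRelations s₂ s₃ e f psi)
    (D : EpsRelations a q e P eps) (n : ℤ) :
    ⁅modeV s₃ e, modeJ e f n⁆ = (-(2 * (n : ℂ))) • modeJ e f (n - 2) := by
  rcases le_or_gt 0 n with hn | hn
  · obtain ⟨k, rfl⟩ := Int.eq_ofNat_of_zero_le hn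
    exact_mod_cast L.lie_modeV_modeJ_nonneg k
  obtain ⟨k, rfl⟩ : ∃ k : ℕ, n = -((k : ℤ) + 1) := ⟨(-n - 1).toNat, by omega⟩
  have e3 : -((k : ℤ) + 1) - 2 = -(((k + 2 : ℕ) : ℤ) + 1) := by push_cast; ring
  rw [e3]
  have hcast : (-(2 * ((-((k : ℤ) + 1) : ℤ) : ℂ))) = 2 * ((k : ℂ) + 1) := by push_cast; ring
  rw [hcast, ← sub_eq_zero]
  have hk : 2 * (((k : ℂ) + 2) + 1) ≠ 0 := by
    have := Nat.cast_add_one_ne_zero (R := ℂ) (k + 2)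
    push_cast at this
    exact mul_ne_zero two_ne_zero this
  refine eq_zero_of_euler L (lie_creationAlg ha D f) ?_ ?_ hk ?_
  · exact sub_mem (D.adjoin_eps_le hq f (D.lie_modeV_mem ha (D.modeJ_mem ha f k)))
      (Subalgebra.smul_mem _ (modeJ_mem_creationAlg _) _)
  · intro m
    have h4 : ⁅modeJ e f ((m : ℤ) + 1), modeV s₃ e⁆
        = (2 * ((m : ℂ) + 1)) • modeJ e f ((m : ℤ) + 1 - 2) := by
      have := L.lie_modeV_modeJ_nonneg (m + 1)
      push_cast at this
      rw [← neg_bracket, this]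
      module
    have h5 : -((k : ℤ) + 1) = -((k + 1 : ℕ) : ℤ) := by push_cast; ring
    have h6 : -(((k + 2 : ℕ) : ℤ) + 1) = -((k + 3 : ℕ) : ℤ) := by push_cast; ring
    have h7 : ⁅modeV s₃ e, (if k + 1 = m + 1 then ((m : ℂ) + 1) • (1 : R) else 0)⁆ = 0 := by
      split_ifs
      · rw [bracket_smul_right, bracket_one, smul_zero]
      · simp
    rw [bracket_sub, bracket_bracket_right, h4, bracket_smul_right, bracket_smul_left, h5, h6,
      -- For J_{m+1} the brackets involve J_{m-1}, so the first two values of m are special: J_{-1}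
      -- commutes with the creation modes, and `modeJ` is 0 at index 0.
      L.lie_modeJ_pos_neg, L.lie_modeJ_pos_neg, h7, add_zero]
    rcases m with _ | _ | m
    · have h8 : ((0 : ℕ) : ℤ) + 1 - 2 = -(((0 : ℕ) : ℤ) + 1) := by simp
      rw [h8, ← h5, lie_modeJ_neg_neg ha D f]
      simp
    · simp [modeJ_zero]
    · have h8 : ((m + 1 + 1 : ℕ) : ℤ) + 1 - 2 = (m : ℤ) + 1 := by push_cast; ring
      rw [h8, L.lie_modeJ_pos_neg]
      by_cases hkm : k = m
      · subst hkm
        simp only [if_true]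
        push_cast
        module
      · rw [if_neg (by omega), if_neg (by omega)]
        simp
  · rw [bracket_sub, bracket_bracket_right, psi_two_modeV L, bracket_smul_right,
      L.psi_two_modeJ_neg, L.psi_two_modeJ_neg, bracket_smul_right, bracket_smul_left]
    push_cast
    module

end

/-- The Heisenberg relations and the action of the modes `V_{±2}` on the Heisenberg modes. -/
structure CurrentRelations (s₂ s₃ : ℂ) (e f psi : ℕ → R) : Prop extends
    LowRelations s₂ s₃ e f psi where
  lie_J : ∀ m n : ℤ, ⁅modeJ e f m, modeJ e f n⁆ = if m + n = 0 then (m : ℂ) • 1 else 0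
  lie_V : ∀ n : ℤ, ⁅modeV s₃ e, modeJ e f n⁆ = (-(2 * (n : ℂ))) • modeJ e f (n - 2)
  lie_W : ∀ n : ℤ, ⁅-modeV s₃ f, modeJ e f n⁆ = (-(2 * (n : ℂ))) • modeJ e f (n + 2)

/-- The normally ordered product of Heisenberg modes. -/
def normJ (e f : ℕ → R) (i j : ℤ) : R :=
  if i ≤ j then modeJ e f i * modeJ e f j else modeJ e f j * modeJ e f i

/-- A finite part of the sum `∑_{i+j=m} :a_{i,1} a_{j,1}:`. -/
def sugawara (e f : ℕ → R) (m K : ℤ) : R := ∑ i ∈ Finset.Icc (m - K) K, normJ e f i (m - i)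

namespace CurrentRelations

variable (C : CurrentRelations s₂ s₃ e f psi)
include C

theorem lie_mul_J (i j n : ℤ) : ⁅modeJ e f i * modeJ e f j, modeJ e f n⁆
    = (if j = -n then (-(n : ℂ)) • modeJ e f i else 0)
      + (if i = -n then (-(n : ℂ)) • modeJ e f j else 0) := by
  rw [← neg_bracket, bracket_mul, C.lie_J, C.lie_J]
  by_cases h1 : i = -n <;> by_cases h2 : j = -n
  · subst h1 h2; simp
  · have : ¬ (n + j = 0) := by omega
    subst h1; simp [h2, this]
  · have : ¬ (n + i = 0) := by omega
    subst h2; simp [h1, this]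
  · have h3 : ¬ (n + i = 0) := by omega
    have h4 : ¬ (n + j = 0) := by omega
    simp [h1, h2, h3, h4]

theorem lie_normJ_J (i j n : ℤ) : ⁅normJ e f i j, modeJ e f n⁆
    = (if j = -n then (-(n : ℂ)) • modeJ e f i else 0)
      + (if i = -n then (-(n : ℂ)) • modeJ e f j else 0) := by
  rw [normJ]
  split_ifs <;> rw [C.lie_mul_J] <;> simp [*]

/-- Each of the two factors contributes one contraction, whence the 2. The bounds say that both
contracted terms lie in the window of summation. -/
theorem lie_sugawara_J {m K n : ℤ} (h1 : m - K ≤ -n) (h2 : -n ≤ K) :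
    ⁅sugawara e f m K, modeJ e f n⁆ = (-(2 * (n : ℂ))) • modeJ e f (n + m) := by
  have h3 : ⁅sugawara e f m K, modeJ e f n⁆
      = ∑ i ∈ Finset.Icc (m - K) K, ⁅normJ e f i (m - i), modeJ e f n⁆ := by
    rw [sugawara]
    simp only [Ring.lie_def, Finset.sum_mul, Finset.mul_sum, Finset.sum_sub_distrib]
  rw [h3]
  simp only [C.lie_normJ_J, Finset.sum_add_distrib]
  have h4 (i : ℤ) : (m - i = -n) ↔ (i = n + m) := by omega
  simp only [h4, Finset.sum_ite_eq', Finset.mem_Icc]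
  rw [if_pos ⟨by omega, by omega⟩, if_pos ⟨h1, h2⟩, show m - -n = n + m by ring]
  module

theorem lie_V_sub_sugawara_J {K n : ℤ} (h1 : -2 - K ≤ -n) (h2 : -n ≤ K) :
    ⁅modeV s₃ e - sugawara e f (-2) K, modeJ e f n⁆ = 0 := by
  rw [sub_bracket, C.lie_V, C.lie_sugawara_J h1 h2, ← sub_eq_add_neg, sub_self]

theorem lie_W_sub_sugawara_J {K n : ℤ} (h1 : 2 - K ≤ -n) (h2 : -n ≤ K) :
    ⁅-modeV s₃ f - sugawara e f 2 K, modeJ e f n⁆ = 0 := by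
  rw [sub_bracket, C.lie_W, C.lie_sugawara_J h1 h2, sub_self]

/-- V_2 minus its Sugawara part commutes with every mode of the second sum; its window is smaller by
2 precisely so that all those modes are within reach of the first. -/
theorem lie_W_sub_sugawara (K : ℤ) :
    ⁅-modeV s₃ f - sugawara e f 2 K, sugawara e f (-2) (K - 2)⁆ = 0 := by
  have h3 (X : R) : ⁅X, sugawara e f (-2) (K - 2)⁆
      = ∑ i ∈ Finset.Icc (-2 - (K - 2)) (K - 2), ⁅X, normJ e f i (-2 - i)⁆ := by
    rw [sugawara]
    simp only [Ring.lie_def, Finset.sum_mul, Finset.mul_sum, Finset.sum_sub_distrib]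
  rw [h3]
  refine Finset.sum_eq_zero fun i hi => ?_
  rw [Finset.mem_Icc] at hi
  have e1 := C.lie_W_sub_sugawara_J (K := K) (n := i) (by omega) (by omega)
  have e2 := C.lie_W_sub_sugawara_J (K := K) (n := -2 - i) (by omega) (by omega)
  rw [normJ]
  split_ifs <;> rw [bracket_mul, e1, e2] <;> simp

/-- Bracketing with V_{-2} keeps the product normally ordered except for J_1J_1, where J_1J_{-1}
appears. That reordering is the central term behind the 1 in 1 + σ₂ + σ₃². -/
theorem lie_normJ_V (i : ℤ) : ⁅normJ e f i (2 - i), modeV s₃ e⁆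
    = (2 * (i : ℂ)) • normJ e f (i - 2) (2 - i) + (2 * (2 - (i : ℂ))) • normJ e f i (-i)
      + (if i = 1 then (2 : ℂ) • 1 else 0) := by
  have hV (n : ℤ) : ⁅modeV s₃ e, modeJ e f n⁆ = (-(2 * (n : ℂ))) • modeJ e f (n - 2) := C.lie_V n
  have hJ0 : modeJ e f 0 = 0 := modeJ_zero
  by_cases h1 : i = 1
  · subst h1
    have := C.lie_J 1 (-1)
    simp only [Ring.lie_def] at this
    norm_num at this
    norm_num [normJ]
    rw [← neg_bracket, bracket_mul, hV]
    norm_num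
    rw [sub_eq_iff_eq_add.1 this]
    module
  · rw [if_neg h1, add_zero]
    rcases lt_or_gt_of_ne h1 with h2 | h2
    · have e1 : normJ e f i (2 - i) = modeJ e f i * modeJ e f (2 - i) := by
        rw [normJ, if_pos (by omega)]
      have e2 : normJ e f (i - 2) (2 - i) = modeJ e f (i - 2) * modeJ e f (2 - i) := by
        rw [normJ, if_pos (by omega)]
      have e3 : normJ e f i (-i) = modeJ e f i * modeJ e f (-i) := by
        rw [normJ, if_pos (by omega)]
      rw [e1, e2, e3, ← neg_bracket, bracket_mul, hV, hV, show 2 - i - 2 = -i by ring]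
      push_cast
      simp only [smul_mul_assoc, mul_smul_comm]
      module
    · have e1 : normJ e f i (2 - i) = modeJ e f (2 - i) * modeJ e f i := by
        rw [normJ, if_neg (by omega)]
      have e2 : normJ e f (i - 2) (2 - i) = modeJ e f (2 - i) * modeJ e f (i - 2) := by
        rw [normJ]
        split_ifs with h
        · have : i = 2 := by omega
          subst this; simp [hJ0]
        · rfl
      have e3 : normJ e f i (-i) = modeJ e f (-i) * modeJ e f i := by
        rw [normJ, if_neg (by omega)]
      rw [e1, e2, e3, ← neg_bracket, bracket_mul, hV, hV, show 2 - i - 2 = -i by ring]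
      push_cast
      simp only [smul_mul_assoc, mul_smul_comm]
      module

/-- The two sums are kept apart because the shift by 2 moves the window; where they overlap the
coefficients 2(i+2) and 2(2-i) add up to 8. -/
theorem lie_sugawara_V {K : ℤ} (hK : 2 ≤ K) : ⁅sugawara e f 2 K, modeV s₃ e⁆
    = ∑ i ∈ Finset.Icc (-K) (K - 2), (2 * ((i : ℂ) + 2)) • normJ e f i (-i)
      + ∑ i ∈ Finset.Icc (2 - K) K, (2 * (2 - (i : ℂ))) • normJ e f i (-i) + (2 : ℂ) • 1 := by
  have h3 (X : R) : ⁅sugawara e f 2 K, X⁆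
      = ∑ i ∈ Finset.Icc (2 - K) K, ⁅normJ e f i (2 - i), X⁆ := by
    rw [sugawara]
    simp only [Ring.lie_def, Finset.sum_mul, Finset.mul_sum, Finset.sum_sub_distrib]
  rw [h3]
  simp only [C.lie_normJ_V, Finset.sum_add_distrib]
  rw [Finset.sum_ite_eq', if_pos (Finset.mem_Icc.2 ⟨by omega, by omega⟩)]
  congr 2
  refine Finset.sum_bij' (fun i _ => i - 2) (fun i _ => i + 2) ?_ ?_ ?_ ?_ ?_
  · intro i hi; rw [Finset.mem_Icc] at *; omega
  · intro i hi; rw [Finset.mem_Icc] at *; omega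
  · intro i _; ring
  · intro i _; ring
  · intro i _
    rw [show -(i - 2) = 2 - i by ring]
    push_cast
    congr 1
    ring

theorem lie_sub_sugawara {K : ℤ} (hK : 2 ≤ K) :
    ⁅-modeV s₃ f - sugawara e f 2 K, modeV s₃ e - sugawara e f (-2) (K - 2)⁆
      = (8 : ℂ) • psi 2 - (2 * (s₂ + s₃ ^ 2)) • 1
      - (∑ i ∈ Finset.Icc (-K) (K - 2), (2 * ((i : ℂ) + 2)) • normJ e f i (-i)
      + ∑ i ∈ Finset.Icc (2 - K) K, (2 * (2 - (i : ℂ))) • normJ e f i (-i) + (2 : ℂ) • 1) := by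
  rw [bracket_sub, C.lie_W_sub_sugawara, sub_zero, sub_bracket, C.lie_modeV_modeV,
    C.lie_sugawara_V hK]

end CurrentRelations

/-- The modes `1/k! ad_{e₁}^k V`. -/
def modeVk (s₃ : ℂ) (e : ℕ → R) (k : ℕ) : R :=
  (1 / (k.factorial : ℂ)) • adPow (e 1) k (modeV s₃ e)

theorem lie_e_modeVk (k : ℕ) : ⁅e 1, modeVk s₃ e k⁆ = ((k : ℂ) + 1) • modeVk s₃ e (k + 1) := by
  rw [modeVk, modeVk, adPow_succ, Nat.factorial_succ, bracket_smul_right, smul_smul]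
  congr 1
  have := Nat.cast_add_one_ne_zero (R := ℂ) k
  have := Nat.cast_ne_zero (R := ℂ).2 k.factorial_ne_zero
  push_cast
  field_simp

theorem CurrentRelations.lie_Vk (C : CurrentRelations s₂ s₃ e f psi) (k : ℕ) (n : ℤ) :
    ⁅modeVk s₃ e k, modeJ e f n⁆ = (-(2 * (n : ℂ))) • modeJ e f (n - k - 2) := by
  induction k generalizing n with
  | zero =>
    have : modeVk s₃ e 0 = modeV s₃ e := by simp [modeVk, adPow]
    rw [this, C.lie_V]; simp
  | succ k ih =>
    have hk := Nat.cast_add_one_ne_zero (R := ℂ) k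
    refine smul_right_cancel_of_ne hk ?_
    rw [← bracket_smul_left, ← lie_e_modeVk, bracket_bracket_left, ih, bracket_smul_right,
      C.lie_e_modeJ, C.lie_e_modeJ, bracket_smul_right, ih,
      show n - 1 - (k : ℤ) - 2 = n - k - 2 - 1 by ring,
      show n - ((k + 1 : ℕ) : ℤ) - 2 = n - k - 2 - 1 by push_cast; ring]
    push_cast
    module

end

end

section

open Filter Topology PlanePartition

/-! ### Representations on plane partitions -/

section

variable {h : Fin 3 → ℂ} {E : PlanePartition → Box → ℂ}

theorem bracket_neg_neg {R : Type} [Ring R] (x y : R) : ⁅-x, -y⁆ = ⁅x, y⁆ := by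
  simp [Ring.lie_def]

theorem adPow_neg {R : Type} [Ring R] (x y : R) (k : ℕ) : adPow x k (-y) = -adPow x k y := by
  induction k with
  | zero => rfl
  | succ k ih => rw [adPow_succ, adPow_succ, ih, bracket_neg_right]

theorem bracket_neg_swap {R : Type} [Ring R] (x y : R) : ⁅y, -x⁆ = ⁅x, y⁆ := by
  rw [bracket_neg_right, neg_bracket]

theorem neg_modeV_aux {R : Type} [Ring R] [Algebra ℂ R] (c : ℂ) (x y z : R) :
    -(⁅z, x⁆ - c • ⁅y, x⁆) = ⁅-x, -z⁆ - c • ⁅-x, -y⁆ := by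
  rw [bracket_neg_neg, bracket_neg_neg, ← neg_bracket z x, ← neg_bracket y x]
  module

/-- The brackets with ψ₃ and ψ₄ are the cubic (ψ,e) relations at j = 0 and j = 1, solved for the top
term using ψ₀ = 1 and ψ₁ = 0. -/
theorem lowRelations_of_hom {A : Type} [Ring A] [Algebra ℂ A] (g : Yangian h →ₐ[ℂ] A)
    (h1 : g (Yangian.psi h 1) = 0) :
    LowRelations (sigma2 h) (sigma3 h) (fun j => g (Yangian.e h j)) (fun j => g (Yangian.f h j))
      (fun j => g (Yangian.psi h j)) := by
  have br (x y : Free) : ⁅g (Yangian.mk h x), g (Yangian.mk h y)⁆ = g (Yangian.mk h ⁅x, y⁆) := by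
    rw [map_bracket, map_bracket]
  have p0 : g (Yangian.psi h 0) = 1 := by
    rw [Yangian.psi, Yangian.mk_rel h Rel.psi0, map_one, map_one]
  have p2 (j : ℕ) : ⁅g (Yangian.psi h 2), g (Yangian.e h j)⁆ = (2 : ℂ) • g (Yangian.e h j) := by
    simp only [Yangian.psi, Yangian.e]
    rw [br, Yangian.mk_rel h (Rel.psi2_e j), map_smul, map_smul]
  have cub (j k : ℕ) : cubic (sigma2 h) (sigma3 h) (fun i => g (Yangian.psi h i))
      (fun i => g (Yangian.e h i)) j k = 0 := by
    have := congrArg g (Yangian.mk_rel h (Rel.psi_e j k))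
    rw [map_cubic, map_cubic, map_zero, map_zero] at this
    exact this
  have p3 (j : ℕ) : ⁅g (Yangian.psi h 3), g (Yangian.e h j)⁆
      = (6 : ℂ) • g (Yangian.e h (j + 1)) + (2 * sigma3 h) • g (Yangian.e h j) := by
    have := cub 0 j
    simp only [cubic, zero_add, p2, h1, p0, zero_bracket, one_mul, mul_one] at this
    have o (x : A) : ⁅(1 : A), x⁆ = 0 := by simp [Ring.lie_def]
    simp only [o] at this
    linear_combination (norm := module) this
  refine ⟨fun j k => ?_, p0, h1, p2, fun j => ?_, p3, ?_⟩
  · simp only [Yangian.e, Yangian.f]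
    rw [br, Yangian.mk_rel h (Rel.e_f j k), Yangian.psi]
  · simp only [Yangian.psi, Yangian.f]
    rw [br, Yangian.mk_rel h (Rel.psi2_f j), map_neg, map_neg, map_smul, map_smul]
  · have := cub 1 0
    simp only [cubic, zero_add, Nat.reduceAdd, p2, p3, h1, zero_bracket, zero_mul, mul_zero] at this
    linear_combination (norm := module) this

/-- Compatibility of the square roots is forced: it is the vanishing of the matrix element of [e₀,
f₀] = 1 from |π+b⟩ to |π+a⟩, where only the paths through π and through π+a+b contribute. -/
theorem exchange_of_bracket
    (H : ⁅eMode h E 0, fMode h E 0⁆ = (1 : Module.End ℂ Fock)) : Exchange E := by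
  intro π a b ha hb hab
  have hba := addable_ins hb ha (Ne.symm hab)
  have hab' := addable_ins ha hb hab
  have h1 := congrArg (fun X : Module.End ℂ Fock => X (ket (π.ins b)) (π.ins a)) H
  have hne : π.ins b ≠ π.ins a := fun e => by
    have : b ∈ (π.ins a).boxes := e ▸ (mem_ins hb).2 (Or.inl rfl)
    rcases (mem_ins ha).1 this with h | h
    · exact hab h.symm
    · exact hb.1 h
  classical
  have e1 : (eMode h E 0 * fMode h E 0) (ket (π.ins b)) (π.ins a) = -(E π a * E π b) := by
    rw [Module.End.mul_apply, eMode, eOp_apply, Finset.sum_eq_single_of_mem a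
      (mem_remFin.2 (removable_ins ha)), del_ins ha, fMode, fOp_apply,
      Finset.sum_eq_single_of_mem b (mem_addFin.2 hb), ket_apply, if_pos rfl]
    · ring
    · intro d hd hdb
      rw [ket_apply, if_neg, mul_zero]
      intro e
      rw [mem_addFin] at hd
      have : d ∈ (π.ins b).boxes := e ▸ (mem_ins hd).2 (Or.inl rfl)
      rcases (mem_ins hb).1 this with h | h
      · exact hdb h
      · exact hd.1 h
    · intro c hc hca
      rw [mem_remFin] at hc
      rw [fMode, fOp_apply, Finset.sum_eq_zero, neg_zero, mul_zero]
      intro d hd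
      rw [mem_addFin] at hd
      rw [ket_apply, if_neg, mul_zero]
      intro e
      have : a ∈ (π.ins b).boxes :=
        e ▸ (mem_ins hd).2 (Or.inr ((mem_del hc).2 ⟨Ne.symm hca, (mem_ins ha).2 (Or.inl rfl)⟩))
      rcases (mem_ins hb).1 this with h | h
      · exact hab h
      · exact ha.1 h
  have e2 : (fMode h E 0 * eMode h E 0) (ket (π.ins b)) (π.ins a)
      = -(E (π.ins a) b * E (π.ins b) a) := by
    rw [Module.End.mul_apply, fMode, fOp_apply, Finset.sum_eq_single_of_mem b
      (mem_addFin.2 hab'), eMode, eOp_apply, Finset.sum_eq_single_of_mem a, ins_comm ha hb,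
      del_ins hba, ket_apply, if_pos rfl]
    · ring
    · rw [mem_remFin, ins_comm ha hb]; exact removable_ins hba
    · intro c hc hca
      rw [mem_remFin] at hc
      rw [ket_apply, if_neg, mul_zero]
      intro e
      have h3 : a ∈ (((π.ins a).ins b).del c).boxes :=
        (mem_del hc).2 ⟨Ne.symm hca, (mem_ins hab').2 (Or.inr ((mem_ins ha).2 (Or.inl rfl)))⟩
      rw [← e] at h3
      rcases (mem_ins hb).1 h3 with h | h
      · exact hab h
      · exact ha.1 h
    · intro d hd hdb
      rw [mem_addFin] at hd
      rw [eMode, eOp_apply, Finset.sum_eq_zero, mul_zero]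
      intro c hc
      rw [mem_remFin] at hc
      rw [ket_apply, if_neg, mul_zero]
      intro e
      have hb2 : b ∈ (((π.ins a).ins d).del c).boxes := e ▸ (mem_ins hb).2 (Or.inl rfl)
      rcases (mem_ins hd).1 ((mem_del hc).1 hb2).2 with h | h
      · exact hdb h.symm
      · rcases (mem_ins ha).1 h with h | h
        · exact hab h.symm
        · exact hb.1 h
  rw [Ring.lie_def] at h1
  simp only [Module.End.one_apply] at h1
  rw [ket_apply, if_neg hne] at h1
  have h2 : (eMode h E 0 * fMode h E 0) (ket (π.ins b)) (π.ins a)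
    - (fMode h E 0 * eMode h E 0) (ket (π.ins b)) (π.ins a) = 0 := h1
  rw [e1, e2] at h2
  linear_combination h2

theorem epsRelations_eMode (H : Generic h) (hE : HasResidues h E) (hX : Exchange E) :
    EpsRelations (h 0) (h 1 * h 2) (eMode h E) (dP h) (eps h E) := by
  refine ⟨rfl, eps_rec H, eMode_zero_comm_eps H hE hX, eMode_two_eps H hE hX, ?_⟩
  rw [eMode, dP_mul_e]
  congr 2
  funext w
  ring

/-- The amplitudes of a representation on plane partitions. -/
structure IsAmplitude (h : Fin 3 → ℂ) (ρ : Yangian h →ₐ[ℂ] Module.End ℂ Fock)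
    (E : PlanePartition → Box → ℂ) : Prop where
  residues : HasResidues h E
  exchange : Exchange E
  map_e : ∀ j, ρ (Yangian.e h j) = eMode h E j
  map_f : ∀ j, ρ (Yangian.f h j) = fMode h E j

variable {ρ : Yangian h →ₐ[ℂ] Module.End ℂ Fock}

theorem exists_isAmplitude (hρ : IsPlanePartitionRep h ρ) : ∃ E, IsAmplitude h ρ E := by
  obtain ⟨E, c, -, hE, -, he, hf⟩ := hρ
  have h1 (j : ℕ) : ρ (Yangian.e h j) = eMode h E j := op_ext fun π => by
    rw [he, eMode, eOp_ket, sum_addFin]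
    exact Finset.sum_congr rfl fun b _ => by rw [ins_eq b.2]
  have h2 (j : ℕ) : ρ (Yangian.f h j) = fMode h E j := op_ext fun π => by
    rw [hf, fMode, fOp_ket, sum_remFin]
    exact Finset.sum_congr rfl fun b _ => by rw [del_eq b.2]
  refine ⟨E, fun π b hb => hE π ⟨b, hb⟩, exchange_of_bracket (h := h) ?_, h1, h2⟩
  rw [← h1, ← h2, ← map_bracket (B := Module.End ℂ Fock) ρ, Yangian.e, Yangian.f, ← map_bracket,
    Yangian.mk_rel h (Rel.e_f 0 0), Yangian.mk_rel h Rel.psi0, map_one, map_one]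

namespace IsAmplitude

variable (H : Generic h) (A : IsAmplitude h ρ E)
include A

theorem map_psi (j : ℕ) : ρ (Yangian.psi h j) = dOp (moment h E fun w => w ^ j) := by
  have : Yangian.psi h j = ⁅Yangian.e h j, Yangian.f h 0⁆ := by
    rw [Yangian.e, Yangian.f, ← map_bracket, Yangian.mk_rel h (Rel.e_f j 0), Yangian.psi, add_zero]
  rw [this, map_bracket (B := Module.End ℂ Fock) ρ, A.map_e, A.map_f, Ring.lie_def]
  have h2 := eOp_fOp_bracket (h := h) A.exchange (fun w => w ^ j) (fun w => w ^ 0)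
  simp only [pow_zero, mul_one] at h2
  exact h2

theorem isAdj_e (j : ℕ) : IsAdj (ρ (Yangian.e h j)) (-ρ (Yangian.f h j)) := by
  rw [A.map_e, A.map_f]; exact isAdj_eOp _ _ _

theorem isAdj_adPow {X Y : Module.End ℂ Fock} (hXY : IsAdj X Y) (k : ℕ) :
    IsAdj (adPow (ρ (Yangian.e h 1)) k X) (adPow (ρ (Yangian.f h 1)) k Y) := by
  induction k with
  | zero => exact hXY
  | succ k ih =>
    rw [adPow_succ, adPow_succ]
    have := (A.isAdj_e 1).bracket ih
    rwa [bracket_neg_swap (R := Module.End ℂ Fock)] at this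

theorem isAdj_modeJ_pos (k : ℕ) :
    IsAdj (modeJ (fun j => ρ (Yangian.e h j)) (fun j => ρ (Yangian.f h j)) (-((k : ℤ) + 1)))
      (modeJ (fun j => ρ (Yangian.e h j)) (fun j => ρ (Yangian.f h j)) ((k : ℤ) + 1)) := by
  rw [modeJ_neg, modeJ_pos]
  have := (A.isAdj_adPow (A.isAdj_e 0) k).smul (1 / (k.factorial : ℂ))
  rw [adPow_neg (R := Module.End ℂ Fock)] at this
  rwa [smul_neg (A := Module.End ℂ Fock)] at this

theorem isAdj_modeJ (n : ℤ) :
    IsAdj (modeJ (fun j => ρ (Yangian.e h j)) (fun j => ρ (Yangian.f h j)) n)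
      (modeJ (fun j => ρ (Yangian.e h j)) (fun j => ρ (Yangian.f h j)) (-n)) := by
  rcases lt_trichotomy n 0 with hn | rfl | hn
  · obtain ⟨k, rfl⟩ : ∃ k : ℕ, n = -((k : ℤ) + 1) := ⟨(-n - 1).toNat, by omega⟩
    rw [neg_neg]; exact A.isAdj_modeJ_pos k
  · exact IsAdj.zero
  · obtain ⟨k, rfl⟩ : ∃ k : ℕ, n = (k : ℤ) + 1 := ⟨(n - 1).toNat, by omega⟩
    exact (A.isAdj_modeJ_pos k).symm

theorem isAdj_modeV : IsAdj (modeV (sigma3 h) fun j => ρ (Yangian.e h j))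
    (-modeV (sigma3 h) fun j => ρ (Yangian.f h j)) := by
  have := ((A.isAdj_e 2).bracket (A.isAdj_e 0)).sub
    (((A.isAdj_e 1).bracket (A.isAdj_e 0)).smul (sigma3 h))
  convert this using 1
  simp only [modeV]
  exact neg_modeV_aux (R := Module.End ℂ Fock) _ _ _ _

include H

theorem lowRelations : LowRelations (sigma2 h) (sigma3 h) (fun j => ρ (Yangian.e h j))
    (fun j => ρ (Yangian.f h j)) (fun j => ρ (Yangian.psi h j)) := by
  refine lowRelations_of_hom (A := Module.End ℂ Fock) ρ ?_
  rw [A.map_psi]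
  refine op_ext fun π => ?_
  simp only [pow_one, dOp_ket, A.residues.moment_id H, zero_smul, LinearMap.zero_apply]

theorem epsRelations : EpsRelations (h 0) (h 1 * h 2) (fun j => ρ (Yangian.e h j)) (dP h)
    (eps h E) := by
  rw [show (fun j => ρ (Yangian.e h j)) = eMode h E from funext A.map_e]
  exact epsRelations_eMode H A.residues A.exchange

/-- Two negative modes commute by the ε family, and opposite signs are covered by the low relations.
Two positive modes, and V_2, are obtained by transposition. -/
theorem currentRelations : CurrentRelations (sigma2 h) (sigma3 h) (fun j => ρ (Yangian.e h j))
    (fun j => ρ (Yangian.f h j)) (fun j => ρ (Yangian.psi h j)) := by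
  have L := A.lowRelations H
  have D := A.epsRelations H
  have hV := lie_modeV_modeJ H.h0_ne (mul_ne_zero H.h1_ne H.h2_ne) L D
  have hneg (m n : ℤ) (hm : m < 0) (hn : n < 0) :
      ⁅modeJ (fun j => ρ (Yangian.e h j)) (fun j => ρ (Yangian.f h j)) m,
        modeJ (fun j => ρ (Yangian.e h j)) (fun j => ρ (Yangian.f h j)) n⁆ = 0 := by
    obtain ⟨k, rfl⟩ : ∃ k : ℕ, m = -((k : ℤ) + 1) := ⟨(-m - 1).toNat, by omega⟩
    obtain ⟨l, rfl⟩ : ∃ k : ℕ, n = -((k : ℤ) + 1) := ⟨(-n - 1).toNat, by omega⟩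
    exact lie_modeJ_neg_neg H.h0_ne D _ k l
  have hpn (m n : ℤ) (hm : 0 < m) (hn : n < 0) :
      ⁅modeJ (fun j => ρ (Yangian.e h j)) (fun j => ρ (Yangian.f h j)) m,
        modeJ (fun j => ρ (Yangian.e h j)) (fun j => ρ (Yangian.f h j)) n⁆
        = if m + n = 0 then (m : ℂ) • 1 else 0 := by
    obtain ⟨k, rfl⟩ : ∃ k : ℕ, m = (k : ℤ) + 1 := ⟨(m - 1).toNat, by omega⟩
    obtain ⟨l, rfl⟩ : ∃ k : ℕ, n = -(k : ℤ) := ⟨(-n).toNat, by omega⟩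
    rw [L.lie_modeJ_pos_neg]
    have : l = k + 1 ↔ (k : ℤ) + 1 + -l = 0 := by omega
    simp only [this]
    push_cast
    rfl
  refine { L with lie_J := fun m n => ?_, lie_V := hV, lie_W := fun n => ?_ }
  · rcases lt_trichotomy m 0 with hm | rfl | hm
    · rcases lt_trichotomy n 0 with hn | rfl | hn
      · rw [hneg m n hm hn, if_neg (by omega)]
      · rw [modeJ_zero, bracket_zero (R := Module.End ℂ Fock), if_neg (by omega)]
      · rw [← neg_bracket (A := Module.End ℂ Fock), hpn n m hn hm]
        by_cases h0 : m + n = 0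
        · rw [if_pos h0, if_pos (by omega)]
          obtain rfl : n = -m := by omega
          push_cast
          module
        · rw [if_neg h0, if_neg (by omega)]
          exact neg_zero (G := Module.End ℂ Fock)
    · rw [modeJ_zero, zero_bracket (R := Module.End ℂ Fock)]
      simp
    · rcases lt_trichotomy n 0 with hn | rfl | hn
      · exact hpn m n hm hn
      · rw [modeJ_zero, bracket_zero (R := Module.End ℂ Fock), if_neg (by omega)]
      · rw [if_neg (by omega)]
        have h1 := (A.isAdj_modeJ (-n)).bracket (A.isAdj_modeJ (-m))
        rw [neg_neg, neg_neg] at h1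
        exact h1.eq_of_eq IsAdj.zero (hneg _ _ (by omega) (by omega))
  · have h1 := (A.isAdj_modeV).bracket (A.isAdj_modeJ (-n))
    rw [neg_neg] at h1
    have h2 := h1.eq_of_eq ((A.isAdj_modeJ (-n - 2)).smul _) (hV (-n))
    rw [← neg_bracket (A := Module.End ℂ Fock), h2, show -(-n - 2) = n + 2 by ring]
    push_cast
    module

end IsAmplitude

end

end

section

open Filter Topology PlanePartition

/-! ### The filtration by the number of boxes and the normally ordered sums -/

/-- The vectors supported on diagrams with at most `N` boxes. -/
def fil (N : ℤ) : Submodule ℂ Fock := Finsupp.supported ℂ ℂ {π | (π.boxes.card : ℤ) ≤ N}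

theorem ket_mem_fil {π : PlanePartition} {N : ℤ} (hN : (π.boxes.card : ℤ) ≤ N) : ket π ∈ fil N :=
  Finsupp.single_mem_supported ℂ 1 hN

theorem fil_mono {M N : ℤ} (hMN : M ≤ N) : fil M ≤ fil N :=
  Finsupp.supported_mono fun _ hπ => le_trans hπ hMN

theorem exists_mem_fil (v : Fock) : ∃ N : ℤ, 0 ≤ N ∧ v ∈ fil N := by
  refine ⟨∑ π ∈ v.support, (π.boxes.card : ℤ), Finset.sum_nonneg fun _ _ => by positivity, ?_⟩
  intro π hπ
  exact Finset.single_le_sum (f := fun π : PlanePartition => (π.boxes.card : ℤ))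
    (fun _ _ => by positivity) hπ

theorem eq_zero_of_mem_fil {v : Fock} {N : ℤ} (hN : N < 0) (hv : v ∈ fil N) : v = 0 := by
  ext π
  by_contra h0
  have : ((π.boxes.card : ℤ)) ≤ N := hv (Finsupp.mem_support_iff.2 h0)
  have := Int.natCast_nonneg π.boxes.card
  omega

theorem fil_le_of_ket {N : ℤ} {S : Submodule ℂ Fock}
    (H : ∀ π : PlanePartition, (π.boxes.card : ℤ) ≤ N → ket π ∈ S) : fil N ≤ S := by
  rw [fil, Finsupp.supported_eq_span_single, Submodule.span_le]
  rintro _ ⟨π, hπ, rfl⟩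
  exact H π hπ

/-- The operator `X` lowers the number of boxes by `n`. -/
def Lowers (X : Module.End ℂ Fock) (n : ℤ) : Prop := ∀ N v, v ∈ fil N → X v ∈ fil (N - n)

namespace Lowers

variable {X Y : Module.End ℂ Fock} {m n : ℤ}

theorem of_ket (H : ∀ π, X (ket π) ∈ fil (π.boxes.card - n)) : Lowers X n := fun N v hv => by
  have : fil N ≤ (fil (N - n)).comap X := fil_le_of_ket fun π hπ => fil_mono (by omega) (H π)
  exact this hv

theorem zero : Lowers 0 n := fun N v _ => by simp

theorem sub (hX : Lowers X n) (hY : Lowers Y n) : Lowers (X - Y) n := fun N v hv => by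
  rw [LinearMap.sub_apply]; exact sub_mem (hX N v hv) (hY N v hv)

theorem neg (hX : Lowers X n) : Lowers (-X) n := fun N v hv => by
  rw [LinearMap.neg_apply]; exact neg_mem (hX N v hv)

theorem smul (c : ℂ) (hX : Lowers X n) : Lowers (c • X) n := fun N v hv => by
  rw [LinearMap.smul_apply]; exact Submodule.smul_mem _ _ (hX N v hv)

theorem mul (hX : Lowers X m) (hY : Lowers Y n) : Lowers (X * Y) (m + n) := fun N v hv => by
  have := hX _ _ (hY N v hv)
  rwa [show N - (m + n) = N - n - m by ring]

theorem bracket (hX : Lowers X m) (hY : Lowers Y n) : Lowers ⁅X, Y⁆ (m + n) := by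
  rw [Ring.lie_def]
  have := hY.mul hX
  rw [add_comm] at this
  exact (hX.mul hY).sub this

theorem adPow (hX : Lowers X m) (hY : Lowers Y n) (k : ℕ) :
    Lowers (adPow X k Y) (k * m + n) := by
  induction k with
  | zero => simpa [PlanePartitionYangian.adPow] using hY
  | succ k ih =>
    rw [adPow_succ]
    convert hX.bracket ih using 1
    push_cast; ring

theorem sum {ι : Type*} {s : Finset ι} {F : ι → Module.End ℂ Fock}
    (H : ∀ i ∈ s, Lowers (F i) n) : Lowers (∑ i ∈ s, F i) n := fun N v hv => by
  rw [LinearMap.sum_apply]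
  exact Submodule.sum_mem _ fun i hi => H i hi N v hv

theorem apply_eq_zero (hX : Lowers X n) {N : ℤ} {v : Fock} (hv : v ∈ fil N) (h : N < n) :
    X v = 0 := eq_zero_of_mem_fil (by omega) (hX N v hv)

end Lowers

theorem apply_of_bracket {X Y Z : Module.End ℂ Fock} (H : ⁅X, Y⁆ = Z) (v : Fock) :
    X (Y v) = Y (X v) + Z v := by
  rw [← H, Ring.lie_def]
  exact (add_sub_cancel _ _).symm

theorem apply_of_bracket_zero {X Y : Module.End ℂ Fock} (H : ⁅X, Y⁆ = 0) (v : Fock) :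
    X (Y v) = Y (X v) := by
  rw [apply_of_bracket H, LinearMap.zero_apply, add_zero]

section

variable {h : Fin 3 → ℂ} {ρ : Yangian h →ₐ[ℂ] Module.End ℂ Fock}
  {E : PlanePartition → Box → ℂ}

/-- The images of the generators `e_j`. -/
def repE (ρ : Yangian h →ₐ[ℂ] Module.End ℂ Fock) (j : ℕ) : Module.End ℂ Fock := ρ (Yangian.e h j)

/-- The images of the generators `f_j`. -/
def repF (ρ : Yangian h →ₐ[ℂ] Module.End ℂ Fock) (j : ℕ) : Module.End ℂ Fock := ρ (Yangian.f h j)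

/-- The images of the generators `ψ_j`. -/
def repPsi (ρ : Yangian h →ₐ[ℂ] Module.End ℂ Fock) (j : ℕ) : Module.End ℂ Fock :=
  ρ (Yangian.psi h j)

/-- The Heisenberg modes as operators. -/
def opJ (ρ : Yangian h →ₐ[ℂ] Module.End ℂ Fock) (n : ℤ) : Module.End ℂ Fock :=
  modeJ (repE ρ) (repF ρ) n

/-- The normally ordered products as operators. -/
def opN (ρ : Yangian h →ₐ[ℂ] Module.End ℂ Fock) (i j : ℤ) : Module.End ℂ Fock :=
  normJ (repE ρ) (repF ρ) i j

theorem map_adPow {A B : Type} [Ring A] [Algebra ℂ A] [Ring B] [Algebra ℂ B] (g : A →ₐ[ℂ] B)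
    (x y : A) (k : ℕ) : g (adPow x k y) = adPow (g x) k (g y) := by
  induction k with
  | zero => rfl
  | succ k ih => rw [adPow_succ, adPow_succ, map_bracket, ih]

theorem map_modeOne (ρ : Yangian h →ₐ[ℂ] Module.End ℂ Fock) (n : ℤ) :
    ρ (modeOne h n) = opJ ρ n := by
  rcases n with (_ | n) | n
  · exact map_zero ρ
  · simp only [modeOne, opJ, modeJ]
    rw [map_neg, map_smul, map_adPow (B := Module.End ℂ Fock)]
    rfl
  · simp only [modeOne, opJ, modeJ]
    rw [map_smul, map_adPow (B := Module.End ℂ Fock)]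
    rfl

theorem map_normalProd (ρ : Yangian h →ₐ[ℂ] Module.End ℂ Fock) (i j : ℤ) :
    ρ (normalProd h i j) = opN ρ i j := by
  rw [normalProd, opN, normJ]
  split_ifs <;> rw [map_mul, map_modeOne, map_modeOne] <;> rfl

theorem bosonSum_ket (ρ : Yangian h →ₐ[ℂ] Module.End ℂ Fock) (m : ℤ) (π : PlanePartition) :
    bosonSum ρ m (ket π) = ∑ᶠ i : ℤ, opN ρ i (m - i) (ket π) := by
  simp [bosonSum, ket, Finsupp.linearCombination_single, ← map_normalProd]

namespace IsAmplitude

variable (A : IsAmplitude h ρ E)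
include A

theorem lowers_e (j : ℕ) : Lowers (repE ρ j) (-1) := by
  refine Lowers.of_ket fun π => ?_
  rw [repE, A.map_e, eMode, eOp_ket]
  refine Submodule.sum_mem _ fun b hb => Submodule.smul_mem _ _ (ket_mem_fil ?_)
  rw [card_ins (mem_addFin.1 hb)]; push_cast; omega

theorem lowers_f (j : ℕ) : Lowers (repF ρ j) 1 := by
  refine Lowers.of_ket fun π => ?_
  rw [repF, A.map_f, fMode, fOp_ket]
  refine Submodule.sum_mem _ fun b hb => Submodule.smul_mem _ _ (ket_mem_fil ?_)
  have := card_del (mem_remFin.1 hb)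
  omega

theorem lowers_J (n : ℤ) : Lowers (opJ ρ n) n := by
  rcases lt_trichotomy n 0 with hn | rfl | hn
  · obtain ⟨k, rfl⟩ : ∃ k : ℕ, n = -((k : ℤ) + 1) := ⟨(-n - 1).toNat, by omega⟩
    rw [opJ, modeJ_neg]
    convert ((A.lowers_e 1).adPow (A.lowers_e 0) k).smul _ using 1
    ring
  · exact Lowers.zero
  · obtain ⟨k, rfl⟩ : ∃ k : ℕ, n = (k : ℤ) + 1 := ⟨(n - 1).toNat, by omega⟩
    rw [opJ, modeJ_pos]
    convert (((A.lowers_f 1).adPow (A.lowers_f 0) k).smul _).neg using 1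
    ring

theorem lowers_N (i m : ℤ) : Lowers (opN ρ i (m - i)) m := by
  rw [opN, normJ]
  split_ifs
  · have := (A.lowers_J i).mul (A.lowers_J (m - i))
    rwa [add_sub_cancel] at this
  · have := (A.lowers_J (m - i)).mul (A.lowers_J i)
    rwa [sub_add_cancel] at this

theorem N_apply_eq_zero {i j N : ℤ} {v : Fock} (hv : v ∈ fil N) (hij : N < i ∨ N < j) :
    opN ρ i j v = 0 := by
  rw [opN, normJ]
  split_ifs
  · rw [Module.End.mul_apply]
    exact (congrArg _ ((A.lowers_J j).apply_eq_zero hv (by omega))).trans (map_zero _)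
  · rw [Module.End.mul_apply]
    exact (congrArg _ ((A.lowers_J i).apply_eq_zero hv (by omega))).trans (map_zero _)

/-- J_i with i > K kills vectors of at most K boxes, and normal ordering lets the larger index act
first; so i and m - i may be restricted to at most K. -/
theorem bosonSum_apply {m K : ℤ} {v : Fock} (hv : v ∈ fil K) :
    bosonSum ρ m v = sugawara (repE ρ) (repF ρ) m K v := by
  have : fil K ≤ LinearMap.eqLocus (bosonSum ρ m) (sugawara (repE ρ) (repF ρ) m K) := by
    refine fil_le_of_ket fun π hπ => ?_
    rw [LinearMap.mem_eqLocus, bosonSum_ket, sugawara, LinearMap.sum_apply]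
    refine finsum_eq_sum_of_support_subset _ fun i hi => ?_
    rw [Function.mem_support] at hi
    rw [Finset.coe_Icc, Set.mem_Icc]
    by_contra hn
    refine hi (A.N_apply_eq_zero (ket_mem_fil hπ) ?_)
    omega
  exact this hv

theorem lowers_bosonSum (m : ℤ) : Lowers (bosonSum ρ m) m := fun N v hv => by
  rw [A.bosonSum_apply hv, sugawara]
  exact Lowers.sum (fun i _ => A.lowers_N i m) N v hv

theorem isAdj_N (i j : ℤ) : IsAdj (opN ρ i j) (opN ρ (-i) (-j)) := by
  rw [opN, opN, normJ, normJ]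
  split_ifs with h1 h2 h2
  · obtain rfl : i = j := by omega
    exact (A.isAdj_modeJ i).mul (A.isAdj_modeJ i)
  · exact (A.isAdj_modeJ i).mul (A.isAdj_modeJ j)
  · exact (A.isAdj_modeJ j).mul (A.isAdj_modeJ i)
  · omega

theorem isAdj_sugawara (m K : ℤ) : IsAdj (sugawara (repE ρ) (repF ρ) m K)
    (sugawara (repE ρ) (repF ρ) (-m) (K - m)) := by
  have h1 : sugawara (repE ρ) (repF ρ) (-m) (K - m)
      = ∑ i ∈ Finset.Icc (m - K) K, opN ρ (-i) (-(m - i)) := by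
    rw [sugawara]
    refine Finset.sum_bij' (fun i _ => -i) (fun i _ => -i) ?_ ?_ ?_ ?_ ?_
    · intro i hi; rw [Finset.mem_Icc] at *; omega
    · intro i hi; rw [Finset.mem_Icc] at *; omega
    · intro i _; ring
    · intro i _; ring
    · intro i _
      rw [neg_neg, show -(m - -i) = -m - i by ring]
      rfl
  rw [h1, sugawara]
  exact IsAdj.sum fun i _ => A.isAdj_N i (m - i)

theorem isAdj_bosonSum (m : ℤ) : IsAdj (bosonSum ρ m) (bosonSum ρ (-m)) := fun x y => by
  obtain ⟨N, hN, hx⟩ := exists_mem_fil x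
  obtain ⟨M, hM, hy⟩ := exists_mem_fil y
  -- Transposing a window of size K for index m gives size K - m for index -m; K is chosen so that
  -- both vectors fit.
  have h1 : x ∈ fil (N + M + |m|) := fil_mono (by have := abs_nonneg m; omega) hx
  have h2 : y ∈ fil (N + M + |m| - m) := fil_mono (by have := le_abs_self m; omega) hy
  rw [A.bosonSum_apply h1, A.bosonSum_apply h2, A.isAdj_sugawara]

end IsAmplitude

end

end

section

open Filter Topology PlanePartition

/-! ### The spin two modes -/

section

variable {h : Fin 3 → ℂ} {ρ : Yangian h →ₐ[ℂ] Module.End ℂ Fock}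
  {E : PlanePartition → Box → ℂ}

theorem vac_mem_fil : vac ∈ fil 0 := ket_mem_fil (by simp [PlanePartition.empty])

theorem form_vac (v : Fock) : form vac v = v PlanePartition.empty := form_ket_left _ _

theorem form_vac_vac : form vac vac = 1 := by
  classical
  rw [form_vac, vac, ket_apply, if_pos rfl]

theorem vev_eq_form (X : Module.End ℂ Fock) : vev X = form vac (X vac) := (form_vac _).symm

/-- The operator `V₋₂`. -/
def opV (ρ : Yangian h →ₐ[ℂ] Module.End ℂ Fock) : Module.End ℂ Fock := modeV (sigma3 h) (repE ρ)

/-- The operator `V₂`. -/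
def opW (ρ : Yangian h →ₐ[ℂ] Module.End ℂ Fock) : Module.End ℂ Fock := -modeV (sigma3 h) (repF ρ)

/-- The operator `V₋ₖ₋₂`. -/
def opVk (ρ : Yangian h →ₐ[ℂ] Module.End ℂ Fock) (k : ℕ) : Module.End ℂ Fock :=
  modeVk (sigma3 h) (repE ρ) k

theorem map_modeV {A : Type} [Ring A] [Algebra ℂ A] (g : Yangian h →ₐ[ℂ] A) (x : ℕ → Yangian h)
    (c : ℂ) : g (⁅x 2, x 0⁆ - c • ⁅x 1, x 0⁆) = modeV c fun j => g (x j) := by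
  rw [map_sub, map_smul, map_bracket, map_bracket]; rfl

theorem creation_eq (ρ : Yangian h →ₐ[ℂ] Module.End ℂ Fock) (k : ℕ) :
    creation ρ (k + 2) = opVk ρ k - bosonSum ρ (-((k : ℤ) + 2)) := by
  rw [creation]
  congr 1
  · rw [map_smul, map_adPow (B := Module.End ℂ Fock), map_modeV (A := Module.End ℂ Fock) ρ]
    rfl

theorem opVk_zero (ρ : Yangian h →ₐ[ℂ] Module.End ℂ Fock) : opVk ρ 0 = opV ρ := by
  simp [opVk, modeVk, adPow, opV]

theorem creation_two (ρ : Yangian h →ₐ[ℂ] Module.End ℂ Fock) :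
    creation ρ 2 = opV ρ - bosonSum ρ (-2) := by
  have := creation_eq ρ 0
  rwa [opVk_zero] at this

theorem annihilation_eq (ρ : Yangian h →ₐ[ℂ] Module.End ℂ Fock) (k : ℕ) :
    annihilation ρ (k + 2) = (1 / (k.factorial : ℂ)) • adPow (repF ρ 1) k (opW ρ)
      - bosonSum ρ ((k : ℤ) + 2) := by
  rw [annihilation]
  congr 1
  · rw [map_smul, map_adPow (B := Module.End ℂ Fock), map_modeV (A := Module.End ℂ Fock) ρ, opW,
      adPow_neg (R := Module.End ℂ Fock)]
    exact (smul_neg (A := Module.End ℂ Fock) _ _).symm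

theorem annihilation_two (ρ : Yangian h →ₐ[ℂ] Module.End ℂ Fock) :
    annihilation ρ 2 = opW ρ - bosonSum ρ 2 := by
  have := annihilation_eq ρ 0
  have h2 := one_smul ℂ (opW ρ)
  simpa [adPow, h2] using this

theorem psi_two_aux {R : Type} [Ring R] [Algebra ℂ R] {s₂ s₃ : ℂ} {e f psi : ℕ → R}
    (L : LowRelations s₂ s₃ e f psi) :
    ⁅psi 2, modeV s₃ e - e 0 * e 0⁆ = (4 : ℂ) • (modeV s₃ e - e 0 * e 0) := by
  rw [bracket_sub, psi_two_modeV L, bracket_mul, L.psi_two_e, smul_mul_assoc, mul_smul_comm]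
  module

namespace IsAmplitude

variable (A : IsAmplitude h ρ E)

section

include A

theorem isAdj_creation (k : ℕ) : IsAdj (creation ρ (k + 2)) (annihilation ρ (k + 2)) := by
  rw [creation_eq, annihilation_eq]
  have h1 := A.isAdj_bosonSum (-((k : ℤ) + 2))
  rw [neg_neg] at h1
  exact ((A.isAdj_adPow A.isAdj_modeV k).smul _).sub h1

theorem lowers_V : Lowers (opV ρ) (-2) :=
  ((A.lowers_e 2).bracket (A.lowers_e 0)).sub (((A.lowers_e 1).bracket (A.lowers_e 0)).smul _)

theorem lowers_W : Lowers (opW ρ) 2 :=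
  (((A.lowers_f 2).bracket (A.lowers_f 0)).sub
    (((A.lowers_f 1).bracket (A.lowers_f 0)).smul _)).neg

theorem lowers_creation : Lowers (creation ρ 2) (-2) := by
  rw [creation_two]; exact A.lowers_V.sub (A.lowers_bosonSum _)

theorem lowers_annihilation : Lowers (annihilation ρ 2) 2 := by
  rw [annihilation_two]; exact A.lowers_W.sub (A.lowers_bosonSum _)

theorem creation_apply {K : ℤ} {v : Fock} (hv : v ∈ fil K) :
    creation ρ 2 v = (opV ρ - sugawara (repE ρ) (repF ρ) (-2) K) v := by
  rw [creation_two, LinearMap.sub_apply, LinearMap.sub_apply, A.bosonSum_apply hv]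

theorem annihilation_apply {K : ℤ} {v : Fock} (hv : v ∈ fil K) :
    annihilation ρ 2 v = (opW ρ - sugawara (repE ρ) (repF ρ) 2 K) v := by
  rw [annihilation_two, LinearMap.sub_apply, LinearMap.sub_apply, A.bosonSum_apply hv]

theorem J_vac {n : ℤ} (hn : 0 ≤ n) : opJ ρ n vac = 0 := by
  rcases hn.eq_or_lt with rfl | hn
  · rfl
  · exact (A.lowers_J n).apply_eq_zero vac_mem_fil hn

theorem sum_N_apply {N : ℤ} {v : Fock} (hv : v ∈ fil N) {s : Finset ℤ}
    (hs : Finset.Icc (-N) N ⊆ s) (c : ℤ → ℂ) :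
    (∑ i ∈ s, c i • opN ρ i (-i)) v = ∑ i ∈ Finset.Icc (-N) N, c i • opN ρ i (-i) v := by
  rw [LinearMap.sum_apply]
  refine (Finset.sum_subset hs fun i _ hi => ?_).symm
  rw [LinearMap.smul_apply, A.N_apply_eq_zero hv, smul_zero]
  rw [Finset.mem_Icc] at hi
  omega

end

variable (H : Generic h)
include A H

theorem relations : CurrentRelations (sigma2 h) (sigma3 h) (repE ρ) (repF ρ) (repPsi ρ) :=
  A.currentRelations H

/-- On a diagram with N boxes all infinite sums become finite windows. The terms beyond [-N, N] in
the two sums of `lie_sugawara_V` act as zero, and the rest combine to 8 T_0. -/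
theorem bracket_annihilation_creation : ⁅annihilation ρ 2, creation ρ 2⁆ =
    (8 : ℂ) • zeroMode ρ - (2 * (1 + sigma2 h + sigma3 h ^ 2)) • (1 : Module.End ℂ Fock) := by
  refine op_ext fun π => ?_
  set v := ket π
  set N : ℤ := (π.boxes.card : ℤ) with hN
  have hN0 : 0 ≤ N := by positivity
  have hv : v ∈ fil N := ket_mem_fil le_rfl
  -- The window N + 2 accommodates the two boxes added by the creation operator, and the creation
  -- operator itself only needs N.
  have h1 : ⁅annihilation ρ 2, creation ρ 2⁆ v
      = ⁅opW ρ - sugawara (repE ρ) (repF ρ) 2 (N + 2),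
          opV ρ - sugawara (repE ρ) (repF ρ) (-2) (N + 2 - 2)⁆ v := by
    rw [Ring.lie_def, Ring.lie_def]
    change annihilation ρ 2 (creation ρ 2 v) - creation ρ 2 (annihilation ρ 2 v) = _ - _
    rw [Module.End.mul_apply, Module.End.mul_apply]
    have a1 := A.lowers_creation N v hv
    have a2 := A.lowers_annihilation N v hv
    rw [A.annihilation_apply (K := N + 2) (fil_mono (by omega) a1),
      A.creation_apply (K := N + 2 - 2) (fil_mono (by omega) hv),
      A.annihilation_apply (K := N + 2) (fil_mono (by omega) hv),
      A.creation_apply (K := N + 2 - 2)]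
    rw [← A.annihilation_apply (K := N + 2) (fil_mono (by omega) hv)]
    exact fil_mono (by omega) a2
  have h2 : zeroMode ρ v = repPsi ρ 2 v - ∑ i ∈ Finset.Icc (-N) N, opN ρ i (-i) v := by
    rw [zeroMode, LinearMap.sub_apply, A.bosonSum_apply hv, sugawara, LinearMap.sum_apply]
    simp only [zero_sub]
    rfl
  have h3 := (A.relations H).lie_sub_sugawara (K := N + 2) (by omega)
  have h4 := A.sum_N_apply hv (s := Finset.Icc (-(N + 2)) (N + 2 - 2))
    (Finset.Icc_subset_Icc (by omega) (by omega)) fun i => 2 * ((i : ℂ) + 2)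
  have h5 := A.sum_N_apply hv (s := Finset.Icc (2 - (N + 2)) (N + 2))
    (Finset.Icc_subset_Icc (by omega) (by omega)) fun i => 2 * (2 - (i : ℂ))
  rw [h1]
  refine (congrArg (fun X : Module.End ℂ Fock => X v) h3).trans ?_
  simp only [LinearMap.sub_apply, LinearMap.add_apply, LinearMap.smul_apply, Module.End.one_apply]
  rw [h2]
  change _ - ((∑ i ∈ Finset.Icc (-(N + 2)) (N + 2 - 2), (2 * ((i : ℂ) + 2)) • opN ρ i (-i)) v
    + (∑ i ∈ Finset.Icc (2 - (N + 2)) (N + 2), (2 * (2 - (i : ℂ))) • opN ρ i (-i)) v + _) = _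
  rw [h4, h5, ← Finset.sum_add_distrib]
  have h6 (i : ℤ) : (2 * ((i : ℂ) + 2)) • opN ρ i (-i) v + (2 * (2 - (i : ℂ))) • opN ρ i (-i) v
      = (8 : ℂ) • opN ρ i (-i) v := by module
  simp only [h6, ← Finset.smul_sum]
  module

/-- The decoupling of P₂₂ from the boson. It makes the vectors P₂₂ᵏ|0⟩ vacua for all J_n with n ≥ 0.
-/
theorem J_creation {n : ℤ} (v : Fock) :
    opJ ρ n (creation ρ 2 v) = creation ρ 2 (opJ ρ n v) := by
  obtain ⟨N, hN, hv⟩ := exists_mem_fil v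
  have h1 := (A.relations H).lie_V_sub_sugawara_J (K := N + |n|) (n := n)
    (by have := le_abs_self n; omega) (by have := neg_le_abs n; omega)
  have h2 := A.lowers_J n N v hv
  rw [A.creation_apply (K := N + |n|) (fil_mono (by have := abs_nonneg n; omega) hv),
    A.creation_apply (K := N + |n|) (fil_mono (by have := neg_le_abs n; omega) h2)]
  exact (apply_of_bracket_zero h1 v).symm

theorem J_creation_pow {n : ℤ} (hn : 0 ≤ n) (k : ℕ) : opJ ρ n ((creation ρ 2 ^ k) vac) = 0 := by
  induction k with
  | zero => exact A.J_vac hn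
  | succ k ih => rw [pow_succ', Module.End.mul_apply, A.J_creation H, ih, map_zero]

theorem N_creation_pow {i j : ℤ} (hij : 0 ≤ i ∨ 0 ≤ j) (k : ℕ) :
    opN ρ i j ((creation ρ 2 ^ k) vac) = 0 := by
  rw [opN, normJ]
  split_ifs
  · rw [Module.End.mul_apply]
    exact (congrArg _ (A.J_creation_pow H (n := j) (by omega) k)).trans (map_zero _)
  · rw [Module.End.mul_apply]
    exact (congrArg _ (A.J_creation_pow H (n := i) (by omega) k)).trans (map_zero _)

theorem bosonSum_creation_pow (m : ℤ) (hm : -1 ≤ m) (k : ℕ) :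
    bosonSum ρ m ((creation ρ 2 ^ k) vac) = 0 := by
  obtain ⟨N, hN, hv⟩ := exists_mem_fil ((creation ρ 2 ^ k) vac)
  rw [A.bosonSum_apply hv, sugawara, LinearMap.sum_apply]
  exact Finset.sum_eq_zero fun i _ => A.N_creation_pow H (by omega) k

/-- Of all :J_iJ_{-2-i}: only i = -1 has no index ≥ 0, so T_{-2} acts on these vectors as e₀². Hence
they lie in 𝒴⁺|0⟩ although T_{-2} is an infinite sum. -/
theorem bosonSum_neg_two_creation_pow (k : ℕ) :
    bosonSum ρ (-2) ((creation ρ 2 ^ k) vac)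
      = repE ρ 0 (repE ρ 0 ((creation ρ 2 ^ k) vac)) := by
  obtain ⟨N, hN, hv⟩ := exists_mem_fil ((creation ρ 2 ^ k) vac)
  rw [A.bosonSum_apply hv, sugawara, LinearMap.sum_apply,
    Finset.sum_eq_single_of_mem (-1) (Finset.mem_Icc.2 ⟨by omega, by omega⟩)]
  · rw [normJ, if_pos (by norm_num), show (-2 : ℤ) - -1 = -1 by norm_num, modeJ_neg_one]
    rfl
  · intro i _ hi
    exact A.N_creation_pow H (by omega) k

/-- The element of the ring whose powers give the vectors `P₂₂ⁿ|0⟩`. -/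
theorem creation_pow_eq (k : ℕ) :
    (creation ρ 2 ^ k) vac = ((opV ρ - repE ρ 0 * repE ρ 0) ^ k) vac := by
  induction k with
  | zero => rfl
  | succ k ih =>
    rw [pow_succ', pow_succ', Module.End.mul_apply, Module.End.mul_apply, ← ih]
    conv_lhs => rw [creation_two, LinearMap.sub_apply, ← creation_two,
      A.bosonSum_neg_two_creation_pow H]
    rfl

theorem psi_two_vac : repPsi ρ 2 vac = 0 := by
  rw [repPsi, A.map_psi, vac, dOp_ket, A.residues.moment_sq H]
  simp [PlanePartition.empty]

theorem psi_two_creation_pow (k : ℕ) :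
    repPsi ρ 2 ((creation ρ 2 ^ k) vac) = (4 * (k : ℂ)) • (creation ρ 2 ^ k) vac := by
  rw [A.creation_pow_eq H]
  induction k with
  | zero => simpa using A.psi_two_vac H
  | succ k ih =>
    have h1 := psi_two_aux (A.relations H).toLowRelations
    rw [pow_succ', Module.End.mul_apply]
    have h2 := apply_of_bracket h1 (((opV ρ - repE ρ 0 * repE ρ 0) ^ k) vac)
    refine h2.trans ?_
    rw [ih, map_smul, LinearMap.smul_apply]
    push_cast
    change _ • (opV ρ - repE ρ 0 * repE ρ 0) _ + _ • (opV ρ - repE ρ 0 * repE ρ 0) _ = _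
    module

theorem zeroMode_creation_pow (k : ℕ) :
    zeroMode ρ ((creation ρ 2 ^ k) vac) = (4 * (k : ℂ)) • (creation ρ 2 ^ k) vac := by
  rw [zeroMode, LinearMap.sub_apply, A.bosonSum_creation_pow H 0 (by norm_num), sub_zero]
  exact A.psi_two_creation_pow H k

/-- Commuting a_{2,2} to the right sums 8 · 4i - 2(1 + σ₂ + σ₃²) over i = 0, …, k. -/
theorem annihilation_creation_pow (k : ℕ) :
    annihilation ρ 2 ((creation ρ 2 ^ (k + 1)) vac)
      = (((k : ℂ) + 1) * (-2 * (1 + sigma2 h + sigma3 h ^ 2) + 16 * k)) •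
        (creation ρ 2 ^ k) vac := by
  have h1 := A.bracket_annihilation_creation H
  induction k with
  | zero =>
    rw [zero_add, pow_one, apply_of_bracket h1, A.lowers_annihilation.apply_eq_zero vac_mem_fil
      (by norm_num), map_zero, zero_add, LinearMap.sub_apply, LinearMap.smul_apply]
    have := A.zeroMode_creation_pow H 0
    rw [pow_zero, Module.End.one_apply] at this
    rw [this, LinearMap.smul_apply, pow_zero, Module.End.one_apply]
    push_cast
    module
  | succ k ih =>
    rw [pow_succ', Module.End.mul_apply, apply_of_bracket h1, ih, map_smul, LinearMap.sub_apply,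
      LinearMap.smul_apply, LinearMap.smul_apply, A.zeroMode_creation_pow H, Module.End.one_apply,
      ← Module.End.mul_apply, ← pow_succ']
    push_cast
    module

theorem form_creation_pow (n : ℕ) :
    form ((creation ρ 2 ^ n) vac) ((creation ρ 2 ^ n) vac)
      = (n.factorial : ℂ) * ∏ j ∈ Finset.Icc 1 n,
            (-2 * (1 + sigma2 h + sigma3 h ^ 2) + 16 * ((j : ℂ) - 1)) := by
  induction n with
  | zero => simp [form_vac_vac]
  | succ n ih =>
    have h1 := A.isAdj_creation 0
    rw [zero_add] at h1
    conv_lhs => enter [1, 2]; rw [pow_succ', Module.End.mul_apply]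
    rw [h1, A.annihilation_creation_pow H, map_smul, ih, Finset.prod_Icc_succ_top (by omega),
      Nat.factorial_succ, smul_eq_mul]
    push_cast
    ring

end IsAmplitude

end

end

section

open Filter Topology PlanePartition

/-! ### The quadratic form and the norms of the vectors `a_{-n,2}|0⟩` -/

section

variable {h : Fin 3 → ℂ} {ρ : Yangian h →ₐ[ℂ] Module.End ℂ Fock}
  {E : PlanePartition → Box → ℂ}

theorem anti_e (h : Fin 3 → ℂ) (j : ℕ) :
    anti h (Yangian.e h j) = MulOpposite.op (-Yangian.f h j) := by
  rw [anti, Yangian.e, Yangian.mk, RingQuot.liftAlgHom_mkAlgHom_apply]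
  exact FreeAlgebra.lift_ι_apply _ _

theorem sum_range_mul_sub (x : ℂ) (m : ℕ) :
    ∑ a ∈ Finset.range m, (a : ℂ) * (x - a)
      = x * (m * (m - 1)) / 2 - (m - 1) * m * (2 * m - 1) / 6 := by
  induction m with
  | zero => simp
  | succ m ih => rw [Finset.sum_range_succ, ih]; push_cast; ring

theorem cast_choose_three (k : ℕ) :
    ((k + 3).choose k : ℂ) = ((k : ℂ) + 3) * (k + 2) * (k + 1) / 6 := by
  have h1 : (k + 3).choose k = (k + 3).choose 3 := Nat.choose_symm_add
  have h2 := Nat.descFactorial_eq_factorial_mul_choose (k + 3) 3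
  have h3 : (k + 3).descFactorial 3 = (k + 3) * ((k + 2) * (k + 1)) := by
    simp [Nat.descFactorial_succ]; ring
  rw [h3, show Nat.factorial 3 = 6 by rfl] at h2
  have h4 := congrArg (fun n : ℕ => (n : ℂ)) h2
  push_cast at h4
  rw [h1]
  linear_combination -h4 / 6

theorem sum_Icc_neg (k : ℕ) :
    ∑ i ∈ Finset.Icc (-((k : ℤ) + 2) - 0) 0, 2 * (-(i : ℂ)) * (((k : ℂ) + 2) + i)
      = 2 * ((k + 3).choose k : ℂ) := by
  have h1 : ∑ i ∈ Finset.Icc (-((k : ℤ) + 2) - 0) 0, 2 * (-(i : ℂ)) * (((k : ℂ) + 2) + i)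
      = ∑ a ∈ Finset.range (k + 3), 2 * ((a : ℂ) * (((k : ℂ) + 2) - a)) := by
    refine Finset.sum_bij' (fun i _ => (-i).toNat) (fun a _ => -(a : ℤ)) ?_ ?_ ?_ ?_ ?_
    · intro i hi; rw [Finset.mem_Icc] at hi; rw [Finset.mem_range]; omega
    · intro a ha; rw [Finset.mem_range] at ha; rw [Finset.mem_Icc]; omega
    · intro i hi; rw [Finset.mem_Icc] at hi; omega
    · intro a _; simp
    · intro i hi
      rw [Finset.mem_Icc] at hi
      have : (((-i).toNat : ℕ) : ℂ) = -(i : ℂ) := by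
        have : (((-i).toNat : ℕ) : ℤ) = -i := Int.toNat_of_nonneg (by omega)
        exact_mod_cast congrArg (fun n : ℤ => (n : ℂ)) this
      simp only [this]
      ring
  rw [h1, ← Finset.mul_sum, sum_range_mul_sub, cast_choose_three]
  push_cast
  ring

namespace IsAmplitude

variable (A : IsAmplitude h ρ E)

section

include A

/-- Identifies the form on 𝒴⁺|0⟩ with the diagram-orthonormal form. Its value depends only on the
two vectors, hence is independent of the elements chosen to represent them. -/
theorem isAdj_anti {y : Yangian h} (hy : y ∈ Yangian.plus h) :
    IsAdj (ρ y) (ρ (anti h y).unop) := by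
  induction hy using Algebra.adjoin_induction with
  | mem y hy =>
    obtain ⟨j, rfl⟩ := hy
    rw [anti_e, MulOpposite.unop_op, map_neg]
    exact A.isAdj_e j
  | algebraMap r =>
    rw [AlgHom.commutes ρ, AlgHom.commutes (anti h), MulOpposite.algebraMap_apply,
      MulOpposite.unop_op, AlgHom.commutes ρ,
      Algebra.algebraMap_eq_smul_one]
    exact IsAdj.one.smul r
  | add x y _ _ hx hy =>
    rw [map_add, map_add, MulOpposite.unop_add, map_add]
    exact hx.add hy
  | mul x y _ _ hx hy =>
    rw [map_mul, map_mul, MulOpposite.unop_mul, map_mul]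
    exact hx.mul hy

theorem vev_anti {x y : Yangian h} (hy : y ∈ Yangian.plus h) :
    vev (ρ ((anti h y).unop * x)) = form (ρ y vac) (ρ x vac) := by
  rw [vev_eq_form, map_mul, Module.End.mul_apply, ← A.isAdj_anti hy]

theorem e_one_vac : repE ρ 1 vac = 0 := by
  rw [repE, A.map_e, vac, eMode, eOp_ket, addFin_empty]
  simp [boxWeight_zero]

theorem e_one_Vk (k : ℕ) : repE ρ 1 (opVk ρ k vac) = ((k : ℂ) + 1) • opVk ρ (k + 1) vac := by
  have h1 := apply_of_bracket (lie_e_modeVk (R := Module.End ℂ Fock) (s₃ := sigma3 h)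
    (e := repE ρ) k) vac
  rw [A.e_one_vac, map_zero, zero_add] at h1
  exact h1

end

variable (H : Generic h)
include A H

theorem formEq_creation_pow (n : ℕ) :
    FormEq ρ ((creation ρ 2 ^ n) vac) ((creation ρ 2 ^ n) vac)
          ((n.factorial : ℂ) * ∏ j ∈ Finset.Icc 1 n,
            (-2 * (1 + sigma2 h + sigma3 h ^ 2) + 16 * ((j : ℂ) - 1))) := by
  have hmem (j : ℕ) : Yangian.e h j ∈ Yangian.plus h := Algebra.subset_adjoin ⟨j, rfl⟩
  have hbr (i j : ℕ) : ⁅Yangian.e h i, Yangian.e h j⁆ ∈ Yangian.plus h := by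
    rw [Ring.lie_def]
    exact sub_mem (mul_mem (hmem _) (hmem _)) (mul_mem (hmem _) (hmem _))
  have hex : ∃ x ∈ Yangian.plus h, ρ x vac = (creation ρ 2 ^ n) vac := by
    refine ⟨((⁅Yangian.e h 2, Yangian.e h 0⁆ - sigma3 h • ⁅Yangian.e h 1, Yangian.e h 0⁆)
      - Yangian.e h 0 * Yangian.e h 0) ^ n, ?_, ?_⟩
    · exact pow_mem (sub_mem (sub_mem (hbr _ _) (Subalgebra.smul_mem _ (hbr _ _) _))
        (mul_mem (hmem _) (hmem _))) n
    · rw [A.creation_pow_eq H, map_pow, map_sub, map_mul, map_modeV (A := Module.End ℂ Fock) ρ]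
      rfl
  refine ⟨hex, hex, fun x _ y hy hx' hy' => ?_⟩
  rw [A.vev_anti hy, hx', hy', A.form_creation_pow H]

theorem psi_two_Vk (k : ℕ) :
    repPsi ρ 2 (opVk ρ k vac) = (2 * (k : ℂ) + 4) • opVk ρ k vac := by
  induction k with
  | zero =>
    rw [opVk_zero]
    have h1 := apply_of_bracket (psi_two_modeV (A.relations H).toLowRelations) vac
    rw [A.psi_two_vac H, map_zero, zero_add] at h1
    refine h1.trans ?_
    rw [LinearMap.smul_apply]
    simp only [Nat.cast_zero, mul_zero, zero_add]
    rfl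
  | succ k ih =>
    have hk := Nat.cast_add_one_ne_zero (R := ℂ) k
    have h1 := apply_of_bracket ((A.relations H).psi_two_e 1) (opVk ρ k vac)
    rw [ih, map_smul, LinearMap.smul_apply, A.e_one_Vk, map_smul] at h1
    have h2 : ((k : ℂ) + 1) • repPsi ρ 2 (opVk ρ (k + 1) vac)
        = ((k : ℂ) + 1) • ((2 * ((k + 1 : ℕ) : ℂ) + 4) • opVk ρ (k + 1) vac) := by
      rw [h1]; push_cast; module
    exact smul_right_injective Fock hk h2

theorem f_one_Vk_zero : repF ρ 1 (opVk ρ 0 vac) = 0 := by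
  rw [opVk_zero]
  have h1 := apply_of_bracket ((A.relations H).lie_f_one_modeV) vac
  rw [LinearMap.smul_apply, A.e_one_vac, smul_zero, add_zero,
    (A.lowers_f 1).apply_eq_zero vac_mem_fil (by norm_num), map_zero] at h1
  exact h1

/-- The vectors V_{-k-2}|0⟩ form a lowest-weight sl₂-string of ψ₂-weights 4, 6, 8, … -/
theorem f_one_Vk (k : ℕ) :
    repF ρ 1 (opVk ρ (k + 1) vac) = (-((k : ℂ) + 4)) • opVk ρ k vac := by
  have hfe : ⁅repF ρ 1, repE ρ 1⁆ = -repPsi ρ 2 := (A.relations H).fe 1 1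
  induction k with
  | zero =>
    have h1 := apply_of_bracket hfe (opVk ρ 0 vac)
    rw [A.e_one_Vk, A.f_one_Vk_zero H, map_zero, zero_add, LinearMap.neg_apply,
      A.psi_two_Vk H] at h1
    simp only [Nat.cast_zero, zero_add, one_smul, mul_zero] at h1 ⊢
    rw [h1, neg_smul]
  | succ k ih =>
    have hk := Nat.cast_add_one_ne_zero (R := ℂ) (k + 1)
    have h1 := apply_of_bracket hfe (opVk ρ (k + 1) vac)
    rw [A.e_one_Vk, ih, map_smul, map_smul, A.e_one_Vk, LinearMap.neg_apply,
      A.psi_two_Vk H] at h1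
    refine smul_right_injective Fock hk (h1.trans ?_)
    push_cast
    module

/-- The sl₂-string gives (k+1)‖V_{-k-3}|0⟩‖² = (k+4)‖V_{-k-2}|0⟩‖², starting from -2(σ₂ + σ₃²), the
central term of [V_2, V_{-2}]. -/
theorem form_Vk (k : ℕ) : form (opVk ρ k vac) (opVk ρ k vac)
    = ((k + 3).choose k : ℂ) * (-2 * (sigma2 h + sigma3 h ^ 2)) := by
  induction k with
  | zero =>
    rw [opVk_zero]
    have h1 : IsAdj (opV ρ) (opW ρ) := A.isAdj_modeV
    have h2 : opW ρ (opV ρ vac) = (-2 * (sigma2 h + sigma3 h ^ 2)) • vac := by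
      have h3 := apply_of_bracket ((A.relations H).lie_modeV_modeV) vac
      rw [LinearMap.sub_apply, LinearMap.smul_apply, LinearMap.smul_apply, A.psi_two_vac H,
        Module.End.one_apply] at h3
      refine h3.trans ?_
      have h4 : opW ρ vac = 0 := A.lowers_W.apply_eq_zero vac_mem_fil (by norm_num)
      rw [opW] at h4
      rw [h4, map_zero]
      module
    rw [h1, h2, map_smul, form_vac_vac]
    simp
  | succ k ih =>
    have hk := Nat.cast_add_one_ne_zero (R := ℂ) k
    have h1 : form (repE ρ 1 (opVk ρ k vac)) (opVk ρ (k + 1) vac)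
        = ((k : ℂ) + 4) * form (opVk ρ k vac) (opVk ρ k vac) := by
      have := A.isAdj_e 1 (opVk ρ k vac) (opVk ρ (k + 1) vac)
      refine this.trans ?_
      have h2 := A.f_one_Vk H k
      rw [repF] at h2
      rw [LinearMap.neg_apply, h2, map_neg, map_smul, smul_eq_mul]
      ring
    rw [A.e_one_Vk, map_smul, LinearMap.smul_apply, smul_eq_mul, ih, cast_choose_three] at h1
    refine mul_left_cancel₀ hk (h1.trans ?_)
    rw [cast_choose_three]
    push_cast
    ring

/-- The pairing of w with a product of two creation modes depends only on how annihilation modes act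
on w. Both V_{-k-2}|0⟩ and T_{-k-2}|0⟩ satisfy the hypothesis, so they have the same pairing with
T_{-k-2}|0⟩. -/
theorem form_N_vac {k : ℕ} {i : ℤ} (hi : i ∈ Finset.Icc (-((k : ℤ) + 2) - 0) 0) {w : Fock}
    (hw : ∀ b : ℤ, 0 ≤ b → b ≤ k + 2 → opJ ρ b w = (2 * (b : ℂ)) • opJ ρ (b - k - 2) vac) :
    form w (opN ρ i (-((k : ℤ) + 2) - i) vac) = 2 * (-(i : ℂ)) * (((k : ℂ) + 2) + i) := by
  rw [Finset.mem_Icc] at hi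
  have key (a b : ℤ) (ha : 0 ≤ a) (hb : 0 ≤ b) (hab : a + b = k + 2) :
      form vac (opJ ρ a (opJ ρ b w)) = 2 * (a : ℂ) * b := by
    rw [hw b hb (by omega), map_smul, show b - k - 2 = -a by omega]
    have h1 := apply_of_bracket ((A.relations H).lie_J a (-a)) vac
    rw [if_pos (by omega), LinearMap.smul_apply, Module.End.one_apply] at h1
    have h2 : modeJ (repE ρ) (repF ρ) a vac = 0 := A.J_vac ha
    rw [h2, map_zero, zero_add] at h1
    have h3 : opJ ρ a (opJ ρ (-a) vac) = (a : ℂ) • vac := h1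
    rw [h3, map_smul, map_smul, form_vac_vac, smul_eq_mul, smul_eq_mul]
    ring
  rw [form_symm, A.isAdj_N, opN, normJ]
  split_ifs
  · refine (key (-i) (-(-((k : ℤ) + 2) - i)) (by omega) (by omega) (by omega)).trans ?_
    push_cast; ring
  · refine (key (-(-((k : ℤ) + 2) - i)) (-i) (by omega) (by omega) (by omega)).trans ?_
    push_cast; ring

theorem form_sugawara_vac {k : ℕ} {w : Fock}
    (hw : ∀ b : ℤ, 0 ≤ b → b ≤ k + 2 → opJ ρ b w = (2 * (b : ℂ)) • opJ ρ (b - k - 2) vac) :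
    form w (bosonSum ρ (-((k : ℤ) + 2)) vac) = 2 * ((k + 3).choose k : ℂ) := by
  rw [A.bosonSum_apply vac_mem_fil, sugawara, LinearMap.sum_apply, map_sum, ← sum_Icc_neg]
  exact Finset.sum_congr rfl fun i hi => A.form_N_vac H hi hw

/-- By the previous remark ‖V - T‖² = ‖V‖² - ‖T‖² on the vacuum, and ‖T‖² is twice the binomial
coefficient. -/
theorem vev_annihilation_creation (k : ℕ) :
    vev (annihilation ρ (k + 2) * creation ρ (k + 2)) =
      -2 * ((k + 3).choose k : ℂ) * (1 + sigma2 h + sigma3 h ^ 2) := by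
  rw [vev_eq_form, Module.End.mul_apply, ← A.isAdj_creation k, creation_eq, LinearMap.sub_apply]
  have hJ (b : ℤ) (hb : 0 ≤ b) (Z : Module.End ℂ Fock)
      (hZ : ⁅Z, opJ ρ b⁆ = (-(2 * (b : ℂ))) • opJ ρ (b - k - 2)) :
      opJ ρ b (Z vac) = (2 * (b : ℂ)) • opJ ρ (b - k - 2) vac := by
    have := apply_of_bracket hZ vac
    rw [A.J_vac hb, map_zero, LinearMap.smul_apply, eq_comm, neg_smul, ← sub_eq_add_neg,
      sub_eq_zero] at this
    exact this
  have h1 := A.form_sugawara_vac H (k := k) (w := opVk ρ k vac) fun b hb _ =>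
    hJ b hb _ ((A.relations H).lie_Vk k b)
  have h2 := A.form_sugawara_vac H (k := k) (w := bosonSum ρ (-((k : ℤ) + 2)) vac)
    fun b hb hb' => by
      rw [A.bosonSum_apply vac_mem_fil]
      refine hJ b hb _ ?_
      have := (A.relations H).lie_sugawara_J (m := -((k : ℤ) + 2)) (K := 0) (n := b) (by omega)
        (by omega)
      rw [show b + -((k : ℤ) + 2) = b - k - 2 by ring] at this
      exact this
  rw [map_sub, map_sub, LinearMap.sub_apply, LinearMap.sub_apply,
    form_symm (bosonSum ρ (-((k : ℤ) + 2)) vac) (opVk ρ k vac), h1, h2, A.form_Vk H]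
  ring

end IsAmplitude

/-- The three statements about a representation on plane partitions. -/
theorem spin_two_of_rep (H : Generic h) (hρ : IsPlanePartitionRep h ρ) :
      (∀ n : ℕ, 2 ≤ n →
        vev (annihilation ρ n * creation ρ n) =
          -2 * ((n + 1).choose (n - 2) : ℂ) * (1 + sigma2 h + sigma3 h ^ 2)) ∧
      ⁅annihilation ρ 2, creation ρ 2⁆ =
        (8 : ℂ) • zeroMode ρ - (2 * (1 + sigma2 h + sigma3 h ^ 2)) • (1 : Module.End ℂ Fock) ∧
      ∀ n : ℕ,
        FormEq ρ ((creation ρ 2 ^ n) vac) ((creation ρ 2 ^ n) vac)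
          ((n.factorial : ℂ) * ∏ j ∈ Finset.Icc 1 n,
            (-2 * (1 + sigma2 h + sigma3 h ^ 2) + 16 * ((j : ℂ) - 1))) := by
  obtain ⟨E, A⟩ := exists_isAmplitude hρ
  refine ⟨fun n hn => ?_, A.bracket_annihilation_creation H, A.formEq_creation_pow H⟩
  obtain ⟨k, rfl⟩ : ∃ k, n = k + 2 := ⟨n - 2, by omega⟩
  exact A.vev_annihilation_creation H k

end

end

section

open Filter Topology PlanePartition

/-! ### Construction of the amplitudes -/

section

variable {h : Fin 3 → ℂ}

/-- A square root of a complex number. -/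
def csqrt (z : ℂ) : ℂ := z ^ (((2 : ℕ) : ℂ)⁻¹)

theorem csqrt_sq (z : ℂ) : csqrt z ^ 2 = z := Complex.cpow_nat_inv_pow z two_ne_zero

/-- The difference of the weights is not a zero or a pole of `φ`. -/
def Regular (h : Fin 3 → ℂ) (a b : Box) : Prop :=
  ∀ i, boxWeight h b - boxWeight h a ≠ h i ∧ boxWeight h a - boxWeight h b ≠ h i

theorem Regular.symm {a b : Box} (H : Regular h a b) : Regular h b a := fun i => (H i).symm

theorem regular_of_addable (H : Generic h) {π : PlanePartition} {a b : Box} (ha : π.Addable a)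
    (hb : π.Addable b) (hab : a ≠ b) : Regular h a b := fun i =>
  ⟨weight_sub_ne_of_addable H ha hb hab i, weight_sub_ne_of_addable H hb ha (Ne.symm hab) i⟩

theorem Regular.sub_ne {a b : Box} (H : Regular h a b) (i : Fin 3) :
    boxWeight h b - boxWeight h a - h i ≠ 0 := sub_ne_zero.2 (H i).1

theorem Regular.add_ne {a b : Box} (H : Regular h a b) (i : Fin 3) :
    boxWeight h b - boxWeight h a + h i ≠ 0 := fun e => (H i).2 (by linear_combination -e)

theorem Regular.varphi_ne {a b : Box} (H : Regular h a b) :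
    varphi h (boxWeight h b - boxWeight h a) ≠ 0 := by
  rw [varphi]
  exact div_ne_zero (mul_ne_zero (mul_ne_zero (H.add_ne 0) (H.add_ne 1)) (H.add_ne 2))
    (mul_ne_zero (mul_ne_zero (H.sub_ne 0) (H.sub_ne 1)) (H.sub_ne 2))

theorem varphi_neg (h : Fin 3 → ℂ) (v : ℂ) : varphi h (-v) = (varphi h v)⁻¹ := by
  rw [varphi, varphi, inv_div, ← neg_div_neg_eq]
  congr 1 <;> ring

theorem Regular.tendsto {a b : Box} (H : Regular h a b) :
    Tendsto (fun u => varphi h (u - boxWeight h a)) (𝓝[≠] boxWeight h b)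
      (𝓝 (varphi h (boxWeight h b - boxWeight h a))) := by
  refine Tendsto.mono_left ?_ nhdsWithin_le_nhds
  have hc : ContinuousAt (fun u => varphi h (u - boxWeight h a)) (boxWeight h b) := by
    unfold varphi
    refine ContinuousAt.div (by fun_prop) (by fun_prop) ?_
    exact mul_ne_zero (mul_ne_zero (H.sub_ne 0) (H.sub_ne 1)) (H.sub_ne 2)
  exact hc

/-- The factor by which the amplitude of `b` changes when a box `a` is added. -/
def exchangeFactor (h : Fin 3 → ℂ) (a b : Box) : ℂ :=
  if Encodable.encode a < Encodable.encode b then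
    csqrt (varphi h (boxWeight h b - boxWeight h a))
  else (csqrt (varphi h (boxWeight h a - boxWeight h b)))⁻¹

theorem exchangeFactor_sq (h : Fin 3 → ℂ) (a b : Box) :
    exchangeFactor h a b ^ 2 = varphi h (boxWeight h b - boxWeight h a) := by
  rw [exchangeFactor]
  split_ifs
  · rw [csqrt_sq]
  · rw [inv_pow, csqrt_sq, ← varphi_neg, neg_sub]

/-- φ(v)φ(-v) = 1. An arbitrary order on boxes decides which of the two roots is chosen freely; the
other is its inverse, which removes the sign ambiguity. -/
theorem exchangeFactor_mul {a b : Box} (H : Regular h a b) (hab : a ≠ b) :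
    exchangeFactor h a b * exchangeFactor h b a = 1 := by
  have key (a b : Box) (H : Regular h a b) (hlt : Encodable.encode a < Encodable.encode b) :
      exchangeFactor h a b * exchangeFactor h b a = 1 := by
    rw [exchangeFactor, exchangeFactor, if_pos hlt, if_neg (by omega), mul_inv_cancel₀]
    intro e
    have := csqrt_sq (varphi h (boxWeight h b - boxWeight h a))
    rw [e] at this
    exact H.varphi_ne (by rw [← this]; simp)
  rcases lt_trichotomy (Encodable.encode a) (Encodable.encode b) with h1 | h1 | h1
  · exact key a b H h1
  · exact absurd (Encodable.encode_injective h1) hab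
  · rw [mul_comm]; exact key b a H.symm h1

open Classical in
/-- The factor of `(u - h_□) ψ_π(u)` that is not regular at `h_□`. -/
def singularPart (h : Fin 3 → ℂ) (π : PlanePartition) (b : Box) (u : ℂ) : ℂ :=
  (u - boxWeight h b) * ((u + sigma3 h) / u) *
    ∏ a ∈ π.boxes with ¬ Regular h a b, varphi h (u - boxWeight h a)

open Classical in
/-- The amplitude `E(π → π + □)`. -/
def amplitude (h : Fin 3 → ℂ) (π : PlanePartition) (b : Box) : ℂ :=
  csqrt (limUnder (𝓝[≠] boxWeight h b) (singularPart h π b) / sigma3 h) *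
    ∏ a ∈ π.boxes with Regular h a b, exchangeFactor h a b

/-- The boxes regular with respect to `b` contribute finite nonzero factors of φ, which are the
squares of the exchange factors. Dividing them out of (u - h_b)ψ_π(u) shows that the singular part
has a limit, so `limUnder` takes its true value. -/
theorem hasResidues_amplitude (H : Generic h) : HasResidues h (amplitude h) := by
  classical
  intro π b hb
  obtain ⟨L, hL⟩ := exists_residue H hb
  have h3 := H.sigma3_ne
  have h1 : Tendsto (fun u => ∏ a ∈ π.boxes with Regular h a b, varphi h (u - boxWeight h a))
      (𝓝[≠] boxWeight h b)
      (𝓝 (∏ a ∈ π.boxes with Regular h a b, varphi h (boxWeight h b - boxWeight h a))) :=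
    tendsto_finsetProd _ fun a ha => (Finset.mem_filter.1 ha).2.tendsto
  have hne : ∏ a ∈ π.boxes with Regular h a b, varphi h (boxWeight h b - boxWeight h a) ≠ 0 :=
    Finset.prod_ne_zero_iff.2 fun a ha => (Finset.mem_filter.1 ha).2.varphi_ne
  have hfac (u : ℂ) : (u - boxWeight h b) * psiFun h π u = singularPart h π b u *
      ∏ a ∈ π.boxes with Regular h a b, varphi h (u - boxWeight h a) := by
    rw [singularPart, psiFun, ← Finset.prod_filter_mul_prod_filter_not π.boxes
      (fun a => Regular h a b)]
    ring
  have h2 := hL.div h1 hne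
  have hlim : Tendsto (singularPart h π b) (𝓝[≠] boxWeight h b)
      (𝓝 (L / ∏ a ∈ π.boxes with Regular h a b, varphi h (boxWeight h b - boxWeight h a))) := by
    refine h2.congr' ?_
    filter_upwards [h1.eventually_ne hne] with u hu
    simp only [Pi.div_apply]
    rw [hfac, mul_div_cancel_right₀ _ hu]
  have hval : sigma3 h * amplitude h π b ^ 2 = L := by
    rw [amplitude, hlim.limUnder_eq, mul_pow, csqrt_sq, ← Finset.prod_pow]
    simp only [exchangeFactor_sq]
    field_simp
  rw [hval]
  exact hL

/-- Two addable boxes of one diagram are regular with respect to each other, so adding `a` leaves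
the singular part at `b`, and with it the chosen square root, untouched. -/
theorem amplitude_ins (H : Generic h) {π : PlanePartition} {a b : Box} (ha : π.Addable a)
    (hb : π.Addable b) (hab : a ≠ b) :
    amplitude h (π.ins a) b = amplitude h π b * exchangeFactor h a b := by
  classical
  have hr := regular_of_addable H ha hb hab
  have h1 : singularPart h (π.ins a) b = singularPart h π b := by
    funext u
    rw [singularPart, singularPart, ins_boxes ha, Finset.filter_insert, if_neg (not_not.2 hr)]
  rw [amplitude, amplitude, h1, ins_boxes ha, Finset.filter_insert, if_pos hr, Finset.prod_insert]
  · ring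
  · exact fun hm => ha.1 (Finset.mem_filter.1 hm).1

theorem exchange_amplitude (H : Generic h) : Exchange (amplitude h) := by
  intro π a b ha hb hab
  rw [amplitude_ins H ha hb hab, amplitude_ins H hb ha (Ne.symm hab)]
  linear_combination amplitude h π a * amplitude h π b *
    exchangeFactor_mul (regular_of_addable H ha hb hab) hab

end

end

section

open Filter Topology PlanePartition

/-! ### Existence of the representation -/

/-! ### Reduction of the Serre and cubic relations -/

section

variable {R : Type} [Ring R]

theorem bracket_bracket_of_eq {f a b p q : R} (ha : ⁅a, f⁆ = p) (hb : ⁅b, f⁆ = q) :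
    ⁅f, ⁅a, b⁆⁆ = ⁅q, a⁆ - ⁅p, b⁆ := by
  subst ha hb
  simp only [Ring.lie_def]; noncomm_ring

theorem bracket_anticomm_of_eq {f a b p q : R} (ha : ⁅a, f⁆ = p) (hb : ⁅b, f⁆ = q) :
    ⁅f, a * b + b * a⁆ = -(p * b + b * p) - (q * a + a * q) := by
  subst ha hb
  simp only [Ring.lie_def]; noncomm_ring

/-- The sum of `[x_a, [x_b, x_{c+1}]]` over the permutations of the indices. -/
def serreSum (x : ℕ → R) (a b c : ℕ) : R :=
  ⁅x a, ⁅x b, x (c + 1)⁆⁆ + ⁅x a, ⁅x c, x (b + 1)⁆⁆ + ⁅x b, ⁅x a, x (c + 1)⁆⁆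
    + ⁅x b, ⁅x c, x (a + 1)⁆⁆ + ⁅x c, ⁅x a, x (b + 1)⁆⁆ + ⁅x c, ⁅x b, x (a + 1)⁆⁆

theorem serre_eq_serreSum (x : ℕ → R) (j : Fin 3 → ℕ) :
    serre x j = serreSum x (j 0) (j 1) (j 2) := by
  have hu : (Finset.univ : Finset (Equiv.Perm (Fin 3))) =
      {1, Equiv.swap 0 1, Equiv.swap 0 2, Equiv.swap 1 2, Equiv.swap 0 1 * Equiv.swap 1 2,
        Equiv.swap 1 2 * Equiv.swap 0 1} := by decide
  have h3 (s : Equiv.Perm (Fin 3)) {a b c : Fin 3} (ha : s 0 = a) (hb : s 1 = b) (hc : s 2 = c) :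
      ⁅x (j (s 0)), ⁅x (j (s 1)), x (j (s 2) + 1)⁆⁆ = ⁅x (j a), ⁅x (j b), x (j c + 1)⁆⁆ := by
    rw [ha, hb, hc]
  rw [serre, hu, Finset.sum_insert (by decide), Finset.sum_insert (by decide),
    Finset.sum_insert (by decide), Finset.sum_insert (by decide), Finset.sum_insert (by decide),
    Finset.sum_singleton, serreSum,
    h3 1 (a := 0) (b := 1) (c := 2) (by decide) (by decide) (by decide),
    h3 (Equiv.swap 0 1) (a := 1) (b := 0) (c := 2) (by decide) (by decide) (by decide),
    h3 (Equiv.swap 0 2) (a := 2) (b := 1) (c := 0) (by decide) (by decide) (by decide),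
    h3 (Equiv.swap 1 2) (a := 0) (b := 2) (c := 1) (by decide) (by decide) (by decide),
    h3 (Equiv.swap 0 1 * Equiv.swap 1 2) (a := 1) (b := 2) (c := 0)
      (by decide) (by decide) (by decide),
    h3 (Equiv.swap 1 2 * Equiv.swap 0 1) (a := 2) (b := 0) (c := 1)
      (by decide) (by decide) (by decide)]
  abel

theorem serreSum_swap (x : ℕ → R) (a b c : ℕ) : serreSum x a c b = serreSum x a b c := by
  simp only [serreSum]; abel

theorem serreSum_rotate (x : ℕ → R) (a b c : ℕ) : serreSum x b c a = serreSum x a b c := by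
  simp only [serreSum]; abel

theorem bracket_serreSum {x : ℕ → R} {D : R} {m : ℕ} (hD : ∀ k, ⁅D, x k⁆ = x (k + m))
    (a b c : ℕ) : ⁅D, serreSum x a b c⁆
      = serreSum x (a + m) b c + serreSum x a (b + m) c + serreSum x a b (c + m) := by
  have key (a b c : ℕ) : ⁅D, ⁅x a, ⁅x b, x (c + 1)⁆⁆⁆ = ⁅x (a + m), ⁅x b, x (c + 1)⁆⁆
      + ⁅x a, ⁅x (b + m), x (c + 1)⁆⁆ + ⁅x a, ⁅x b, x (c + m + 1)⁆⁆ := by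
    rw [bracket_bracket_right D (x a), bracket_bracket_right D (x b), hD, hD, hD, bracket_add,
      add_right_comm c 1 m, add_assoc ⁅x (a + m), _⁆]
  simp only [serreSum, bracket_add, key]
  abel

variable [Algebra ℂ R]

theorem eq_zero_of_natCast_smul {n : ℕ} (hn : n ≠ 0) {x : R} (hx : n • x = 0) : x = 0 := by
  rw [← Nat.cast_smul_eq_nsmul ℂ] at hx
  exact (smul_eq_zero.1 hx).resolve_left (Nat.cast_ne_zero.2 hn)

/-- The Serre relations follow from the lowest one if there are derivations that shift the
indices. -/
theorem serre_eq_zero {x D : ℕ → R} (hD : ∀ m k, ⁅D m, x k⁆ = x (k + m))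
    (h0 : ⁅x 0, ⁅x 0, x 1⁆⁆ = 0) (j : Fin 3 → ℕ) : serre x j = 0 := by
  -- The indices are raised one at a time: the derivation D_a gives 3S(a,0,0) = 0, then D_b gives
  -- 2S(a,b,0) = 0, then D_c gives S(a,b,c) = 0.
  have k0 : serreSum x 0 0 0 = 0 := by simp [serreSum, h0]
  have k1 (a : ℕ) : serreSum x a 0 0 = 0 := by
    have h1 := bracket_serreSum (hD a) 0 0 0
    rw [k0, bracket_zero, zero_add, serreSum_swap x 0 a 0, ← serreSum_rotate x 0 a 0,
      serreSum_swap x a 0 0] at h1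
    exact eq_zero_of_natCast_smul three_ne_zero (by rw [succ_nsmul, two_nsmul, ← h1])
  have k2 (a b : ℕ) : serreSum x a b 0 = 0 := by
    have h1 := bracket_serreSum (hD b) a 0 0
    rw [k1, k1, bracket_zero, zero_add, zero_add, serreSum_swap x a b 0] at h1
    exact eq_zero_of_natCast_smul two_ne_zero (by rw [two_nsmul, ← h1])
  have h1 := bracket_serreSum (hD (j 2)) (j 0) (j 1) 0
  rw [k2, k2, k2, bracket_zero, zero_add, zero_add, zero_add] at h1
  rw [serre_eq_serreSum, ← h1]

variable {s₂ s₃ : ℂ} {e f psi : ℕ → R}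

/-- Bracketing with f_l replaces one e at a time by ψ, turning the (e,e) relation into two (ψ,e)
relations. -/
theorem bracket_cubic (ef : ∀ j k, ⁅e j, f k⁆ = psi (j + k))
    (hpsi : ∀ j k, cubic s₂ s₃ psi e j k = 0) (j k l : ℕ) : ⁅f l, cubic s₂ s₃ e e j k⁆ = 0 := by
  have h1 : ⁅f l, cubic s₂ s₃ e e j k⁆
      = -cubic s₂ s₃ psi e (j + l) k - cubic s₂ s₃ psi e (k + l) j := ?_
  · rw [h1, hpsi, hpsi, neg_zero, sub_zero]
  simp only [cubic, bracket_sub, bracket_add, bracket_smul_right,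
    bracket_bracket_of_eq (ef _ _) (ef _ _), bracket_anticomm_of_eq (ef _ _) (ef _ _),
    add_right_comm _ _ l]
  module

end

/-! ### The Yangian relations on Fock space -/

section

variable {h : Fin 3 → ℂ} {E : PlanePartition → Box → ℂ}

/-- A linear independence property of the powers of distinct numbers. -/
theorem eq_zero_of_sum_pow {s : Finset Box} {x c : Box → ℂ} (hx : Set.InjOn x (s : Set Box))
    (H : ∀ l : ℕ, ∑ b ∈ s, c b * x b ^ l = 0) : ∀ b ∈ s, c b = 0 := by
  classical
  have hp (p : Polynomial ℂ) : ∑ b ∈ s, c b * p.eval (x b) = 0 := by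
    simp only [Polynomial.eval_eq_sum_range, Finset.mul_sum]
    rw [Finset.sum_comm]
    refine Finset.sum_eq_zero fun l _ => ?_
    rw [← mul_zero (p.coeff l), ← H l, Finset.mul_sum]
    exact Finset.sum_congr rfl fun b _ => by ring
  intro b hb
  have h1 := hp (∏ b' ∈ s.erase b, (Polynomial.X - Polynomial.C (x b')))
  rw [Finset.sum_eq_single_of_mem b hb, Polynomial.eval_prod, mul_eq_zero] at h1
  · refine h1.resolve_right (Finset.prod_ne_zero_iff.2 fun b' hb' => ?_)
    rw [Polynomial.eval_sub, Polynomial.eval_X, Polynomial.eval_C]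
    exact sub_ne_zero.2 fun e =>
      Finset.ne_of_mem_erase hb' (hx (Finset.mem_of_mem_erase hb') hb e.symm)
  · intro b' hb' hne
    rw [Polynomial.eval_prod,
      Finset.prod_eq_zero (Finset.mem_erase.2 ⟨hne, hb'⟩) (by simp), mul_zero]

/-- The mode version of `eq_zero_of_lowering`, with a Vandermonde argument in place of the one with
simple fractions. -/
theorem eq_zero_of_fMode (H : Generic h) {v : Fock} (hv : v ∈ raised h E)
    (hf : ∀ l, fMode h E l v = 0) : v = 0 := by
  ext τ
  rw [Finsupp.zero_apply]
  by_contra h0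
  refine h0 (apply_eq_zero_of_raised hv fun b hb => ?_)
  have key := eq_zero_of_sum_pow (s := (τ.del b).addFin) (x := boxWeight h)
    (c := fun b' => E (τ.del b) b' * v ((τ.del b).ins b')) ?_ ?_ b (mem_addFin.2 (addable_del hb))
  · rw [ins_del hb] at key
    exact (mul_eq_zero.1 key).resolve_right h0
  · intro b1 h1 b2 h2 e
    rw [Finset.mem_coe, mem_addFin] at h1 h2
    by_contra hn
    exact weight_ne_of_addable H h1 h2 hn e.symm
  · intro l
    have := congrArg (fun u : Fock => u (τ.del b)) (hf l)
    simp only [fMode, fOp_apply, Finsupp.zero_apply, neg_eq_zero] at this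
    rw [← this]
    exact Finset.sum_congr rfl fun b' _ => by ring

theorem op_eq_zero_of_fMode_commute (H : Generic h) {X : Module.End ℂ Fock}
    (hX : IsRaised h E X) (hf : ∀ l, ⁅fMode h E l, X⁆ = 0) : X = 0 := by
  refine op_ext fun π => ?_
  rw [LinearMap.zero_apply]
  induction hn : π.boxes.card using Nat.strong_induction_on generalizing π with
  | _ n ih =>
    refine eq_zero_of_fMode H (hX _) fun l => ?_
    have hl : fMode h E l * X = X * fMode h E l := sub_eq_zero.1 (hf l)
    rw [← Module.End.mul_apply, hl, Module.End.mul_apply, fMode, fOp_ket, map_sum]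
    refine Finset.sum_eq_zero fun b hb => ?_
    rw [map_smul, ih _ ?_ (π.del b) rfl, smul_zero]
    have := card_del (mem_remFin.1 hb)
    omega

/-- The modes `ψ_j`. -/
def psiMode (h : Fin 3 → ℂ) (E : PlanePartition → Box → ℂ) (j : ℕ) : Module.End ℂ Fock :=
  dOp (moment h E fun w => w ^ j)

theorem bracket_eMode_fMode (hX : Exchange E) (j k : ℕ) :
    ⁅eMode h E j, fMode h E k⁆ = psiMode h E (j + k) := by
  rw [Ring.lie_def, eMode, fMode, eOp_fOp_bracket hX]
  simp only [psiMode, pow_add]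

theorem dOp_eMode_ket (d : PlanePartition → ℂ) (k : ℕ) (π : PlanePartition) :
    (dOp d * eMode h E k) (ket π)
      = ∑ b ∈ π.addFin, (d (π.ins b) * boxWeight h b ^ k * E π b) • ket (π.ins b) := by
  rw [Module.End.mul_apply, eMode, eOp_ket, map_sum]
  refine Finset.sum_congr rfl fun b _ => ?_
  rw [map_smul, dOp_ket, smul_smul]
  congr 1; ring

theorem eMode_dOp_ket (d : PlanePartition → ℂ) (k : ℕ) (π : PlanePartition) :
    (eMode h E k * dOp d) (ket π)
      = ∑ b ∈ π.addFin, (d π * boxWeight h b ^ k * E π b) • ket (π.ins b) := by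
  rw [Module.End.mul_apply, dOp_ket, map_smul, eMode, eOp_ket, Finset.smul_sum]
  refine Finset.sum_congr rfl fun b _ => ?_
  rw [smul_smul]
  congr 1; ring

theorem bracket_dOp_eMode {d : PlanePartition → ℂ} {k m : ℕ} {c : ℂ}
    (H : ∀ π b, π.Addable b → d (π.ins b) = d π + c * boxWeight h b ^ m) :
    ⁅dOp d, eMode h E k⁆ = c • eMode h E (k + m) := op_ext fun π => by
  rw [Ring.lie_def, LinearMap.sub_apply, LinearMap.smul_apply, dOp_eMode_ket, eMode_dOp_ket, eMode,
    eOp_ket, ← Finset.sum_sub_distrib, Finset.smul_sum]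
  refine Finset.sum_congr rfl fun b hb => ?_
  rw [← sub_smul, smul_smul, H π b (mem_addFin.1 hb)]
  congr 1; ring

theorem cubic_apply (s₂ s₃ : ℂ) (x y : ℕ → Module.End ℂ Fock) (j k : ℕ) (v : Fock) :
    cubic s₂ s₃ x y j k v =
      ((x (j + 3) * y k) v - (y k * x (j + 3)) v)
      - (3 : ℂ) • ((x (j + 2) * y (k + 1)) v - (y (k + 1) * x (j + 2)) v)
      + (3 : ℂ) • ((x (j + 1) * y (k + 2)) v - (y (k + 2) * x (j + 1)) v)
      - ((x j * y (k + 3)) v - (y (k + 3) * x j) v)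
      + s₂ • ((x (j + 1) * y k) v - (y k * x (j + 1)) v)
      - s₂ • ((x j * y (k + 1)) v - (y (k + 1) * x j) v)
      - s₃ • ((x j * y k) v + (y k * x j) v) := rfl

theorem moment_cubic (h : Fin 3 → ℂ) (E : PlanePartition → Box → ℂ) (π : PlanePartition)
    (x s c : ℂ) (j : ℕ) :
    moment h E (fun w => w ^ j * ((w - x) ^ 3 + s * (w - x) + c)) π
      = moment h E (fun w => w ^ (j + 3)) π - 3 * x * moment h E (fun w => w ^ (j + 2)) π
        + (3 * x ^ 2 + s) * moment h E (fun w => w ^ (j + 1)) π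
        - (x ^ 3 + s * x - c) * moment h E (fun w => w ^ j) π := by
  have : (fun w : ℂ => w ^ j * ((w - x) ^ 3 + s * (w - x) + c)) = fun w => w ^ (j + 3)
      - 3 * x * w ^ (j + 2) + (3 * x ^ 2 + s) * w ^ (j + 1) - (x ^ 3 + s * x - c) * w ^ j := by
    funext w; ring
  rw [this, moment_sub, moment_add, moment_sub, moment_smul, moment_smul, moment_smul]

/-- Coefficient by coefficient in |π+□⟩ this is the last clause of `HasResidues.moment_ins`; the
cubic relation is ψ_{π+□} = ψ_π φ with denominators cleared. -/
theorem cubic_psiMode_eMode (H : Generic h) (hE : HasResidues h E) (j k : ℕ) :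
    cubic (sigma2 h) (sigma3 h) (psiMode h E) (eMode h E) j k = 0 := op_ext fun π => by
  rw [cubic_apply]
  simp only [psiMode, dOp_eMode_ket, eMode_dOp_ket, Finset.smul_sum, ← Finset.sum_sub_distrib,
    ← Finset.sum_add_distrib, LinearMap.zero_apply]
  refine Finset.sum_eq_zero fun b hb => ?_
  have h1 := (hE.moment_ins H (mem_addFin.1 hb)).2.2.2 j
  simp only [sub_eq_add_neg _ (sigma3 h)] at h1
  rw [moment_cubic, moment_cubic] at h1
  simp only [smul_smul, ← sub_smul, ← add_smul]
  rw [← zero_smul ℂ (ket (π.ins b))]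
  congr 1
  linear_combination (boxWeight h b ^ k * E π b) * h1

theorem IsRaised.bracket {X Y : Module.End ℂ Fock} (hX : IsRaised h E X) (hY : IsRaised h E Y) :
    IsRaised h E ⁅X, Y⁆ := (hX.mul Y).sub (hY.mul X)

theorem isRaised_eMode (j : ℕ) : IsRaised h E (eMode h E j) := IsRaised.eOp _

theorem cubic_eMode_eMode (H : Generic h) (hE : HasResidues h E) (hX : Exchange E) (j k : ℕ) :
    cubic (sigma2 h) (sigma3 h) (eMode h E) (eMode h E) j k = 0 := by
  have hb (a b : ℕ) : IsRaised h E ⁅eMode h E a, eMode h E b⁆ :=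
    (isRaised_eMode a).bracket (isRaised_eMode b)
  refine op_eq_zero_of_fMode_commute (E := E) H ?_ fun l => ?_
  · exact ((((((hb _ _).sub ((hb _ _).smul _)).add ((hb _ _).smul _)).sub (hb _ _)).add
      ((hb _ _).smul _)).sub ((hb _ _).smul _)).sub
      ((((isRaised_eMode _).mul _).add ((isRaised_eMode _).mul _)).smul _)
  · exact bracket_cubic (R := Module.End ℂ Fock) (bracket_eMode_fMode hX)
      (cubic_psiMode_eMode H hE) j k l

/-- The diagonal operators ∑ h_□^m shift the index of every e_k by m, so only [e₀,[e₀,e₁]] = 0 is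
left, which is the commutation of J_{-1} with J_{-2}. -/
theorem serre_eMode (H : Generic h) (hE : HasResidues h E) (hX : Exchange E) (j : Fin 3 → ℕ) :
    serre (eMode h E) j = 0 := by
  refine serre_eq_zero (R := Module.End ℂ Fock)
    (D := fun m => dOp fun π => ∑ b ∈ π.boxes, boxWeight h b ^ m) (fun m k => ?_) ?_ j
  · have := bracket_dOp_eMode (h := h) (E := E) (k := k) (m := m) (c := 1)
      (d := fun π => ∑ b ∈ π.boxes, boxWeight h b ^ m)
      fun π b hb => by rw [sum_ins hb]; ring
    rwa [one_smul] at this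
  · have := lie_modeJ_neg_neg (R := Module.End ℂ Fock) H.h0_ne (epsRelations_eMode H hE hX)
      (fMode h E) 0 1
    rw [modeJ_neg, modeJ_neg] at this
    have h2 : ⁅eMode h E 0, ⁅eMode h E 1, eMode h E 0⁆⁆ = 0 := by
      simpa [adPow] using this
    rw [← neg_bracket (eMode h E 1), bracket_neg_right, h2]
    exact neg_zero (G := Module.End ℂ Fock)

theorem isAdj_eMode (j : ℕ) : IsAdj (eMode h E j) (-fMode h E j) := isAdj_eOp _ _ _

theorem isAdj_psiMode (j : ℕ) : IsAdj (psiMode h E j) (psiMode h E j) := isAdj_dOp _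

/-- Transposition reverses commutators but not anticommutators, so σ₃ changes sign relative to the
rest; this is the sign ε = -1 in the relations for f. -/
theorem isAdj_cubic {s₂ s₃ : ℂ} {x y x' y' : ℕ → Module.End ℂ Fock}
    (hx : ∀ j, IsAdj (x j) (x' j)) (hy : ∀ j, IsAdj (y j) (y' j)) (j k : ℕ) :
    IsAdj (cubic s₂ s₃ x y j k) (-cubic s₂ (-s₃) x' y' j k) := by
  have hb (a b : ℕ) : IsAdj ⁅x a, y b⁆ ⁅y' b, x' a⁆ := (hx a).bracket (hy b)
  have h1 := ((((((hb (j + 3) k).sub ((hb (j + 2) (k + 1)).smul 3)).add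
    ((hb (j + 1) (k + 2)).smul 3)).sub (hb j (k + 3))).add
      ((hb (j + 1) k).smul s₂)).sub ((hb j (k + 1)).smul s₂)).sub
      ((((hx j).mul (hy k)).add ((hy k).mul (hx j))).smul s₃)
  have h2 : ∀ (R : Type) [Ring R] [Algebra ℂ R] (x' y' : ℕ → R),
      ⁅y' k, x' (j + 3)⁆ - (3 : ℂ) • ⁅y' (k + 1), x' (j + 2)⁆ + (3 : ℂ) • ⁅y' (k + 2), x' (j + 1)⁆
      - ⁅y' (k + 3), x' j⁆ + s₂ • ⁅y' k, x' (j + 1)⁆ - s₂ • ⁅y' (k + 1), x' j⁆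
      - s₃ • (y' k * x' j + x' j * y' k) = -cubic s₂ (-s₃) x' y' j k := by
    intro R _ _ x' y'
    simp only [cubic, ← neg_bracket (x' _) (y' _)]
    module
  exact (h2 (Module.End ℂ Fock) x' y') ▸ h1

theorem cubic_fMode_fMode (H : Generic h) (hE : HasResidues h E) (hX : Exchange E) (j k : ℕ) :
    cubic (sigma2 h) (-sigma3 h) (fMode h E) (fMode h E) j k = 0 := by
  have h1 := (isAdj_cubic isAdj_eMode isAdj_eMode j k).eq_of_eq IsAdj.zero
    (cubic_eMode_eMode H hE hX j k)
  rw [cubic_neg] at h1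
  exact neg_eq_zero (α := Module.End ℂ Fock).1 h1

theorem cubic_psiMode_fMode (H : Generic h) (hE : HasResidues h E) (j k : ℕ) :
    cubic (sigma2 h) (-sigma3 h) (psiMode h E) (fMode h E) j k = 0 := by
  have h1 := (isAdj_cubic isAdj_psiMode isAdj_eMode j k).eq_of_eq IsAdj.zero
    (cubic_psiMode_eMode H hE j k)
  rw [cubic_neg_right] at h1
  exact neg_eq_zero (α := Module.End ℂ Fock).1 (neg_eq_zero (α := Module.End ℂ Fock).1 h1)

theorem serre_fMode (H : Generic h) (hE : HasResidues h E) (hX : Exchange E) (j : Fin 3 → ℕ) :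
    serre (fMode h E) j = 0 := by
  have h1 : IsAdj (serre (eMode h E) j) (∑ s : Equiv.Perm (Fin 3),
      -⁅fMode h E (j (s 0)), ⁅fMode h E (j (s 1)), fMode h E (j (s 2) + 1)⁆⁆) := by
    refine IsAdj.sum fun s _ => ?_
    have h2 := (isAdj_eMode (h := h) (E := E) (j (s 0))).bracket
      ((isAdj_eMode (h := h) (E := E) (j (s 1))).bracket
        (isAdj_eMode (h := h) (E := E) (j (s 2) + 1)))
    have h3 : ∀ (R : Type) [Ring R] (a b c : R), ⁅⁅-c, -b⁆, -a⁆ = -⁅a, ⁅b, c⁆⁆ := by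
      intro R _ a b c
      simp only [Ring.lie_def]; noncomm_ring
    exact (h3 (Module.End ℂ Fock) _ _ _) ▸ h2
  have h2 := h1.eq_of_eq IsAdj.zero (serre_eMode H hE hX j)
  exact neg_eq_zero (α := Module.End ℂ Fock).1
    ((Finset.sum_neg_distrib (G := Module.End ℂ Fock) _).symm.trans h2)

theorem psiMode_zero (H : Generic h) (hE : HasResidues h E) : psiMode h E 0 = 1 := by
  rw [psiMode, ← dOp_one]
  congr 1
  funext π
  simpa using hE.moment_one H π

theorem psiMode_one (H : Generic h) (hE : HasResidues h E) : psiMode h E 1 = 0 := by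
  refine op_ext fun π => ?_
  rw [psiMode, dOp_ket]
  simp [hE.moment_id H π]

theorem bracket_psiMode_two_eMode (H : Generic h) (hE : HasResidues h E) (j : ℕ) :
    ⁅psiMode h E 2, eMode h E j⁆ = (2 : ℂ) • eMode h E j :=
  bracket_dOp_eMode (m := 0) fun π b hb => by rw [(hE.moment_ins H hb).2.2.1]; simp

theorem bracket_psiMode_two_fMode (H : Generic h) (hE : HasResidues h E) (j : ℕ) :
    ⁅psiMode h E 2, fMode h E j⁆ = -((2 : ℂ) • fMode h E j) := by
  have h1 := ((isAdj_psiMode 2).bracket (isAdj_eMode j)).eq_of_eq ((isAdj_eMode j).smul 2)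
    (bracket_psiMode_two_eMode H hE j)
  have h2 : ∀ (R : Type) [Ring R] [Algebra ℂ R] (x y : R), ⁅-x, y⁆ = (2 : ℂ) • -x →
      ⁅y, x⁆ = -((2 : ℂ) • x) := fun R _ _ x y hxy => by
    rw [← neg_bracket, ← bracket_neg_left, hxy, smul_neg]
  exact h2 (Module.End ℂ Fock) _ _ h1

/-- The images of the generators. -/
def genOp (h : Fin 3 → ℂ) (E : PlanePartition → Box → ℂ) : Gen → Module.End ℂ Fock
  | Gen.e j => eMode h E j
  | Gen.f j => fMode h E j
  | Gen.psi j => psiMode h E j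

theorem lift_genOp_rel (H : Generic h) (hE : HasResidues h E) (hX : Exchange E) {x y : Free}
    (r : Rel h x y) :
    FreeAlgebra.lift ℂ (genOp h E) x = FreeAlgebra.lift ℂ (genOp h E) y := by
  have le (j : ℕ) : FreeAlgebra.lift ℂ (genOp h E) (Free.e j) = eMode h E j :=
    FreeAlgebra.lift_ι_apply _ _
  have lf (j : ℕ) : FreeAlgebra.lift ℂ (genOp h E) (Free.f j) = fMode h E j :=
    FreeAlgebra.lift_ι_apply _ _
  have lp (j : ℕ) : FreeAlgebra.lift ℂ (genOp h E) (Free.psi j) = psiMode h E j :=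
    FreeAlgebra.lift_ι_apply _ _
  have hc (s₂ s₃ : ℂ) (x y : ℕ → Free) (j k : ℕ) :=
    map_cubic (B := Module.End ℂ Fock) (FreeAlgebra.lift ℂ (genOp h E)) s₂ s₃ x y j k
  have hb (x y : Free) := map_bracket (B := Module.End ℂ Fock) (FreeAlgebra.lift ℂ (genOp h E)) x y
  have hs (x : ℕ → Free) (j : Fin 3 → ℕ) :=
    map_serre (B := Module.End ℂ Fock) (FreeAlgebra.lift ℂ (genOp h E)) x j
  have comm_one (x : Module.End ℂ Fock) : ⁅(1 : Module.End ℂ Fock), x⁆ = 0 := by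
    rw [Ring.lie_def, one_mul, mul_one, sub_self]
  cases r with
  | psi_psi j k =>
    rw [hb, lp, lp, map_zero, Ring.lie_def, psiMode, psiMode, dOp_comm, sub_self]
  | e_e j k => rw [hc, map_zero]; simp only [le]; exact cubic_eMode_eMode H hE hX j k
  | f_f j k => rw [hc, map_zero]; simp only [lf]; exact cubic_fMode_fMode H hE hX j k
  | e_f j k => rw [hb, le, lf, lp, bracket_eMode_fMode hX]
  | psi_e j k => rw [hc, map_zero]; simp only [lp, le]; exact cubic_psiMode_eMode H hE j k
  | psi_f j k => rw [hc, map_zero]; simp only [lp, lf]; exact cubic_psiMode_fMode H hE j k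
  | psi0_e j => rw [hb, lp, psiMode_zero H hE, comm_one, map_zero]
  | psi1_e j =>
    rw [hb, lp, psiMode_one H hE, map_zero]
    exact zero_bracket (R := Module.End ℂ Fock) _
  | psi2_e j => rw [hb, lp, map_smul, le, bracket_psiMode_two_eMode H hE]
  | psi0_f j => rw [hb, lp, psiMode_zero H hE, comm_one, map_zero]
  | psi1_f j =>
    rw [hb, lp, psiMode_one H hE, map_zero]
    exact zero_bracket (R := Module.End ℂ Fock) _
  | psi2_f j => rw [hb, lp, map_neg, map_smul, lf, bracket_psiMode_two_fMode H hE]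
  | serre_e j => rw [hs, map_zero]; simp only [le]; exact serre_eMode H hE hX j
  | serre_f j => rw [hs, map_zero]; simp only [lf]; exact serre_fMode H hE hX j
  | psi0 => rw [lp, map_one, psiMode_zero H hE]

/-- The representation on plane partitions with the amplitudes `E`. -/
def planePartitionRep (H : Generic h) (hE : HasResidues h E) (hX : Exchange E) :
    Yangian h →ₐ[ℂ] Module.End ℂ Fock :=
  RingQuot.liftAlgHom ℂ ⟨FreeAlgebra.lift ℂ (genOp h E), fun _ _ r => lift_genOp_rel H hE hX r⟩

theorem planePartitionRep_mk (H : Generic h) (hE : HasResidues h E) (hX : Exchange E) (g : Gen) :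
    planePartitionRep H hE hX (Yangian.mk h (FreeAlgebra.ι ℂ g)) = genOp h E g := by
  rw [planePartitionRep, Yangian.mk, RingQuot.liftAlgHom_mkAlgHom_apply, FreeAlgebra.lift_ι_apply]

theorem hasSum_pow_div {u w : ℂ} (hu : ‖w‖ < ‖u‖) :
    HasSum (fun j : ℕ => w ^ j / u ^ (j + 1)) (1 / (u - w)) := by
  have h0 : u ≠ 0 := norm_pos_iff.1 ((norm_nonneg w).trans_lt hu)
  have h1 : u - w ≠ 0 := fun e => by rw [sub_eq_zero.1 e] at hu; exact lt_irrefl _ hu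
  have h2 : ‖w / u‖ < 1 := by
    rw [norm_div]; exact (div_lt_one (norm_pos_iff.2 h0)).2 hu
  have h3 := (hasSum_geometric_of_norm_lt_one h2).mul_left u⁻¹
  have h4 : u⁻¹ * (1 - w / u)⁻¹ = 1 / (u - w) := by
    rw [one_sub_div h0]; field_simp
  rw [h4] at h3
  refine h3.congr_fun fun j => ?_
  rw [div_pow, pow_succ]; field_simp

theorem hasSum_moment {π : PlanePartition} {u : ℂ}
    (hu : ∀ b, π.Addable b ∨ π.Removable b → ‖boxWeight h b‖ < ‖u‖) :
    HasSum (fun j : ℕ => moment h E (fun w => w ^ j) π / u ^ (j + 1))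
      (moment h E (fun w => 1 / (u - w)) π) := by
  have k (s : Finset Box) (hs : ∀ b ∈ s, ‖boxWeight h b‖ < ‖u‖) (c : Box → ℂ) :
      HasSum (fun j : ℕ => ∑ b ∈ s, boxWeight h b ^ j / u ^ (j + 1) * c b)
        (∑ b ∈ s, 1 / (u - boxWeight h b) * c b) :=
    hasSum_sum fun b hb => (hasSum_pow_div (hs b hb)).mul_right (c b)
  have h1 := (k π.addFin (fun b hb => hu b (Or.inl (mem_addFin.1 hb))) fun b => E π b ^ 2).sub
    (k π.remFin (fun b hb => hu b (Or.inr (mem_remFin.1 hb))) fun b => E (π.del b) b ^ 2)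
  refine h1.congr_fun fun j => ?_
  rw [moment, sub_div, Finset.sum_div, Finset.sum_div]
  congr 1 <;> exact Finset.sum_congr rfl fun b _ => by ring

theorem eventually_norm_lt (h : Fin 3 → ℂ) (π : PlanePartition) :
    ∀ᶠ u in Bornology.cobounded ℂ,
      ∀ b, π.Addable b ∨ π.Removable b → ‖boxWeight h b‖ < ‖u‖ := by
  have k (s : Finset Box) : ∀ᶠ u in Bornology.cobounded ℂ, ∀ b ∈ s, ‖boxWeight h b‖ < ‖u‖ := by
    rw [Filter.eventually_all_finset]
    exact fun b _ => tendsto_norm_cobounded_atTop.eventually_gt_atTop _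
  filter_upwards [k π.addFin, k π.remFin] with u h1 h2 b hb
  exact hb.elim (fun hb => h1 b (mem_addFin.2 hb)) fun hb => h2 b (mem_remFin.2 hb)

theorem isPlanePartitionRep_planePartitionRep (H : Generic h) (hE : HasResidues h E)
    (hX : Exchange E) : IsPlanePartitionRep h (planePartitionRep H hE hX) := by
  refine ⟨E, fun π j => moment h E (fun w => w ^ j) π, fun π => ?_, fun π b => hE π b b.2,
    fun j π => ?_, fun j π => ?_, fun j π => ?_⟩
  · obtain ⟨M, hM⟩ := hE.moment_eq H π
    filter_upwards [eventually_norm_lt h π, eventually_cobounded_ne h (cube M)] with u h1 h2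
    rw [hM u h2, add_sub_cancel_left]
    exact (hasSum_moment h1).mul_left _
  · rw [Yangian.psi, Free.psi, planePartitionRep_mk, genOp, psiMode, dOp_ket]
  · rw [Yangian.e, Free.e, planePartitionRep_mk, genOp, eMode, eOp_ket,
      sum_addFin fun b => (boxWeight h b ^ j * E π b) • ket (π.ins b)]
    exact Finset.sum_congr rfl fun b _ => by rw [ins_eq b.2]
  · rw [Yangian.f, Free.f, planePartitionRep_mk, genOp, fMode, fOp_ket,
      sum_remFin fun b => (boxWeight h b ^ j * -E (π.del b) b) • ket (π.del b)]
    exact Finset.sum_congr rfl fun b _ => by rw [del_eq b.2]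

end

end

end PlanePartitionYangian

end

open PlanePartitionYangian in
theorem mainTheorem7 (h : Fin 3 → ℂ) (hsum : h 0 + h 1 + h 2 = 0)
    (hgen : LinearIndependent ℚ ![h 0, h 1]) :
    (∃ ρ : Yangian h →ₐ[ℂ] Module.End ℂ Fock, IsPlanePartitionRep h ρ) ∧
    ∀ ρ : Yangian h →ₐ[ℂ] Module.End ℂ Fock, IsPlanePartitionRep h ρ →
      (∀ n : ℕ, 2 ≤ n →
        vev (annihilation ρ n * creation ρ n) =
          -2 * ((n + 1).choose (n - 2) : ℂ) * (1 + sigma2 h + sigma3 h ^ 2)) ∧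
      ⁅annihilation ρ 2, creation ρ 2⁆ =
        (8 : ℂ) • zeroMode ρ - (2 * (1 + sigma2 h + sigma3 h ^ 2)) • (1 : Module.End ℂ Fock) ∧
      ∀ n : ℕ,
        FormEq ρ ((creation ρ 2 ^ n) vac) ((creation ρ 2 ^ n) vac)
          ((n.factorial : ℂ) * ∏ j ∈ Finset.Icc 1 n,
            (-2 * (1 + sigma2 h + sigma3 h ^ 2) + 16 * ((j : ℂ) - 1))) := by
  have H := generic_of_linearIndependent hsum hgen
  exact ⟨⟨_, isPlanePartitionRep_planePartitionRep H (hasResidues_amplitude H)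
    (exchange_amplitude H)⟩, fun ρ hρ => spin_two_of_rep H hρ⟩
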